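/- For $\epsilon,\delta>0$ and $n\in\mathbb Z$ let $D_{Rn}$ and $D_{Ln}$ be the open unit disks in $\mathbb R^2$ with centres $(1+\frac\epsilon2,\,n(2+\delta))$ and $(-1-\frac\epsilon2,\,n(2+\delta))$, and let $E=\mathbb R^2\setminus\overline{\bigcup_{n\in\mathbb Z}(D_{Ln}\cup D_{Rn})}$. Put $\Omega=\mathbb R\times(-1-\frac\delta2,\,1+\frac\delta2)$, $\Omega_4=\{(x,y)\in\Omega: |x|<4\}$, $$N_v=\Big\{(x,y): |x|<1+\tfrac\epsilon2-\sqrt{1-y^2},\ |y|<\tfrac{\sqrt3}2\Big\},$$ $$N_h=\Big\{(x,y): \big|y-1-\tfrac\delta2\big|<1+\tfrac\delta2-\sqrt{1-(x-1-\tfrac\epsilon2)^2},\ \big|x-1-\tfrac\epsilon2\big|<\tfrac{\sqrt3}2\Big\},$$ $$S(x,y)=-2\sqrt\delta\,\frac{(x-1-\frac\epsilon2)(y-1-\frac\delta2)}{\big((x-1-\frac\epsilon2)^2+\delta\big)^2}.$$ There are constants $C\ge 0$ and $r>0$ such that the following holds for all $\epsilon,\delta\in(0,r)$. Let $H$ be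 a harmonic function on $\mathbb R^2$ with $\nabla H(x,y)=\nabla H(x,y+2+\delta)$ for all $(x,y)$. Let $u$ be continuous on $\mathbb R^2\setminus\bigcup_n(D_{Ln}\cup D_{Rn})$ and harmonic in $E$, such that $u$ is constant on $\partial D_{L0}$ and constant on $\partial D_{R0}$; the normal derivative $\partial_\nu u$ (taken from outside the disks, $\nu$ being the unit normal pointing into the disk) satisfies $$\int_{\partial D_{L0}}\partial_\nu u\,ds=\int_{\partial D_{R0}}\partial_\nu u\,ds=0;$$ $$\int_{\Omega\setminus\overline{D_{L0}\cup D_{R0}}}|\nabla(u-H)|^2\,dx\,dy<\infty;$$ and $\nabla u(x,y)=\nabla u(x,y+2+\delta)$ for all $(x,y)\in E$. Then there exist constants $\lambda,\mu\in\mathbb R$ and vector fields $R_1,R_2$ such that $$\nabla u(x,y)=\lambda\left(\frac{1}{\delta+(x-1-\frac\epsilon2)^2}(0,1)+\frac1{\sqrt\delta}S(x,y)(1,0)\right)+R_1(x,y)\quad\text{for all }(x,y)\in N_h,$$ $$\nabla u(x,y)=\mu\,\frac{\sqrt\epsilon}{\epsilon+y^2}(1,0)+R_2(x,y)\quad\text{for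 all }(x,y)\in N_v,$$ where $\lambda=H(0,1)-H(0,-1)$, $|\mu|\le C\|H\|_{L^\infty(\Omega_4)}$, $\|S\|_{L^\infty(N_h)}\le2$, $S(1+\frac\epsilon2,1+\frac\delta2)=0$, and $$\|R_1\|_{L^\infty(N_h)}+\|R_2\|_{L^\infty(N_v)}\le C\|H\|_{L^\infty(\Omega_4)}.$$ -/

import Mathlib

open MeasureTheory Set
open scoped ENNReal NNReal

noncomputable section

namespace TwoRows

/-- The plane `ℝ²` with its Euclidean structure. -/
abbrev Plane : Type := EuclideanSpace ℝ (Fin 2)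

/-- The centre of the disk `D_{Rn}`. -/
def centerR (ε δ : ℝ) (n : ℤ) : Plane := !₂[1 + ε / 2, n * (2 + δ)]

/-- The centre of the disk `D_{Ln}`. -/
def centerL (ε δ : ℝ) (n : ℤ) : Plane := !₂[-1 - ε / 2, n * (2 + δ)]

/-- The open unit disk `D_{Rn}`. -/
def diskR (ε δ : ℝ) (n : ℤ) : Set Plane := Metric.ball (centerR ε δ n) 1

/-- The open unit disk `D_{Ln}`. -/
def diskL (ε δ : ℝ) (n : ℤ) : Set Plane := Metric.ball (centerL ε δ n) 1

/-- The union of all the open disks. -/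
def inclusions (ε δ : ℝ) : Set Plane := ⋃ n : ℤ, diskL ε δ n ∪ diskR ε δ n

/-- The exterior domain: the complement of the closure of the union of the disks. -/
def exterior (ε δ : ℝ) : Set Plane := (closure (inclusions ε δ))ᶜ

/-- The horizontal strip `Ω = ℝ × (-1 - δ/2, 1 + δ/2)`. -/
def strip (δ : ℝ) : Set Plane := {p | -1 - δ / 2 < p 1 ∧ p 1 < 1 + δ / 2}

/-- The truncated strip `Ω_m = {(x, y) ∈ Ω : |x| < m}`. -/
def stripTrunc (δ m : ℝ) : Set Plane := {p | p ∈ strip δ ∧ |p 0| < m}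

/-- The vertical translation vector `(0, 2 + δ)`. -/
def period (δ : ℝ) : Plane := !₂[0, 2 + δ]

/-- `H` is harmonic on `ℝ²` and `∇H` has period `2 + δ` in the `y` direction. -/
structure IsBackground (δ : ℝ) (H : Plane → ℝ) : Prop where
  harmonic : InnerProductSpace.HarmonicOnNhd H univ
  periodic : ∀ p, gradient H p = gradient H (p + period δ)

/-- The unit vector `(cos θ, sin θ)`. -/
def circleVec (θ : ℝ) : Plane := !₂[Real.cos θ, Real.sin θ]

/-- The one-sided derivative of `u` at the boundary point `p` in the direction `ν`, taken along
`p + t ν` with `t ≤ 0`. For `ν` pointing into a disk, it is taken from outside the disk. -/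
def HasNormalDeriv (u : Plane → ℝ) (p ν : Plane) (g : ℝ) : Prop :=
  HasDerivWithinAt (fun t : ℝ => u (p + t • ν)) g (Iic 0) 0

/-- `∫ ∂_ν u ds = 0` over the boundary of the unit disk with centre `c`, where `ν` is the unit
normal pointing toward the inside of the disk; `θ` is the arc length parameter. -/
def ZeroFlux (u : Plane → ℝ) (c : Plane) : Prop :=
  ∃ g : ℝ → ℝ,
    (∀ θ, HasNormalDeriv u (c + circleVec θ) (-circleVec θ) (g θ)) ∧
    IntervalIntegrable g volume 0 (2 * Real.pi) ∧
    ∫ θ in (0 : ℝ)..(2 * Real.pi), g θ = 0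

/-- `u` solves the perfect conductor problem for the background `H`. Only the values of `u`
outside the open disks matter; the boundary values are attained continuously from outside. -/
structure IsSolution (ε δ : ℝ) (H u : Plane → ℝ) : Prop where
  harmonic : InnerProductSpace.HarmonicOnNhd u (exterior ε δ)
  continuousOn : ContinuousOn u (inclusions ε δ)ᶜ
  const_left : ∃ cL : ℝ, ∀ p ∈ frontier (diskL ε δ 0), u p = cL
  const_right : ∃ cR : ℝ, ∀ p ∈ frontier (diskR ε δ 0), u p = cR
  flux_left : ZeroFlux u (centerL ε δ 0)
  flux_right : ZeroFlux u (centerR ε δ 0)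
  energy : ∫⁻ p in strip δ \ closure (diskL ε δ 0 ∪ diskR ε δ 0),
    ‖gradient (fun q => u q - H q) p‖ₑ ^ 2 < ∞
  periodic : ∀ p ∈ exterior ε δ, gradient u p = gradient u (p + period δ)

/-- The narrow region `N_v` between `D_{L0}` and `D_{R0}`. -/
def gapV (ε : ℝ) : Set Plane :=
  {p | |p 0| < 1 + ε / 2 - √(1 - p 1 ^ 2) ∧ |p 1| < √3 / 2}

/-- The narrow region `N_h` between `D_{R0}` and `D_{R1}`. -/
def gapH (ε δ : ℝ) : Set Plane :=
  {p | |p 1 - 1 - δ / 2| < 1 + δ / 2 - √(1 - (p 0 - 1 - ε / 2) ^ 2) ∧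
    |p 0 - 1 - ε / 2| < √3 / 2}

/-- The function `S`. -/
def S (ε δ : ℝ) (p : Plane) : ℝ :=
  -2 * √δ * ((p 0 - 1 - ε / 2) * (p 1 - 1 - δ / 2) / ((p 0 - 1 - ε / 2) ^ 2 + δ) ^ 2)

/-- The norm of `L^∞(s)` for Lebesgue measure, as an extended nonnegative real. -/
def LinftyNorm {F : Type*} [NormedAddCommGroup F] (f : Plane → F) (s : Set Plane) : ℝ≥0∞ :=
  eLpNorm f ∞ (volume.restrict s)

end TwoRows

end

/-!
Identify the plane with `ℂ`. The gradient of `u - H` is periodic and has finite energy on a period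
strip, so it tends to zero along the strip; hence `u`, like `H`, increases by a constant `κ` over
one period, and `κ` differs from `H(0, 1) - H(0, -1)` by `O(δ ‖H‖)`. A maximum principle on the
strip, with a harmonic barrier of linear growth, bounds `u` by `‖H‖` and the potential difference
`cR - cL`.

In a gap between two disks at distance `e`, compare `u` with the explicit harmonic profile that
takes the boundary values of `u` on both circles. The difference vanishes on the two arcs, so a
logarithmic barrier bounds it by the distance to the disks, and interior estimates then bound its
gradient up to the boundary. The gradient of the profile is the singular part of the expansion, up
to a bounded error.

The profile across the vertical gap carries a flux of order `(cR - cL) / √ε`. Symmetrization in the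
real axis cancels the singular fluxes of the two horizontal gaps, and the rest of the flux is
bounded, so zero flux forces `cR - cL = O(√ε ‖H‖)`.
-/

namespace TwoRows

open InnerProductSpace Metric Filter Topology Laplacian

section HarmonicFunctions

theorem laplacian_comp_linearIsometryEquiv {E E' F : Type*}
    [NormedAddCommGroup E] [InnerProductSpace ℝ E] [FiniteDimensional ℝ E]
    [NormedAddCommGroup E'] [InnerProductSpace ℝ E'] [FiniteDimensional ℝ E']
    [NormedAddCommGroup F] [NormedSpace ℝ F] (e : E ≃ₗᵢ[ℝ] E') (f : E' → F) (x : E) :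
    Δ (f ∘ e) x = Δ f (e x) := by
  have hD : iteratedFDeriv ℝ 2 (f ∘ e) x =
      (iteratedFDeriv ℝ 2 f (e x)).compContinuousLinearMap
        fun _ => (e.toContinuousLinearEquiv : E →L[ℝ] E') := by
    have h := e.toContinuousLinearEquiv.iteratedFDerivWithin_comp_right f uniqueDiffOn_univ
      (mem_univ (e x)) 2
    simp only [preimage_univ, iteratedFDerivWithin_univ] at h
    exact h
  rw [laplacian_eq_iteratedFDeriv_orthonormalBasis (f ∘ e) (stdOrthonormalBasis ℝ E),
    laplacian_eq_iteratedFDeriv_orthonormalBasis f ((stdOrthonormalBasis ℝ E).map e)]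
  simp only [hD]
  refine Finset.sum_congr rfl fun i _ => ?_
  rw [ContinuousMultilinearMap.compContinuousLinearMap_apply]
  congr 1 with j
  fin_cases j <;> simp

theorem harmonicAt_comp_linearIsometryEquiv {E E' F : Type*}
    [NormedAddCommGroup E] [InnerProductSpace ℝ E] [FiniteDimensional ℝ E]
    [NormedAddCommGroup E'] [InnerProductSpace ℝ E'] [FiniteDimensional ℝ E']
    [NormedAddCommGroup F] [NormedSpace ℝ F] (e : E ≃ₗᵢ[ℝ] E') {f : E' → F} {x : E}
    (hf : HarmonicAt f (e x)) : HarmonicAt (f ∘ e) x := by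
  refine ⟨hf.1.comp x e.contDiff.contDiffAt, ?_⟩
  filter_upwards [e.continuous.continuousAt.eventually hf.2] with y hy
  rw [laplacian_comp_linearIsometryEquiv]
  exact hy

theorem eventually_eq_of_isLocalMax_of_harmonicAt {f : ℂ → ℝ} {z : ℂ} (hf : HarmonicAt f z)
    (hmax : IsLocalMax f z) : ∀ᶠ w in 𝓝 z, f w = f z := by
  obtain ⟨r, hr, hball⟩ := Metric.eventually_nhds_iff_ball.mp hf.eventually
  obtain ⟨F, hF, hFf⟩ := HarmonicOnNhd.exists_analyticOnNhd_ball_re_eq hball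
  have hball : ∀ᶠ w in 𝓝 z, w ∈ ball z r := isOpen_ball.mem_nhds (mem_ball_self hr)
  have hnorm : ∀ w ∈ ball z r, ‖Complex.exp (F w)‖ = Real.exp (f w) := fun w hw => by
    rw [Complex.norm_exp, show (F w).re = f w from hFf hw]
  have hdiff : ∀ᶠ w in 𝓝 z, DifferentiableAt ℂ (fun w => Complex.exp (F w)) w := by
    filter_upwards [hball] with w hw using (hF w hw).differentiableAt.cexp
  have hmaxF : IsLocalMax (norm ∘ fun w => Complex.exp (F w)) z := by
    filter_upwards [hball, hmax] with w hw hmw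
    simpa only [Function.comp, hnorm w hw, hnorm z (mem_ball_self hr), Real.exp_le_exp]
  filter_upwards [hball, Complex.eventually_eq_of_isLocalMax_norm hdiff hmaxF] with w hw hFw
  rw [← Real.exp_eq_exp, ← hnorm w hw, ← hnorm z (mem_ball_self hr), hFw]

-- Among the maximizers on `K` the proof picks one with the largest real part, which `hi` may move
-- vertically only.
theorem le_of_harmonicAt_of_le {K T : Set ℂ} {w : ℂ → ℝ} {m : ℝ} (hK : IsCompact K)
    (hw : ContinuousOn w K) (hT : ∀ q ∈ K, q ∈ T → w q ≤ m)
    (hi : ∀ q ∈ K, q ∉ T → ∃ q', w q' = w q ∧ q'.re = q.re ∧ HarmonicAt w q' ∧ K ∈ 𝓝 q')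
    {q : ℂ} (hq : q ∈ K) : w q ≤ m := by
  obtain ⟨q₀, hq₀, hmax⟩ := hK.exists_isMaxOn ⟨q, hq⟩ hw
  have hlevel : IsCompact (K ∩ w ⁻¹' {w q₀}) := by
    obtain ⟨u, hu, huK⟩ := continuousOn_iff_isClosed.mp hw {w q₀} isClosed_singleton
    rw [inter_comm, huK, inter_comm]
    exact hK.inter_right hu
  obtain ⟨q₁, ⟨hq₁K, hq₁ : w q₁ = w q₀⟩, hright⟩ :=
    hlevel.exists_isMaxOn ⟨q₀, hq₀, rfl⟩ Complex.continuous_re.continuousOn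
  refine (hmax hq).trans (hq₁ ▸ ?_)
  by_contra hlt
  obtain ⟨q', hwq', hre, hharm, hKq'⟩ := hi q₁ hq₁K fun h => hlt (hT q₁ hq₁K h)
  have hloc : IsLocalMax w q' := by
    filter_upwards [hKq'] with x hx
    exact hwq' ▸ hq₁ ▸ hmax hx
  obtain ⟨r, hr, hball⟩ := Metric.eventually_nhds_iff_ball.mp
    ((eventually_eq_of_isLocalMax_of_harmonicAt hharm hloc).and hKq')
  have hx : q' + ((r / 2 : ℝ) : ℂ) ∈ ball q' r := by
    rw [mem_ball, dist_self_add_left, Complex.norm_real, Real.norm_of_nonneg (by positivity)]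
    linarith
  obtain ⟨hwx, hxK⟩ := hball _ hx
  have hle : (q' + ((r / 2 : ℝ) : ℂ)).re ≤ q₁.re :=
    hright ⟨hxK, (hwx.trans hwq').trans hq₁⟩
  simp only [Complex.add_re, Complex.ofReal_re] at hle
  linarith

theorem norm_apply_one_sub_I_mul_apply_I (L : ℂ →L[ℝ] ℝ) :
    ‖((L 1 : ℝ) : ℂ) - Complex.I * ((L Complex.I : ℝ) : ℂ)‖ = ‖L‖ := by
  set v : ℂ := (toDual ℝ ℂ).symm L
  have hv : ∀ w, L w = inner ℝ v w := fun w => (toDual_symm_apply (𝕜 := ℝ)).symm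
  have : ((L 1 : ℝ) : ℂ) - Complex.I * ((L Complex.I : ℝ) : ℂ) = starRingEnd ℂ v := by
    apply Complex.ext <;> simp [hv, Complex.inner]
  rw [this, RCLike.norm_conj, LinearIsometryEquiv.norm_map]

theorem norm_deriv_le_of_re_le {F : ℂ → ℂ} {z : ℂ} {r A : ℝ} (hr : 0 < r)
    (hF : DifferentiableOn ℂ F (ball z r)) (hA : ∀ w ∈ ball z r, (F w - F z).re ≤ A) :
    ‖deriv F z‖ ≤ 2 * A / r := by
  have hA0 : 0 ≤ A := by simpa using hA z (mem_ball_self hr)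
  refine le_of_forall_gt_imp_ge_of_dense fun C hC => ?_
  rw [div_lt_iff₀ hr] at hC
  obtain ⟨B, hAB, hBC⟩ := exists_between (show A < C * r / 2 by linarith)
  have hC0 : 0 ≤ C := by nlinarith
  have hmem : ∀ {w}, w ∈ ball 0 r → z + w ∈ ball z r := fun hw => by simpa using hw
  have hBC_near : ∀ᶠ w in 𝓝 z, 2 * B / (r - ‖w - z‖) < C := by
    have hcont : ContinuousAt (fun w => 2 * B / (r - ‖w - z‖)) z :=
      ContinuousAt.div (by fun_prop) (by fun_prop) (by simpa using hr.ne')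
    refine hcont.eventually_lt continuousAt_const ?_
    rw [sub_self, norm_zero, sub_zero, div_lt_iff₀ hr]
    linarith
  rw [norm_deriv_eq_norm_fderiv]
  refine HasFDerivAt.le_of_lip' (hF.differentiableAt
    (isOpen_ball.mem_nhds (mem_ball_self hr))).hasFDerivAt hC0 ?_
  filter_upwards [hBC_near, isOpen_ball.mem_nhds (mem_ball_self hr)] with w hw hwr
  have hbound := Complex.borelCaratheodory_zero (f := fun w => F (z + w) - F z) (M := B) (R := r)
    (z := w - z) (hA0.trans_lt hAB)
    ((hF.comp (by fun_prop) fun _ hw => hmem hw).sub_const _)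
    (fun w hw => (hA _ (hmem hw)).trans hAB.le) hr (by simpa [dist_eq_norm] using hwr) (by simp)
  rw [add_sub_cancel, mul_div_right_comm] at hbound
  exact hbound.trans (by gcongr)

theorem norm_fderiv_le_norm_deriv_of_eventuallyEq_re {f : ℂ → ℝ} {F : ℂ → ℂ} {z : ℂ}
    (hF : DifferentiableAt ℂ F z) (hf : f =ᶠ[𝓝 z] fun w => (F w).re) :
    ‖fderiv ℝ f z‖ ≤ ‖deriv F z‖ := by
  have hderiv : HasFDerivAt f
      (Complex.reCLM.comp (deriv F z • (1 : ℂ →L[ℝ] ℂ))) z :=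
    (Complex.reCLM.hasFDerivAt.comp z hF.hasDerivAt.complexToReal_fderiv).congr_of_eventuallyEq hf
  rw [hderiv.fderiv]
  refine ContinuousLinearMap.opNorm_le_bound _ (norm_nonneg _) fun w => ?_
  simpa using Complex.abs_re_le_norm (deriv F z * w)

theorem norm_fderiv_le_of_harmonicOnNhd_ball {f : ℂ → ℝ} {z : ℂ} {r M : ℝ} (hr : 0 < r)
    (hf : HarmonicOnNhd f (ball z r)) (hM : ∀ w ∈ ball z r, |f w| ≤ M) :
    ‖fderiv ℝ f z‖ ≤ 4 * M / r := by
  have hz : z ∈ ball z r := mem_ball_self hr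
  obtain ⟨F, hF, hFf⟩ := hf.exists_analyticOnNhd_ball_re_eq
  have hre : ∀ w ∈ ball z r, (F w - F z).re ≤ 2 * M := fun w hw => by
    rw [Complex.sub_re, show (F w).re = f w from hFf hw, show (F z).re = f z from hFf hz]
    linarith [abs_le.mp (hM w hw), abs_le.mp (hM z hz)]
  calc ‖fderiv ℝ f z‖ ≤ ‖deriv F z‖ :=
        norm_fderiv_le_norm_deriv_of_eventuallyEq_re (hF z hz).differentiableAt
          (by filter_upwards [isOpen_ball.mem_nhds hz] with w hw using (hFf hw).symm)
    _ ≤ 2 * (2 * M) / r := norm_deriv_le_of_re_le hr hF.differentiableOn hre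
    _ = 4 * M / r := by ring

theorem lintegral_ball_eq_lintegral_polar (f : ℂ → ℝ≥0∞) (p : ℂ) (R : ℝ) :
    ∫⁻ z in ball p R, f z = ∫⁻ q in Ioo (0 : ℝ) R ×ˢ Ioo (-Real.pi) Real.pi,
      ENNReal.ofReal q.1 * f (circleMap p q.1 q.2) := by
  have hcircle : ∀ q : ℝ × ℝ, p + Complex.polarCoord.symm q = circleMap p q.1 q.2 := fun q => by
    rw [Complex.polarCoord_symm_apply, circleMap, Complex.exp_mul_I]
    simp
  have hset : Ioo (0 : ℝ) R ×ˢ Ioo (-Real.pi) Real.pi =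
      (Iio R ×ˢ univ) ∩ polarCoord.target := by
    rw [polarCoord_target, prod_inter_prod, univ_inter, inter_comm, Ioi_inter_Iio]
  rw [← lintegral_indicator measurableSet_ball, ← lintegral_add_left_eq_self _ p,
    ← Complex.lintegral_comp_polarCoord_symm, hset,
    ← setLIntegral_indicator (measurableSet_Iio.prod MeasurableSet.univ)]
  refine setLIntegral_congr_fun polarCoord.open_target.measurableSet fun q hq => ?_
  have hq0 : 0 < q.1 := (polarCoord_target ▸ hq).1
  have hmem : circleMap p q.1 q.2 ∈ ball p R ↔ q ∈ Iio R ×ˢ (univ : Set ℝ) := by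
    simp [dist_eq_norm, circleMap_sub_center, abs_of_pos hq0]
  simp only [hcircle, smul_eq_mul, indicator, hmem, mul_ite, mul_zero]

section MeanValue

variable {E : Type*} [NormedAddCommGroup E] [NormedSpace ℂ E] [CompleteSpace E] {g : ℂ → E}
  {p : ℂ} {r R : ℝ}

theorem two_pi_mul_enorm_le_lintegral_circle (hr : 0 < r)
    (hg : DifferentiableOn ℂ g (closedBall p r)) :
    ENNReal.ofReal (2 * Real.pi) * ‖g p‖ₑ ≤
      ∫⁻ θ in Ioo (-Real.pi) Real.pi, ‖g (circleMap p r θ)‖ₑ := by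
  have hd : DiffContOnCl ℂ g (ball p |r|) :=
    (hg.mono (by simpa [abs_of_pos hr] using closure_ball_subset_closedBall)).diffContOnCl
  have hmean : ∫ θ in (0 : ℝ)..2 * Real.pi, g (circleMap p r θ) = (2 * Real.pi) • g p := by
    rw [← hd.circleAverage, Real.circleAverage_def, smul_smul, mul_inv_cancel₀ (by positivity),
      one_smul]
  have hper : Function.Periodic (fun θ => g (circleMap p r θ)) (2 * Real.pi) := fun θ => by
    simp only [periodic_circleMap p r θ]
  have hshift := hper.intervalIntegral_add_eq 0 (-Real.pi)
  rw [zero_add, hmean, show -Real.pi + 2 * Real.pi = Real.pi by ring,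
    intervalIntegral.integral_of_le (by linarith [Real.pi_pos]),
    integral_Ioc_eq_integral_Ioo] at hshift
  calc ENNReal.ofReal (2 * Real.pi) * ‖g p‖ₑ = ‖(2 * Real.pi) • g p‖ₑ := by
        rw [enorm_smul, Real.enorm_eq_ofReal (by positivity)]
    _ ≤ _ := by rw [hshift]; exact enorm_integral_le_lintegral_enorm _

theorem pi_mul_sq_mul_enorm_le_lintegral_ball (hR : 0 ≤ R)
    (hg : DifferentiableOn ℂ g (ball p R)) :
    ENNReal.ofReal (Real.pi * R ^ 2) * ‖g p‖ₑ ≤ ∫⁻ z in ball p R, ‖g z‖ₑ := by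
  set s : Set (ℝ × ℝ) := Ioo 0 R ×ˢ Ioo (-Real.pi) Real.pi with hs
  have hmaps : MapsTo (fun q : ℝ × ℝ => circleMap p q.1 q.2) s (ball p R) := fun q hq => by
    simpa [dist_eq_norm, circleMap_sub_center, abs_of_pos hq.1.1] using hq.1.2
  have hmeas : AEMeasurable (fun q : ℝ × ℝ => ENNReal.ofReal q.1 * ‖g (circleMap p q.1 q.2)‖ₑ)
      (volume.restrict s) := by
    refine measurable_fst.ennreal_ofReal.aemeasurable.mul (ContinuousOn.aemeasurable
      (continuous_enorm.comp_continuousOn (hg.continuousOn.comp ?_ hmaps))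
      (measurableSet_Ioo.prod measurableSet_Ioo))
    simp only [circleMap]
    fun_prop
  calc ENNReal.ofReal (Real.pi * R ^ 2) * ‖g p‖ₑ
      = ∫⁻ r in Ioo 0 R, ENNReal.ofReal r * (ENNReal.ofReal (2 * Real.pi) * ‖g p‖ₑ) := by
        rw [lintegral_mul_const' _ _ (by finiteness), ← ofReal_integral_eq_lintegral_ofReal,
          ← integral_Ioc_eq_integral_Ioo, ← intervalIntegral.integral_of_le hR, integral_id,
          ← mul_assoc, ← ENNReal.ofReal_mul (by nlinarith)]
        · ring_nf
        · exact (continuous_id.integrableOn_Icc (a := 0) (b := R)).mono_set Ioo_subset_Icc_self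
        · filter_upwards [ae_restrict_mem measurableSet_Ioo] with r hr using hr.1.le
    _ ≤ ∫⁻ r in Ioo 0 R, ENNReal.ofReal r *
          ∫⁻ θ in Ioo (-Real.pi) Real.pi, ‖g (circleMap p r θ)‖ₑ :=
        setLIntegral_mono' measurableSet_Ioo fun r hr => by
          gcongr
          exact two_pi_mul_enorm_le_lintegral_circle hr.1
            (hg.mono (closedBall_subset_ball hr.2))
    _ = ∫⁻ q in s, ENNReal.ofReal q.1 * ‖g (circleMap p q.1 q.2)‖ₑ := by
        rw [Measure.volume_eq_prod, ← Measure.prod_restrict] at hmeas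
        rw [hs, Measure.volume_eq_prod, ← Measure.prod_restrict, lintegral_prod _ hmeas]
        exact lintegral_congr fun r => (lintegral_const_mul' _ _ ENNReal.ofReal_ne_top).symm
    _ = ∫⁻ z in ball p R, ‖g z‖ₑ := (lintegral_ball_eq_lintegral_polar (‖g ·‖ₑ) p R).symm

end MeanValue

theorem pi_mul_sq_mul_enorm_fderiv_sq_le_energy {f : ℂ → ℝ} {p : ℂ} {R : ℝ} (hR : 0 ≤ R)
    (hf : HarmonicOnNhd f (ball p R)) :
    ENNReal.ofReal (Real.pi * R ^ 2) * ‖fderiv ℝ f p‖ₑ ^ 2 ≤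
      ∫⁻ z in ball p R, ‖fderiv ℝ f z‖ₑ ^ 2 := by
  set g : ℂ → ℂ := fun z =>
    ((fderiv ℝ f z 1 : ℝ) : ℂ) - Complex.I * ((fderiv ℝ f z Complex.I : ℝ) : ℂ)
  have hg : DifferentiableOn ℂ g (ball p R) := fun z hz =>
    (HarmonicAt.differentiableAt_complex_partial (hf z hz)).differentiableWithinAt
  have hnorm : ∀ z, ‖g z ^ 2‖ₑ = ‖fderiv ℝ f z‖ₑ ^ 2 := fun z => by
    rw [enorm_pow, ← ofReal_norm, ← ofReal_norm, norm_apply_one_sub_I_mul_apply_I]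
  simpa only [hnorm] using pi_mul_sq_mul_enorm_le_lintegral_ball hR (hg.fun_pow 2)

theorem norm_fderiv_le_of_energy_le {f : ℂ → ℝ} {p : ℂ} {s : ℝ} (hs : 0 ≤ s)
    (hf : HarmonicOnNhd f (ball p 1))
    (hE : ∫⁻ z in ball p 1, ‖fderiv ℝ f z‖ₑ ^ 2 ≤ ENNReal.ofReal (s ^ 2)) :
    ‖fderiv ℝ f p‖ ≤ s := by
  have h := (pi_mul_sq_mul_enorm_fderiv_sq_le_energy zero_le_one hf).trans hE
  rw [← ofReal_norm, ← ENNReal.ofReal_pow (norm_nonneg _), ← ENNReal.ofReal_mul (by positivity),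
    ENNReal.ofReal_le_ofReal_iff (by positivity)] at h
  refine le_of_sq_le_sq ?_ hs
  nlinarith [Real.pi_gt_three, sq_nonneg ‖fderiv ℝ f p‖]

end HarmonicFunctions

/-! ### Functions vanishing on the boundary of two unit disks -/

section Barrier

variable {c e : ℂ}

/-- The logarithmic potential vanishing on the circle of radius `1/2` which touches the unit circle
about `c` from inside at `c + e`. It is a barrier at `c + e` for the exterior of the unit disk. -/
noncomputable def barrier (c e q : ℂ) : ℝ := Real.log ‖2 * (q - c) - e‖

theorem norm_two_mul_sub_sq (he : ‖e‖ = 1) (z : ℂ) :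
    ‖2 * z - e‖ ^ 2 = 2 * ‖z‖ ^ 2 + 2 * ‖z - e‖ ^ 2 - 1 := by
  have h := parallelogram_law_with_norm ℝ z (z - e)
  rw [sub_sub_cancel, he, show z + (z - e) = 2 * z - e by ring] at h
  linarith

theorem one_le_norm_two_mul_sub (he : ‖e‖ = 1) {z : ℂ} (hz : 1 ≤ ‖z‖) : 1 ≤ ‖2 * z - e‖ := by
  rw [← one_le_sq_iff₀ (norm_nonneg _), norm_two_mul_sub_sq he]
  nlinarith [sq_nonneg ‖z - e‖]

theorem barrier_nonneg (he : ‖e‖ = 1) {q : ℂ} (hq : 1 ≤ ‖q - c‖) : 0 ≤ barrier c e q :=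
  Real.log_nonneg (one_le_norm_two_mul_sub he hq)

theorem harmonicAt_barrier (he : ‖e‖ = 1) {q : ℂ} (hq : 1 ≤ ‖q - c‖) :
    HarmonicAt (barrier c e) q :=
  AnalyticAt.harmonicAt_log_norm (f := fun q => 2 * (q - c) - e) (by fun_prop)
    (norm_pos_iff.mp (zero_lt_one.trans_le (one_le_norm_two_mul_sub he hq)))

theorem barrier_le (he : ‖e‖ = 1) {d : ℝ} (hd : 0 ≤ d) :
    barrier c e (c + (1 + d) * e) ≤ 2 * d := by
  have hnorm : ‖2 * (c + (1 + d) * e - c) - e‖ = 1 + 2 * d := by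
    rw [show 2 * (c + (1 + d) * e - c) - e = ((1 + 2 * d : ℝ) : ℂ) * e by push_cast; ring,
      norm_mul, he, mul_one, Complex.norm_of_nonneg (by positivity)]
  rw [barrier, hnorm]
  linarith [Real.log_le_sub_one_of_pos (x := 1 + 2 * d) (by positivity)]

theorem sq_div_two_le_barrier (he : ‖e‖ = 1) {q : ℂ} (hq : 1 ≤ ‖q - c‖) {s : ℝ} (hs : 0 ≤ s)
    (hs' : s ≤ 1 / 2) (hqe : s ≤ ‖q - c - e‖) : s ^ 2 / 2 ≤ barrier c e q := by
  have hsq : 1 + 2 * s ^ 2 ≤ ‖2 * (q - c) - e‖ ^ 2 := by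
    rw [norm_two_mul_sub_sq he]; nlinarith
  have hlog : Real.log (1 + 2 * s ^ 2) ≤ 2 * barrier c e q :=
    (Real.log_le_log (by positivity) hsq).trans_eq (by rw [Real.log_pow]; rfl)
  have hinv : s ^ 2 ≤ 1 - (1 + 2 * s ^ 2)⁻¹ := by
    rw [le_sub_comm, inv_le_iff_one_le_mul₀ (by positivity)]
    nlinarith [sq_nonneg s, mul_nonneg (sq_nonneg s) (show 0 ≤ 1 - 2 * s ^ 2 by nlinarith)]
  linarith [Real.one_sub_inv_le_log_of_pos (x := 1 + 2 * s ^ 2) (by positivity)]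

end Barrier

/-- Near `p`, the function `v` is bounded by `M`, harmonic outside the closed unit disks with
centres `c₁`, `c₂`, continuous up to their boundary, and zero there. -/
structure VanishesNear (c₁ c₂ p : ℂ) (ρ M : ℝ) (v : ℂ → ℝ) : Prop where
  harmonic : ∀ q ∈ ball p ρ, 1 < ‖q - c₁‖ → 1 < ‖q - c₂‖ → HarmonicAt v q
  cont : ContinuousOn v {q | q ∈ closedBall p ρ ∧ 1 ≤ ‖q - c₁‖ ∧ 1 ≤ ‖q - c₂‖}
  zero : ∀ q ∈ closedBall p ρ, 1 ≤ ‖q - c₁‖ → 1 ≤ ‖q - c₂‖ →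
    ‖q - c₁‖ = 1 ∨ ‖q - c₂‖ = 1 → v q = 0
  bound : ∀ q ∈ closedBall p ρ, 1 ≤ ‖q - c₁‖ → 1 ≤ ‖q - c₂‖ → |v q| ≤ M

namespace VanishesNear

variable {c₁ c₂ p : ℂ} {ρ M : ℝ} {v : ℂ → ℝ}

theorem neg (h : VanishesNear c₁ c₂ p ρ M v) : VanishesNear c₁ c₂ p ρ M (-v) where
  harmonic q hq h1 h2 := (h.harmonic q hq h1 h2).neg
  cont := h.cont.neg
  zero q hq h1 h2 h3 := by rw [Pi.neg_apply, h.zero q hq h1 h2 h3, neg_zero]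
  bound q hq h1 h2 := by simpa using h.bound q hq h1 h2

theorem swap (h : VanishesNear c₁ c₂ p ρ M v) : VanishesNear c₂ c₁ p ρ M v where
  harmonic q hq h1 h2 := h.harmonic q hq h2 h1
  cont := h.cont.mono fun _ hq => ⟨hq.1, hq.2.2, hq.2.1⟩
  zero q hq h1 h2 h3 := h.zero q hq h2 h1 h3.symm
  bound q hq h1 h2 := h.bound q hq h2 h1

theorem shrink (h : VanishesNear c₁ c₂ p ρ M v) {q : ℂ} (hq : q ∈ closedBall p (ρ / 2)) :
    VanishesNear c₁ c₂ q (ρ / 2) M v := by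
  have hd : ρ / 2 + dist q p ≤ ρ := by rw [mem_closedBall] at hq; linarith
  have hsub : closedBall q (ρ / 2) ⊆ closedBall p ρ := closedBall_subset_closedBall' hd
  exact ⟨fun x hx => h.harmonic x (ball_subset_ball' hd hx),
    h.cont.mono fun x hx => ⟨hsub hx.1, hx.2⟩,
    fun x hx => h.zero x (hsub hx), fun x hx => h.bound x (hsub hx)⟩

theorem bound_nonneg (h : VanishesNear c₁ c₂ p ρ M v) (hρ : 0 ≤ ρ) (hp₁ : 1 ≤ ‖p - c₁‖)
    (hp₂ : 1 ≤ ‖p - c₂‖) : 0 ≤ M :=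
  (abs_nonneg _).trans (h.bound p (mem_closedBall_self hρ) hp₁ hp₂)

theorem le_mul_of_barrier (h : VanishesNear c₁ c₂ p ρ M v) (hρ : 0 ≤ ρ) {B : ℂ → ℝ} {k : ℝ}
    (hk : 0 ≤ k) (hB : ∀ q, 1 ≤ ‖q - c₁‖ → HarmonicAt B q) (hB₀ : ∀ q, 1 ≤ ‖q - c₁‖ → 0 ≤ B q)
    (hBρ : ∀ q, 1 ≤ ‖q - c₁‖ → ‖q - p‖ = ρ → M ≤ k * B q)
    (hp₁ : 1 ≤ ‖p - c₁‖) (hp₂ : 1 ≤ ‖p - c₂‖) : v p ≤ k * B p := by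
  have hclosed : IsClosed {q : ℂ | 1 ≤ ‖q - c₁‖ ∧ 1 ≤ ‖q - c₂‖} :=
    (isClosed_le (g := fun q => ‖q - c₁‖) continuous_const (by fun_prop)).inter
      (isClosed_le (g := fun q => ‖q - c₂‖) continuous_const (by fun_prop))
  have hcont : ContinuousOn (v - k • B)
      {q | q ∈ closedBall p ρ ∧ 1 ≤ ‖q - c₁‖ ∧ 1 ≤ ‖q - c₂‖} :=
    h.cont.sub (ContinuousOn.const_smul
      (fun q hq => (hB q hq.2.1).1.continuousAt.continuousWithinAt) k)
  suffices hmax : (v - k • B) p ≤ 0 by simpa using hmax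
  refine le_of_harmonicAt_of_le (T := {q | ‖q - p‖ = ρ ∨ ‖q - c₁‖ = 1 ∨ ‖q - c₂‖ = 1})
    ((isCompact_closedBall p ρ).inter_right hclosed) hcont ?_ ?_
    ⟨mem_closedBall_self hρ, hp₁, hp₂⟩
  · rintro q ⟨hq, hq1, hq2⟩ hT
    simp only [Pi.sub_apply, Pi.smul_apply, smul_eq_mul, sub_nonpos]
    rcases hT with hT | hT
    · exact (le_abs_self _).trans ((h.bound q hq hq1 hq2).trans (hBρ q hq1 hT))
    · exact (h.zero q hq hq1 hq2 hT).trans_le (mul_nonneg hk (hB₀ q hq1))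
  · rintro q ⟨hq, hq1, hq2⟩ hT
    simp only [mem_ofPred_eq, not_or] at hT
    have hlt1 : 1 < ‖q - c₁‖ := lt_of_le_of_ne hq1 (Ne.symm hT.2.1)
    have hlt2 : 1 < ‖q - c₂‖ := lt_of_le_of_ne hq2 (Ne.symm hT.2.2)
    have hqb : q ∈ ball p ρ := by
      rw [mem_closedBall, dist_eq_norm] at hq
      rw [mem_ball, dist_eq_norm]
      exact lt_of_le_of_ne hq hT.1
    refine ⟨q, rfl, rfl, (h.harmonic q hqb hlt1 hlt2).sub ((hB q hq1).const_smul), ?_⟩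
    filter_upwards [isOpen_ball.mem_nhds hqb,
      continuousAt_const.eventually_lt (g := fun q => ‖q - c₁‖) (by fun_prop) hlt1,
      continuousAt_const.eventually_lt (g := fun q => ‖q - c₂‖) (by fun_prop) hlt2]
      with x hx hx1 hx2
    exact ⟨ball_subset_closedBall hx, hx1.le, hx2.le⟩

theorem bound_le (h : VanishesNear c₁ c₂ p ρ M v) (hρ : 0 < ρ) (hρ1 : ρ ≤ 1)
    (hp₁ : 1 ≤ ‖p - c₁‖) (hp₂ : 1 ≤ ‖p - c₂‖) : M ≤ 16 * M / ρ ^ 2 * (ρ / 2) := by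
  have hM := h.bound_nonneg hρ.le hp₁ hp₂
  rw [div_mul_eq_mul_div, le_div_iff₀ (by positivity)]
  nlinarith [mul_nonneg hM hρ.le, mul_nonneg (mul_nonneg hM hρ.le) (sub_nonneg.mpr hρ1)]

theorem le_mul_dist (h : VanishesNear c₁ c₂ p ρ M v) (hρ : 0 < ρ) (hρ1 : ρ ≤ 1)
    (hp₁ : 1 ≤ ‖p - c₁‖) (hp₂ : 1 ≤ ‖p - c₂‖) : v p ≤ 16 * M / ρ ^ 2 * (‖p - c₁‖ - 1) := by
  have hM := h.bound_nonneg hρ.le hp₁ hp₂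
  obtain ⟨d, hd⟩ : ∃ d, d = ‖p - c₁‖ - 1 := ⟨_, rfl⟩
  rw [← hd]
  have hd0 : 0 ≤ d := by linarith
  rcases le_or_gt (ρ / 2) d with hfar | hnear
  · exact (le_abs_self _).trans <| (h.bound p (mem_closedBall_self hρ.le) hp₁ hp₂).trans <|
      (h.bound_le hρ hρ1 hp₁ hp₂).trans (by gcongr)
  obtain ⟨e, he, hpe⟩ : ∃ e : ℂ, ‖e‖ = 1 ∧ p = c₁ + (1 + d) * e := by
    have hn : (‖p - c₁‖ : ℂ) ≠ 0 := by exact_mod_cast (zero_lt_one.trans_le hp₁).ne'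
    refine ⟨(p - c₁) / ‖p - c₁‖, by simp [div_self (Complex.ofReal_ne_zero.mp hn)], ?_⟩
    rw [hd]; push_cast; field_simp; ring
  have hsphere : ∀ q, 1 ≤ ‖q - c₁‖ → ‖q - p‖ = ρ → M ≤ 8 * M / ρ ^ 2 * barrier c₁ e q := by
    intro q hq hqp
    have hqe : ρ / 2 ≤ ‖q - c₁ - e‖ := by
      have hde : ‖(d : ℂ) * e‖ = d := by rw [norm_mul, he, mul_one, Complex.norm_of_nonneg hd0]
      rw [show q - c₁ - e = (q - p) + d * e by rw [hpe]; ring]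
      linarith [norm_sub_le_norm_add (q - p) (d * e)]
    calc M = 8 * M / ρ ^ 2 * ((ρ / 2) ^ 2 / 2) := by field_simp; ring
      _ ≤ 8 * M / ρ ^ 2 * barrier c₁ e q := by
        gcongr
        exact sq_div_two_le_barrier he hq (by positivity) (by linarith) hqe
  calc v p ≤ 8 * M / ρ ^ 2 * barrier c₁ e p :=
        h.le_mul_of_barrier hρ.le (by positivity) (fun q => harmonicAt_barrier he)
          (fun q => barrier_nonneg he) hsphere hp₁ hp₂
    _ ≤ 8 * M / ρ ^ 2 * (2 * d) := by
        gcongr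
        exact hpe ▸ barrier_le he hd0
    _ = 16 * M / ρ ^ 2 * d := by ring

theorem abs_le_mul_dist (h : VanishesNear c₁ c₂ p ρ M v) (hρ : 0 < ρ) (hρ1 : ρ ≤ 1)
    (hp₁ : 1 ≤ ‖p - c₁‖) (hp₂ : 1 ≤ ‖p - c₂‖) : |v p| ≤ 16 * M / ρ ^ 2 * (‖p - c₁‖ - 1) :=
  abs_le'.mpr ⟨h.le_mul_dist hρ hρ1 hp₁ hp₂, h.neg.le_mul_dist hρ hρ1 hp₁ hp₂⟩

theorem abs_le_mul_min_dist (h : VanishesNear c₁ c₂ p ρ M v) (hρ : 0 < ρ) (hρ1 : ρ ≤ 1)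
    (hp₁ : 1 ≤ ‖p - c₁‖) (hp₂ : 1 ≤ ‖p - c₂‖) :
    |v p| ≤ 16 * M / ρ ^ 2 * min (min (‖p - c₁‖ - 1) (‖p - c₂‖ - 1)) (ρ / 2) := by
  have hM := h.bound_nonneg hρ.le hp₁ hp₂
  rw [mul_min_of_nonneg _ _ (by positivity), mul_min_of_nonneg _ _ (by positivity)]
  exact le_min (le_min (h.abs_le_mul_dist hρ hρ1 hp₁ hp₂)
    (h.swap.abs_le_mul_dist hρ hρ1 hp₂ hp₁))
    ((h.bound p (mem_closedBall_self hρ.le) hp₁ hp₂).trans (h.bound_le hρ hρ1 hp₁ hp₂))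

/-- The interior gradient estimate on a ball about `p` just touching a disk loses the factor
`1 / d`, with `d` the distance to the disks; linear decay of `v` at the disks compensates. -/
theorem norm_fderiv_le (h : VanishesNear c₁ c₂ p ρ M v) (hρ : 0 < ρ) (hρ1 : ρ ≤ 1)
    (hp₁ : 1 < ‖p - c₁‖) (hp₂ : 1 < ‖p - c₂‖) : ‖fderiv ℝ v p‖ ≤ 512 * M / ρ ^ 2 := by
  have hM := h.bound_nonneg hρ.le hp₁.le hp₂.le
  obtain ⟨d, hd⟩ : ∃ d, d = min (min (‖p - c₁‖ - 1) (‖p - c₂‖ - 1)) (ρ / 2) := ⟨_, rfl⟩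
  have hd0 : 0 < d := by
    rw [hd]; exact lt_min (lt_min (by linarith) (by linarith)) (by linarith)
  obtain ⟨⟨hd1, hd2⟩, hd3⟩ : (d ≤ ‖p - c₁‖ - 1 ∧ d ≤ ‖p - c₂‖ - 1) ∧ d ≤ ρ / 2 := by
    rw [← le_min_iff, ← le_min_iff, hd]
  have hdist : ∀ q ∈ ball p d, ∀ c, ‖p - c‖ - d < ‖q - c‖ ∧ ‖q - c‖ < ‖p - c‖ + d := by
    intro q hq c
    have := abs_lt.mp ((abs_norm_sub_norm_le (q - c) (p - c)).trans_lt
      (by simpa [dist_eq_norm] using hq))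
    constructor <;> linarith
  have hq1 : ∀ q ∈ ball p d, 1 < ‖q - c₁‖ := fun q hq => by linarith [(hdist q hq c₁).1]
  have hq2 : ∀ q ∈ ball p d, 1 < ‖q - c₂‖ := fun q hq => by linarith [(hdist q hq c₂).1]
  have hharm : HarmonicOnNhd v (ball p d) := fun q hq =>
    h.harmonic q (ball_subset_ball (by linarith) hq) (hq1 q hq) (hq2 q hq)
  have hball : ∀ q ∈ ball p d, |v q| ≤ 128 * M / ρ ^ 2 * d := by
    intro q hq
    calc |v q| ≤ 16 * M / (ρ / 2) ^ 2 *
          min (min (‖q - c₁‖ - 1) (‖q - c₂‖ - 1)) (ρ / 2 / 2) :=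
          (h.shrink ((mem_ball.mp hq).le.trans hd3)).abs_le_mul_min_dist (by positivity)
            (by linarith) (hq1 q hq).le (hq2 q hq).le
      _ ≤ 16 * M / (ρ / 2) ^ 2 *
          min (min (‖p - c₁‖ - 1 + d) (‖p - c₂‖ - 1 + d)) (ρ / 2 + d) := by
          gcongr <;> linarith [(hdist q hq c₁).2, (hdist q hq c₂).2]
      _ = 128 * M / ρ ^ 2 * d := by
          rw [min_add_add_right, min_add_add_right, ← hd]; ring
  calc ‖fderiv ℝ v p‖ ≤ 4 * (128 * M / ρ ^ 2 * d) / d :=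
        norm_fderiv_le_of_harmonicOnNhd_ball hd0 hharm hball
    _ = 512 * M / ρ ^ 2 := by field_simp; ring

end VanishesNear

/-! ### The two rows of disks in the complex plane -/

section Geometry

/-- The centre of `D_{Rn}` as a complex number. -/
noncomputable def rightCenter (ε δ : ℝ) (n : ℤ) : ℂ := ⟨1 + ε / 2, n * (2 + δ)⟩

/-- The centre of `D_{Ln}` as a complex number. -/
noncomputable def leftCenter (ε δ : ℝ) (n : ℤ) : ℂ := ⟨-1 - ε / 2, n * (2 + δ)⟩

/-- The vertical period `(0, 2 + δ)` as a complex number. -/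
def vshift (δ : ℝ) : ℂ := ⟨0, 2 + δ⟩

/-- The complement of the closed disks, as a subset of `ℂ`. -/
def openExterior (ε δ : ℝ) : Set ℂ :=
  {z | ∀ n : ℤ, 1 < ‖z - leftCenter ε δ n‖ ∧ 1 < ‖z - rightCenter ε δ n‖}

/-- The complement of the open disks, as a subset of `ℂ`. -/
def closedExterior (ε δ : ℝ) : Set ℂ :=
  {z | ∀ n : ℤ, 1 ≤ ‖z - leftCenter ε δ n‖ ∧ 1 ≤ ‖z - rightCenter ε δ n‖}

variable {ε δ : ℝ} {z w c : ℂ} {n : ℤ}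

theorem openExterior_subset_closedExterior (ε δ : ℝ) : openExterior ε δ ⊆ closedExterior ε δ :=
  fun _ hz n => ⟨(hz n).1.le, (hz n).2.le⟩

theorem rightCenter_add_one (n : ℤ) :
    rightCenter ε δ (n + 1) = rightCenter ε δ n + vshift δ := by
  apply Complex.ext <;> simp [rightCenter, vshift, add_mul]

theorem leftCenter_add_one (n : ℤ) : leftCenter ε δ (n + 1) = leftCenter ε δ n + vshift δ := by
  apply Complex.ext <;> simp [leftCenter, vshift, add_mul]

theorem add_vshift_mem_openExterior : z + vshift δ ∈ openExterior ε δ ↔ z ∈ openExterior ε δ := by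
  rw [openExterior, mem_ofPred_eq, ← (Equiv.addRight (1 : ℤ)).forall_congr_right]
  simp [rightCenter_add_one, leftCenter_add_one]

theorem add_vshift_mem_closedExterior :
    z + vshift δ ∈ closedExterior ε δ ↔ z ∈ closedExterior ε δ := by
  rw [closedExterior, mem_ofPred_eq, ← (Equiv.addRight (1 : ℤ)).forall_congr_right]
  simp [rightCenter_add_one, leftCenter_add_one]

theorem one_lt_norm_sub_of_im (h : 1 < |z.im - c.im|) : 1 < ‖z - c‖ :=
  h.trans_le (by simpa using Complex.abs_im_le_norm (z - c))

theorem one_lt_norm_sub_of_re (h : 1 < |z.re - c.re|) : 1 < ‖z - c‖ :=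
  h.trans_le (by simpa using Complex.abs_re_le_norm (z - c))

theorem norm_sub_lt_norm_sub_of_re_eq (hre : w.re = z.re) (him : |z.im - c.im| < |w.im - c.im|) :
    ‖z - c‖ < ‖w - c‖ := by
  refine lt_of_pow_lt_pow_left₀ 2 (norm_nonneg _) ?_
  rw [Complex.sq_norm, Complex.sq_norm, Complex.normSq_apply, Complex.normSq_apply]
  have := sq_lt_sq.mpr him
  simp only [Complex.sub_re, Complex.sub_im, hre]
  linarith

theorem exists_abs_sub_int_mul_le (hδ : 0 < δ) (y : ℝ) :
    ∃ n : ℤ, |y - n * (2 + δ)| ≤ (2 + δ) / 2 := by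
  have hP : (0 : ℝ) < 2 + δ := by linarith
  refine ⟨round (y / (2 + δ)), ?_⟩
  calc |y - round (y / (2 + δ)) * (2 + δ)|
      = |y / (2 + δ) - round (y / (2 + δ))| * (2 + δ) := by
        rw [← abs_of_pos hP, ← abs_mul, abs_of_pos hP, sub_mul, div_mul_cancel₀ _ hP.ne']
    _ ≤ 1 / 2 * (2 + δ) := by gcongr; exact abs_sub_round _
    _ = (2 + δ) / 2 := by ring

theorem one_lt_abs_sub_of_ne (hδ : 0 < δ) {y : ℝ} {n m : ℤ}
    (hy : |y - n * (2 + δ)| ≤ (2 + δ) / 2) (hnm : m ≠ n) : 1 < |y - m * (2 + δ)| := by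
  have hone : (1 : ℝ) ≤ |(n : ℝ) - m| := by
    exact_mod_cast Int.one_le_abs (sub_ne_zero.mpr hnm.symm)
  have hdist : |(n : ℝ) - m| * (2 + δ) = |n * (2 + δ) - m * (2 + δ)| := by
    rw [← sub_mul, abs_mul, abs_of_pos (show (0 : ℝ) < 2 + δ by linarith)]
  have htri := abs_sub_le (n * (2 + δ)) y (m * (2 + δ))
  rw [abs_sub_comm (n * (2 + δ)) y] at htri
  nlinarith

theorem mem_openExterior_of_row (hδ : 0 < δ) (hy : |z.im - n * (2 + δ)| ≤ (2 + δ) / 2)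
    (h : 1 < ‖z - leftCenter ε δ n‖ ∧ 1 < ‖z - rightCenter ε δ n‖) : z ∈ openExterior ε δ := by
  intro m
  rcases eq_or_ne m n with rfl | hm
  · exact h
  · have := one_lt_abs_sub_of_ne hδ hy hm
    exact ⟨one_lt_norm_sub_of_im this, one_lt_norm_sub_of_im this⟩

theorem mem_openExterior_of_abs_im_lt (hδ : 0 < δ) (hz : z ∈ closedExterior ε δ)
    (hre : w.re = z.re) (him : |z.im - n * (2 + δ)| < |w.im - n * (2 + δ)|)
    (hw : |w.im - n * (2 + δ)| ≤ (2 + δ) / 2) : w ∈ openExterior ε δ :=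
  mem_openExterior_of_row hδ hw
    ⟨(hz n).1.trans_lt (norm_sub_lt_norm_sub_of_re_eq hre him),
      (hz n).2.trans_lt (norm_sub_lt_norm_sub_of_re_eq hre him)⟩

theorem mem_openExterior_of_midline (hδ : 0 < δ) (h : |z.im - n * (2 + δ)| = (2 + δ) / 2) :
    z ∈ openExterior ε δ := by
  have h1 : 1 < |z.im - n * (2 + δ)| := by rw [h]; linarith
  exact mem_openExterior_of_row hδ h.le ⟨one_lt_norm_sub_of_im h1, one_lt_norm_sub_of_im h1⟩

theorem mem_openExterior_of_re (hε : 0 < ε) (h : z.re = 0 ∨ 3 + ε ≤ |z.re|) :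
    z ∈ openExterior ε δ := by
  intro n
  constructor <;> refine one_lt_norm_sub_of_re (lt_abs.mpr ?_) <;>
    simp only [leftCenter, rightCenter] <;> rcases h with h | h <;>
    (try rcases le_abs.mp h with h | h) <;> first | (left; linarith) | (right; linarith)

theorem isClosed_iUnion_closedBall (hδ : 0 < δ) {c : ℤ → ℂ} (hc : ∀ n, (c n).im = n * (2 + δ)) :
    IsClosed (⋃ n, closedBall (c n) 1) := by
  refine LocallyFinite.isClosed_iUnion (fun z => ⟨ball z 1, ball_mem_nhds z one_pos, ?_⟩)
    fun n => isClosed_closedBall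
  refine (Set.finite_Icc (-⌈|z.im| + 2⌉) ⌈|z.im| + 2⌉).subset ?_
  rintro n ⟨w, hwc, hwz⟩
  have him : |(n : ℝ) * (2 + δ)| ≤ |z.im| + 2 := by
    calc |(n : ℝ) * (2 + δ)| = |(c n).im| := by rw [hc]
      _ = |z.im + (w - z).im - (w - c n).im| := by simp
      _ ≤ |z.im| + |(w - z).im| + |(w - c n).im| :=
        (abs_sub _ _).trans (by gcongr; exact abs_add_le _ _)
      _ ≤ |z.im| + 1 + 1 := by
        gcongr
        · exact (Complex.abs_im_le_norm _).trans (mem_ball_iff_norm.mp hwz).le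
        · exact (Complex.abs_im_le_norm _).trans (mem_closedBall_iff_norm.mp hwc)
      _ = |z.im| + 2 := by ring
  have hn : |(n : ℝ)| ≤ |z.im| + 2 := by
    rw [abs_mul, abs_of_pos (show (0 : ℝ) < 2 + δ by linarith)] at him
    nlinarith [abs_nonneg (n : ℝ)]
  exact abs_le.mp (by exact_mod_cast hn.trans (Int.le_ceil _))

theorem openExterior_eq_compl : openExterior ε δ =
    ((⋃ n, closedBall (leftCenter ε δ n) 1) ∪ ⋃ n, closedBall (rightCenter ε δ n) 1)ᶜ := by
  ext z
  simp only [openExterior, mem_ofPred_eq, mem_compl_iff, mem_union, mem_iUnion, mem_closedBall,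
    dist_eq_norm, not_or, not_exists, not_le, forall_and]

theorem isOpen_openExterior (hδ : 0 < δ) : IsOpen (openExterior ε δ) := by
  rw [openExterior_eq_compl, isOpen_compl_iff]
  exact (isClosed_iUnion_closedBall hδ fun n => rfl).union
    (isClosed_iUnion_closedBall hδ fun n => rfl)

theorem isClosed_closedExterior : IsClosed (closedExterior ε δ) := by
  simp only [closedExterior, ofPred_forall, ofPred_and]
  exact isClosed_iInter fun n => (isClosed_le continuous_const (by fun_prop)).inter
    (isClosed_le continuous_const (by fun_prop))

theorem abs_lt_abs_add_mul_sub {a b t : ℝ} (hab : 0 ≤ a * b) (h : |a| < |b|) (ht0 : 0 < t)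
    (ht1 : t ≤ 1) : |a| < |a + t * (b - a)| ∧ |a + t * (b - a)| ≤ |b| := by
  constructor
  · have hprod : a ^ 2 ≤ a * b := by
      rw [← abs_of_nonneg hab, abs_mul, ← sq_abs, sq]
      exact mul_le_mul_of_nonneg_left h.le (abs_nonneg a)
    have hne : b - a ≠ 0 := sub_ne_zero.mpr (by rintro rfl; exact lt_irrefl _ h)
    rw [← sq_lt_sq]
    nlinarith [mul_nonneg ht0.le (sub_nonneg.mpr hprod), pow_pos ht0 2,
      mul_pos (pow_pos ht0 2) (pow_two_pos_of_ne_zero hne)]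
  · calc |a + t * (b - a)| = |(1 - t) * a + t * b| := by ring_nf
      _ ≤ (1 - t) * |a| + t * |b| := by
        refine (abs_add_le _ _).trans_eq ?_
        rw [abs_mul, abs_mul, abs_of_nonneg (sub_nonneg.mpr ht1), abs_of_pos ht0]
      _ ≤ |b| := by nlinarith

/-- Moving vertically away from the nearest row of centres, one stays outside the disks. -/
theorem exists_openSegment_subset_openExterior (hδ : 0 < δ) (hz : z ∈ closedExterior ε δ) :
    ∃ (a : ℂ) (n : ℤ), |a.im - n * (2 + δ)| = (2 + δ) / 2 ∧
      openSegment ℝ z a ⊆ openExterior ε δ := by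
  obtain ⟨n, hn⟩ := exists_abs_sub_int_mul_le hδ z.im
  rcases hn.eq_or_lt with heq | hlt
  · exact ⟨z, n, heq, by simpa using mem_openExterior_of_midline hδ heq⟩
  obtain ⟨b, hb, hab⟩ : ∃ b, |b| = (2 + δ) / 2 ∧ 0 ≤ (z.im - n * (2 + δ)) * b := by
    have hP : 0 ≤ (2 + δ) / 2 := by linarith
    rcases le_total 0 (z.im - n * (2 + δ)) with h0 | h0
    · exact ⟨(2 + δ) / 2, abs_of_nonneg hP, mul_nonneg h0 hP⟩
    · exact ⟨-((2 + δ) / 2), by rw [abs_neg, abs_of_nonneg hP],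
        mul_nonneg_of_nonpos_of_nonpos h0 (neg_nonpos.mpr hP)⟩
  refine ⟨⟨z.re, n * (2 + δ) + b⟩, n, by rw [add_sub_cancel_left, hb], ?_⟩
  rw [openSegment_eq_image']
  rintro _ ⟨t, ht, rfl⟩
  obtain ⟨hfar, hnear⟩ := abs_lt_abs_add_mul_sub hab (hlt.trans_eq hb.symm) ht.1 ht.2.le
  have him : (z + t • ((⟨z.re, n * (2 + δ) + b⟩ : ℂ) - z)).im - n * (2 + δ) =
      z.im - n * (2 + δ) + t * (b - (z.im - n * (2 + δ))) := by
    simp; ring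
  exact mem_openExterior_of_abs_im_lt hδ hz (by simp) (by rwa [him]) (by rwa [him, ← hb])

theorem closedExterior_subset_closure (hδ : 0 < δ) :
    closedExterior ε δ ⊆ closure (openExterior ε δ) := by
  intro z hz
  obtain ⟨a, n, -, ha⟩ := exists_openSegment_subset_openExterior hδ hz
  exact closure_mono ha (segment_subset_closure_openSegment (left_mem_segment ℝ z a))

/-- Every point is joined to `0` by a vertical segment to a horizontal midline between two rows,
followed by segments in that midline and in the imaginary axis. -/
theorem isPreconnected_openExterior (hε : 0 < ε) (hδ : 0 < δ) :
    IsPreconnected (openExterior ε δ) := by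
  refine isPreconnected_of_forall 0 fun z hz => ?_
  obtain ⟨a, n, han, hza⟩ := exists_openSegment_subset_openExterior hδ
    (openExterior_subset_closedExterior _ _ hz)
  have ha : a ∈ openExterior ε δ := mem_openExterior_of_midline hδ han
  have hseg : segment ℝ z a ⊆ openExterior ε δ := by
    rw [← insert_endpoints_openSegment]
    exact insert_subset hz (insert_subset ha hza)
  let b : ℂ := ⟨0, a.im⟩
  refine ⟨segment ℝ 0 b ∪ (segment ℝ b a ∪ segment ℝ a z), ?_, Or.inl (left_mem_segment ℝ _ _),
    Or.inr (Or.inr (right_mem_segment ℝ _ _)), ?_⟩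
  · refine union_subset ?_ (union_subset ?_ (segment_symm ℝ a z ▸ hseg))
    · rw [segment_eq_image']
      rintro _ ⟨t, -, rfl⟩
      exact mem_openExterior_of_re hε (Or.inl (by simp [b]))
    · rw [segment_eq_image']
      rintro _ ⟨t, -, rfl⟩
      exact mem_openExterior_of_midline hδ (n := n) (by simpa [b] using han)
  · refine IsPreconnected.union b (right_mem_segment ℝ _ _) (Or.inl (left_mem_segment ℝ _ _))
      (convex_segment _ _).isPreconnected ?_
    exact IsPreconnected.union a (right_mem_segment ℝ _ _) (left_mem_segment ℝ _ _)
      (convex_segment _ _).isPreconnected (convex_segment _ _).isPreconnected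

end Geometry

/-! ### Behaviour at infinity -/

section PlaneSolution

/-- The perfect conductor problem in complex coordinates; `cL` and `cR` are the potentials of the
disks of row `0`. -/
structure PlaneSolution (ε δ : ℝ) (H u : ℂ → ℝ) (cL cR : ℝ) : Prop where
  harmonic_background : HarmonicOnNhd H univ
  periodic_background : ∀ z, fderiv ℝ H (z + vshift δ) = fderiv ℝ H z
  harmonic : HarmonicOnNhd u (openExterior ε δ)
  cont : ContinuousOn u (closedExterior ε δ)
  left : ∀ z, ‖z - leftCenter ε δ 0‖ = 1 → u z = cL
  right : ∀ z, ‖z - rightCenter ε δ 0‖ = 1 → u z = cR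
  flux : ∃ g : ℝ → ℝ,
    (∀ θ : ℝ, HasDerivWithinAt
      (fun t : ℝ => u (rightCenter ε δ 0 + (1 - t : ℝ) * Complex.exp (θ * Complex.I)))
      (g θ) (Iic 0) 0) ∧
    IntervalIntegrable g volume 0 (2 * Real.pi) ∧ ∫ θ in (0 : ℝ)..(2 * Real.pi), g θ = 0
  energy : ∫⁻ z in {z : ℂ | |z.im| < (2 + δ) / 2 ∧ 4 < |z.re|},
    ‖fderiv ℝ (fun w => u w - H w) z‖ₑ ^ 2 < ∞
  periodic : ∀ z ∈ openExterior ε δ, fderiv ℝ u (z + vshift δ) = fderiv ℝ u z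

variable {ε δ : ℝ} {H u : ℂ → ℝ} {cL cR : ℝ}

theorem exists_add_eq_of_periodic_fderiv {E F : Type*} [NormedAddCommGroup E] [NormedSpace ℝ E]
    [NormedAddCommGroup F] [NormedSpace ℝ F] {s : Set E} {f : E → F} {p : E} (hs : IsOpen s)
    (hc : IsPreconnected s) (hf : ∀ z ∈ s, DifferentiableAt ℝ f z) (hp : ∀ z ∈ s, z + p ∈ s)
    (hper : ∀ z ∈ s, fderiv ℝ f (z + p) = fderiv ℝ f z) :
    ∃ κ, ∀ z ∈ s, f (z + p) = f z + κ := by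
  have hd : ∀ z ∈ s, HasFDerivAt (fun z => f (z + p) - f z) (0 : E →L[ℝ] F) z := by
    intro z hz
    have hshift : HasFDerivAt (fun z => f (z + p)) (fderiv ℝ f (z + p)) z := by
      rw [hasFDerivAt_comp_add_right]
      exact (hf _ (hp z hz)).hasFDerivAt
    have hsub := hshift.sub (hf z hz).hasFDerivAt
    rwa [hper z hz, sub_self] at hsub
  obtain ⟨κ, hκ⟩ := hs.exists_is_const_of_fderiv_eq_zero (𝕜 := ℝ) hc
    (fun z hz => (hd z hz).differentiableAt.differentiableWithinAt) fun z hz => (hd z hz).fderiv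
  exact ⟨κ, fun z hz => eq_add_of_sub_eq' (hκ z hz)⟩

theorem tendsto_setLIntegral_inter_lt_zero {α : Type*} [MeasurableSpace α] {μ : Measure α}
    {F : α → ℝ≥0∞} {g : α → ℝ} {s : Set α} (hs : MeasurableSet s) (hg : Measurable g)
    (hF : ∫⁻ z in s, F z ∂μ ≠ ∞) :
    Tendsto (fun X : ℝ => ∫⁻ z in s ∩ {z | X < g z}, F z ∂μ) atTop (𝓝 0) := by
  have hm : ∀ X : ℝ, MeasurableSet (s ∩ {z | X < g z}) := fun X =>
    hs.inter (measurableSet_lt measurable_const hg)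
  have hfin : (μ.withDensity F) (s ∩ {z | 0 < g z}) ≠ ∞ := by
    rw [withDensity_apply _ (hm 0)]
    exact ne_top_of_le_ne_top hF (lintegral_mono_set inter_subset_left)
  have hlim := tendsto_measure_iInter_atTop (fun X => (hm X).nullMeasurableSet)
    (fun X Y hXY z hz => ⟨hz.1, lt_of_le_of_lt hXY hz.2⟩) ⟨0, hfin⟩
  have hempty : ⋂ X : ℝ, s ∩ {z | X < g z} = ∅ :=
    eq_empty_of_forall_notMem fun z hz => lt_irrefl (g z) (mem_iInter.mp hz (g z)).2
  rw [hempty, measure_empty] at hlim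
  exact hlim.congr fun X => withDensity_apply _ (hm X)

/-- The `j`-th period cell over the set `T` of abscissae. -/
def cell (δ : ℝ) (T : Set ℝ) (j : ℤ) : Set ℂ :=
  {z | |z.im - j * (2 + δ)| < (2 + δ) / 2 ∧ z.re ∈ T}

theorem measurableSet_cell {T : Set ℝ} (hT : MeasurableSet T) (j : ℤ) :
    MeasurableSet (cell δ T j) :=
  (measurableSet_lt (f := fun z : ℂ => |z.im - j * (2 + δ)|) (by fun_prop) measurable_const).inter
    (Complex.measurable_re hT)

theorem setLIntegral_cell_add_one {T : Set ℝ} (hT : MeasurableSet T) {F : ℂ → ℝ≥0∞}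
    (hF : ∀ z : ℂ, z.re ∈ T → F (z + vshift δ) = F z) (j : ℤ) :
    ∫⁻ z in cell δ T (j + 1), F z = ∫⁻ z in cell δ T j, F z := by
  have hpre : (fun z => z + vshift δ) ⁻¹' cell δ T (j + 1) = cell δ T j := by
    ext z
    have him : z.im + (2 + δ) - ((j : ℝ) + 1) * (2 + δ) = z.im - j * (2 + δ) := by ring
    simp [cell, vshift, him]
  rw [← (measurePreserving_add_right (volume : Measure ℂ) _).setLIntegral_comp_preimage_emb
    (measurableEmbedding_addRight (vshift δ)), hpre]
  exact setLIntegral_congr_fun (measurableSet_cell hT j) fun z hz => hF z hz.2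

theorem volume_im_eq (a : ℝ) : volume {z : ℂ | z.im = a} = 0 := by
  have hpre : {z : ℂ | z.im = a} = Complex.measurableEquivRealProd ⁻¹' (univ ×ˢ {a}) := by
    ext z; simp [Complex.measurableEquivRealProd]
  rw [hpre, Complex.volume_preserving_equiv_real_prod.measure_preimage
    (MeasurableSet.univ.prod (measurableSet_singleton a)).nullMeasurableSet,
    Measure.volume_eq_prod, Measure.prod_prod, Real.volume_singleton, mul_zero]

theorem setLIntegral_three_cells_le {T : Set ℝ} (hT : MeasurableSet T) {F : ℂ → ℝ≥0∞}
    (hF : ∀ z : ℂ, z.re ∈ T → F (z + vshift δ) = F z) :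
    ∫⁻ z in {z : ℂ | |z.im| < 3 * (2 + δ) / 2 ∧ z.re ∈ T}, F z ≤
      3 * ∫⁻ z in cell δ T 0, F z := by
  have hcover : {z : ℂ | |z.im| < 3 * (2 + δ) / 2 ∧ z.re ∈ T} ⊆
      ((cell δ T 0 ∪ cell δ T (0 + 1)) ∪ cell δ T (-1)) ∪
        ({z | z.im = (2 + δ) / 2} ∪ {z | z.im = -((2 + δ) / 2)}) := by
    rintro z ⟨hz, hzT⟩
    simp only [cell, mem_union, mem_ofPred_eq, abs_lt, hzT, and_true] at hz ⊢
    push_cast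
    grind
  have hneg : ∫⁻ z in cell δ T (-1), F z = ∫⁻ z in cell δ T 0, F z :=
    (setLIntegral_cell_add_one hT hF (-1)).symm
  calc ∫⁻ z in {z : ℂ | |z.im| < 3 * (2 + δ) / 2 ∧ z.re ∈ T}, F z
      ≤ _ := lintegral_mono_set hcover
    _ ≤ (∫⁻ z in cell δ T 0, F z) + (∫⁻ z in cell δ T (0 + 1), F z) +
          (∫⁻ z in cell δ T (-1), F z) + 0 := by
        refine (lintegral_union_le _ _ _).trans (add_le_add ?_ (le_of_eq ?_))
        · exact (lintegral_union_le _ _ _).trans (add_le_add_left (lintegral_union_le _ _ _) _)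
        · exact setLIntegral_measure_zero _ _
            (measure_union_null (volume_im_eq _) (volume_im_eq _))
    _ = 3 * ∫⁻ z in cell δ T 0, F z := by
        rw [setLIntegral_cell_add_one hT hF, hneg]; ring

theorem norm_vshift (hδ : 0 < δ) : ‖vshift δ‖ = 2 + δ := by
  rw [show vshift δ = ((2 + δ : ℝ) : ℂ) * Complex.I by apply Complex.ext <;> simp [vshift],
    norm_mul, Complex.norm_I, mul_one, Complex.norm_of_nonneg (by linarith)]

namespace PlaneSolution

theorem exists_jump (h : PlaneSolution ε δ H u cL cR) (hε : 0 < ε) (hδ : 0 < δ) :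
    ∃ κ, ∀ z ∈ closedExterior ε δ, u (z + vshift δ) = u z + κ := by
  obtain ⟨κ, hκ⟩ := exists_add_eq_of_periodic_fderiv (isOpen_openExterior hδ)
    (isPreconnected_openExterior hε hδ)
    (fun z hz => (h.harmonic z hz).1.differentiableAt two_ne_zero)
    (fun z hz => add_vshift_mem_openExterior.mpr hz) h.periodic
  refine ⟨κ, EqOn.of_subset_closure hκ ?_ (h.cont.add continuousOn_const)
    (openExterior_subset_closedExterior _ _) (closedExterior_subset_closure hδ)⟩
  exact h.cont.comp (by fun_prop) fun z hz => add_vshift_mem_closedExterior.mpr hz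

theorem exists_jump_background (h : PlaneSolution ε δ H u cL cR) :
    ∃ κ, ∀ z, H (z + vshift δ) = H z + κ := by
  obtain ⟨κ, hκ⟩ := exists_add_eq_of_periodic_fderiv isOpen_univ isPreconnected_univ
    (fun z hz => (h.harmonic_background z hz).1.differentiableAt two_ne_zero)
    (fun z _ => mem_univ _) fun z _ => h.periodic_background z
  exact ⟨κ, fun z => hκ z (mem_univ _)⟩

theorem hasFDerivAt_sub (h : PlaneSolution ε δ H u cL cR) {z : ℂ} (hz : z ∈ openExterior ε δ) :
    HasFDerivAt (fun w => u w - H w) (fderiv ℝ u z - fderiv ℝ H z) z :=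
  ((h.harmonic z hz).1.differentiableAt two_ne_zero).hasFDerivAt.sub
    ((h.harmonic_background z trivial).1.differentiableAt two_ne_zero).hasFDerivAt

theorem harmonicOnNhd_sub (h : PlaneSolution ε δ H u cL cR) :
    HarmonicOnNhd (fun w => u w - H w) (openExterior ε δ) := fun z hz =>
  (h.harmonic z hz).sub (h.harmonic_background z trivial)

theorem fderiv_sub_add_vshift (h : PlaneSolution ε δ H u cL cR) {z : ℂ}
    (hz : z ∈ openExterior ε δ) :
    fderiv ℝ (fun w => u w - H w) (z + vshift δ) = fderiv ℝ (fun w => u w - H w) z := by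
  rw [(h.hasFDerivAt_sub hz).fderiv,
    (h.hasFDerivAt_sub (add_vshift_mem_openExterior.mpr hz)).fderiv, h.periodic z hz,
    h.periodic_background z]

theorem exists_energy_tail_le (h : PlaneSolution ε δ H u cL cR) (hε : 0 < ε) (hε1 : ε < 1)
    {s : ℝ≥0∞} (hs : 0 < s) :
    ∃ X ≥ 4, ∫⁻ z in {z : ℂ | |z.im| < 3 * (2 + δ) / 2 ∧ X < |z.re|},
      ‖fderiv ℝ (fun w => u w - H w) z‖ₑ ^ 2 ≤ 3 * s := by
  have hm : MeasurableSet {z : ℂ | |z.im| < (2 + δ) / 2 ∧ 4 < |z.re|} :=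
    (measurableSet_lt (f := fun z : ℂ => |z.im|) (by fun_prop) measurable_const).inter
      (measurableSet_lt (g := fun z : ℂ => |z.re|) measurable_const (by fun_prop))
  have htail := tendsto_setLIntegral_inter_lt_zero (g := fun z : ℂ => |z.re|) hm (by fun_prop)
    h.energy.ne
  obtain ⟨X, hXs, hX⟩ := ((htail.eventually (ge_mem_nhds hs)).and (eventually_ge_atTop 4)).exists
  refine ⟨X, hX, (setLIntegral_three_cells_le (T := {x | X < |x|})
    (measurableSet_lt measurable_const (by fun_prop)) fun z hz => ?_).trans ?_⟩
  · rw [h.fderiv_sub_add_vshift (mem_openExterior_of_re hε (Or.inr ?_))]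
    exact le_trans (by linarith) (le_of_lt hz)
  · refine mul_le_mul_right ((lintegral_mono_set ?_).trans hXs) _
    rintro z ⟨hz, hzX⟩
    exact ⟨⟨by simpa using hz, hX.trans_lt hzX⟩, hzX⟩

theorem exists_norm_fderiv_sub_le (h : PlaneSolution ε δ H u cL cR) (hε : 0 < ε) (hε1 : ε < 1)
    (hδ : 0 < δ) {s : ℝ} (hs : 0 < s) : ∃ X ≥ 5, ∀ z : ℂ, X ≤ |z.re| → |z.im| ≤ 2 + δ →
      ‖fderiv ℝ (fun w => u w - H w) z‖ ≤ s := by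
  obtain ⟨X, hX, hE⟩ := h.exists_energy_tail_le hε hε1 (s := ENNReal.ofReal (s ^ 2 / 3))
    (ENNReal.ofReal_pos.mpr (by positivity))
  refine ⟨X + 1, by linarith, fun z hz hz2 => ?_⟩
  have hball : ∀ w ∈ ball z 1, |w.im| < 3 * (2 + δ) / 2 ∧ X < |w.re| := by
    intro w hw
    rw [mem_ball_iff_norm] at hw
    have hre := (Complex.abs_re_le_norm (w - z)).trans_lt hw
    have him := (Complex.abs_im_le_norm (w - z)).trans_lt hw
    rw [Complex.sub_re, abs_sub_comm] at hre
    rw [Complex.sub_im] at him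
    constructor
    · linarith [abs_sub_abs_le_abs_sub w.im z.im]
    · linarith [abs_sub_abs_le_abs_sub z.re w.re]
  refine norm_fderiv_le_of_energy_le hs.le (fun w hw => h.harmonicOnNhd_sub w
    (mem_openExterior_of_re hε (Or.inr (by linarith [(hball w hw).2])))) ?_
  calc _ ≤ _ := lintegral_mono_set hball
    _ ≤ 3 * ENNReal.ofReal (s ^ 2 / 3) := hE
    _ = ENNReal.ofReal (s ^ 2) := by
        rw [show (3 : ℝ≥0∞) = ENNReal.ofReal 3 by simp, ← ENNReal.ofReal_mul (by norm_num),
          mul_div_cancel₀ _ (by norm_num)]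

/-- Since `∇(u - H)` is small far away, `u - H` changes arbitrarily little over one period. -/
theorem exists_common_jump (h : PlaneSolution ε δ H u cL cR) (hε : 0 < ε) (hε1 : ε < 1)
    (hδ : 0 < δ) : ∃ κ, (∀ z ∈ closedExterior ε δ, u (z + vshift δ) = u z + κ) ∧
      ∀ z, H (z + vshift δ) = H z + κ := by
  obtain ⟨κ, hκ⟩ := h.exists_jump hε hδ
  obtain ⟨κ', hκ'⟩ := h.exists_jump_background
  suffices hsmall : ∀ s : ℝ, 0 < s → |κ - κ'| ≤ s * (2 + δ) by
    have hzero : |κ - κ'| ≤ 0 := le_of_forall_pos_le_add fun s hs => by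
      have := hsmall (s / (2 + δ)) (by positivity)
      rwa [div_mul_cancel₀ _ (by positivity), ← zero_add s] at this
    obtain rfl := sub_eq_zero.mp (abs_nonpos_iff.mp hzero)
    exact ⟨κ, hκ, hκ'⟩
  intro s hs
  obtain ⟨X, hX, hgrad⟩ := h.exists_norm_fderiv_sub_le hε hε1 hδ hs
  have hmem : ∀ z : ℂ, X ≤ z.re → z ∈ openExterior ε δ := fun z hz =>
    mem_openExterior_of_re hε (Or.inr (by linarith [le_abs_self z.re]))
  let T : Set ℂ := {z | X ≤ z.re} ∩ ({z | -(2 + δ) ≤ z.im} ∩ {z | z.im ≤ 2 + δ})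
  have hT : Convex ℝ T := (convex_halfSpace_re_ge X).inter
    ((convex_halfSpace_im_ge _).inter (convex_halfSpace_im_le _))
  have hmv := hT.norm_image_sub_le_of_norm_fderiv_le (x := (X : ℂ)) (y := X + vshift δ)
    (fun z hz => (h.hasFDerivAt_sub (hmem z hz.1)).differentiableAt)
    (fun z hz => hgrad z (hz.1.trans (le_abs_self _)) (abs_le.mpr hz.2))
    ⟨by simp, by simp; linarith, by simp; linarith⟩
    ⟨by simp [vshift], by simp [vshift]; linarith, by simp [vshift]⟩
  have hjump : u (X + vshift δ) - H (X + vshift δ) - (u X - H X) = κ - κ' := by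
    rw [hκ _ (openExterior_subset_closedExterior _ _ (hmem X (by simp))), hκ']
    ring
  rwa [hjump, add_sub_cancel_left, norm_vshift hδ] at hmv

end PlaneSolution

end PlaneSolution

/-! ### The maximum principle on the periodic exterior domain -/

section MaximumPrinciple

variable {ε δ η m κ X C₀ : ℝ} {f : ℂ → ℝ} {z : ℂ}

theorem rightCenter_eq_add_mul (n : ℤ) :
    rightCenter ε δ n = rightCenter ε δ 0 + n * vshift δ := by
  apply Complex.ext <;> simp [rightCenter, vshift]

theorem leftCenter_eq_add_mul (n : ℤ) : leftCenter ε δ n = leftCenter ε δ 0 + n * vshift δ := by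
  apply Complex.ext <;> simp [leftCenter, vshift]

theorem add_int_mul_vshift_mem_closedExterior (hz : z ∈ closedExterior ε δ) (n : ℤ) :
    z + n * vshift δ ∈ closedExterior ε δ := by
  intro m
  have h := hz (m - n)
  rw [leftCenter_eq_add_mul, rightCenter_eq_add_mul] at h ⊢
  have hshift : ∀ c : ℂ, z + n * vshift δ - (c + m * vshift δ) =
      z - (c + (m - n : ℤ) * vshift δ) := fun c => by push_cast; ring
  rwa [hshift, hshift]

theorem apply_add_int_mul_vshift (hf : ∀ z ∈ closedExterior ε δ, f (z + vshift δ) = f z)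
    (hz : z ∈ closedExterior ε δ) (n : ℤ) : f (z + n * vshift δ) = f z := by
  have hper : Function.Periodic ((closedExterior ε δ).indicator f) (vshift δ) := by
    intro w
    by_cases hw : w ∈ closedExterior ε δ
    · rw [indicator_of_mem hw, indicator_of_mem (add_vshift_mem_closedExterior.mpr hw), hf w hw]
    · rw [indicator_of_notMem hw, indicator_of_notMem (mt add_vshift_mem_closedExterior.mp hw)]
  simpa only [indicator_of_mem hz, indicator_of_mem (add_int_mul_vshift_mem_closedExterior hz n)]
    using hper.int_mul n z

/-- A vertically periodic harmonic function on the exterior that grows linearly at both ends. It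
has a logarithmic pole at every `rightCenter ε δ n`, which lies outside `closedExterior ε δ`. -/
noncomputable def logNormSinh (ε δ : ℝ) (z : ℂ) : ℝ :=
  Real.log ‖Complex.sinh ((Real.pi / (2 + δ) : ℝ) * (z - rightCenter ε δ 0))‖

theorem sinh_ne_zero_of_mem_closedExterior (hδ : 0 < δ) (hz : z ∈ closedExterior ε δ) :
    Complex.sinh ((Real.pi / (2 + δ) : ℝ) * (z - rightCenter ε δ 0)) ≠ 0 := by
  intro h
  obtain ⟨n, hn⟩ := Complex.sin_eq_zero_iff.mp
    (show Complex.sin ((Real.pi / (2 + δ) : ℝ) * (z - rightCenter ε δ 0) * Complex.I) = 0 by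
      rw [Complex.sin_mul_I, h, zero_mul])
  have hP : ((2 + δ : ℝ) : ℂ) ≠ 0 := by exact_mod_cast (show (2 + δ : ℝ) ≠ 0 by linarith)
  have hpi : (Real.pi : ℂ) ≠ 0 := by exact_mod_cast Real.pi_ne_zero
  have hmul : (z - rightCenter ε δ 0) * Complex.I = n * ((2 + δ : ℝ) : ℂ) := by
    rw [Complex.ofReal_div] at hn
    field_simp at hn
    linear_combination hn
  have hz0 : z - rightCenter ε δ (-n) = 0 := by
    have hshift : vshift δ = ((2 + δ : ℝ) : ℂ) * Complex.I := by
      apply Complex.ext <;> simp [vshift]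
    rw [rightCenter_eq_add_mul, hshift]
    push_cast at hmul ⊢
    linear_combination -Complex.I * hmul + (z - rightCenter ε δ 0) * Complex.I_mul_I
  have := (hz (-n)).2
  rw [hz0, norm_zero] at this
  exact absurd this (by norm_num)

theorem harmonicAt_logNormSinh (hδ : 0 < δ) (hz : z ∈ closedExterior ε δ) :
    HarmonicAt (logNormSinh ε δ) z :=
  AnalyticAt.harmonicAt_log_norm
    ((show Differentiable ℂ fun z : ℂ =>
      Complex.sinh ((Real.pi / (2 + δ) : ℝ) * (z - rightCenter ε δ 0)) by fun_prop).analyticAt z)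
    (sinh_ne_zero_of_mem_closedExterior hδ hz)

theorem logNormSinh_add_vshift (hδ : 0 < δ) (z : ℂ) :
    logNormSinh ε δ (z + vshift δ) = logNormSinh ε δ z := by
  have harg : ((Real.pi / (2 + δ) : ℝ) : ℂ) * (z + vshift δ - rightCenter ε δ 0) =
      ((Real.pi / (2 + δ) : ℝ) : ℂ) * (z - rightCenter ε δ 0) + Real.pi * Complex.I := by
    have hP : ((2 + δ : ℝ) : ℂ) ≠ 0 := by exact_mod_cast (show (2 + δ : ℝ) ≠ 0 by linarith)
    have hshift : vshift δ = ((2 + δ : ℝ) : ℂ) * Complex.I := by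
      apply Complex.ext <;> simp [vshift]
    rw [hshift, Complex.ofReal_div]
    field_simp
    ring
  rw [logNormSinh, logNormSinh, harg, Complex.sinh_add_pi_mul_I, norm_neg]

theorem exp_abs_sub_two_le_norm_sinh {w : ℂ} (hw : 1 ≤ |w.re|) :
    Real.exp (|w.re| - 2) ≤ ‖Complex.sinh w‖ := by
  have hreal : ∀ t : ℝ, 1 ≤ t → 2 * Real.exp (t - 2) ≤ Real.exp t - Real.exp (-t) := by
    intro t ht
    have hsplit : Real.exp t = Real.exp (t - 2) * (Real.exp 1 * Real.exp 1) := by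
      rw [← Real.exp_add, ← Real.exp_add]
      ring_nf
    have hneg : Real.exp (-t) ≤ Real.exp (t - 2) := Real.exp_le_exp.mpr (by linarith)
    have he := Real.add_one_le_exp (1 : ℝ)
    nlinarith [Real.exp_pos (t - 2), mul_le_mul he he (by norm_num) (Real.exp_pos 1).le]
  have hdiff : |Real.exp w.re - Real.exp (-w.re)| ≤ ‖Complex.exp w - Complex.exp (-w)‖ := by
    simpa only [Complex.norm_exp, Complex.neg_re] using
      abs_norm_sub_norm_le (Complex.exp w) (Complex.exp (-w))
  have hsinh : ‖Complex.sinh w‖ = ‖Complex.exp w - Complex.exp (-w)‖ / 2 := by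
    rw [Complex.sinh, norm_div, Complex.norm_two]
  have hexp := hreal _ hw
  rw [hsinh]
  rcases abs_cases w.re with ⟨h, -⟩ | ⟨h, -⟩ <;> rw [h] at hexp ⊢ <;>
    rcases abs_le.mp hdiff with ⟨h₁, h₂⟩ <;> (try rw [neg_neg] at hexp) <;> linarith

theorem le_logNormSinh (hε : 0 < ε) (hε1 : ε < 1) (hδ : 0 < δ)
    (h : 1 ≤ Real.pi / (2 + δ) * (|z.re| - 2)) :
    Real.pi / (2 + δ) * (|z.re| - 2) - 2 ≤ logNormSinh ε δ z := by
  have hk : 0 < Real.pi / (2 + δ) := by have := Real.pi_pos; positivity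
  have hre : Real.pi / (2 + δ) * (|z.re| - 2) ≤
      |(((Real.pi / (2 + δ) : ℝ) : ℂ) * (z - rightCenter ε δ 0)).re| := by
    rw [Complex.re_ofReal_mul, abs_mul, abs_of_pos hk, Complex.sub_re, rightCenter]
    have := abs_sub_abs_le_abs_sub z.re (1 + ε / 2)
    rw [abs_of_pos (show (0 : ℝ) < 1 + ε / 2 by linarith)] at this
    exact mul_le_mul_of_nonneg_left (by linarith) hk.le
  have hlog := Real.log_le_log (Real.exp_pos _) (exp_abs_sub_two_le_norm_sinh (h.trans hre))
  rw [Real.log_exp] at hlog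
  rw [logNormSinh]
  linarith

/-- The part of the closed exterior with `|Re z| ≤ X` in two periods around row `0`. -/
def exteriorBox (ε δ X : ℝ) : Set ℂ := {z | |z.re| ≤ X ∧ |z.im| ≤ 2 + δ} ∩ closedExterior ε δ

theorem isCompact_exteriorBox (ε δ X : ℝ) : IsCompact (exteriorBox ε δ X) := by
  have hrect : {z : ℂ | |z.re| ≤ X ∧ |z.im| ≤ 2 + δ} =
      Icc (-X) X ×ℂ Icc (-(2 + δ)) (2 + δ) := by
    ext z
    simp only [mem_ofPred_eq, Complex.mem_reProdIm, mem_Icc, abs_le]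
  rw [exteriorBox, hrect]
  exact (isCompact_Icc.reProdIm isCompact_Icc).inter_right isClosed_closedExterior

theorem exteriorBox_mem_nhds (hδ : 0 < δ) (hz : z ∈ openExterior ε δ) (hre : |z.re| < X)
    (him : |z.im| < 2 + δ) : exteriorBox ε δ X ∈ 𝓝 z := by
  have hopen : IsOpen ({z : ℂ | |z.re| < X} ∩ {z : ℂ | |z.im| < 2 + δ} ∩ openExterior ε δ) :=
    ((isOpen_lt (by fun_prop) continuous_const).inter
      (isOpen_lt (by fun_prop) continuous_const)).inter (isOpen_openExterior hδ)
  exact mem_of_superset (hopen.mem_nhds ⟨⟨hre, him⟩, hz⟩) fun w hw =>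
    ⟨⟨le_of_lt hw.1.1, le_of_lt hw.1.2⟩, openExterior_subset_closedExterior _ _ hw.2⟩

/-- The maximum principle needs no boundary values on `|Im z| = 2 + δ`: those lines are moved to
`Im z = 0` by a period. -/
theorem le_on_exteriorBox_of_periodic (hδ : 0 < δ) (hf : HarmonicOnNhd f (openExterior ε δ))
    (hc : ContinuousOn f (closedExterior ε δ))
    (hper : ∀ z ∈ closedExterior ε δ, f (z + vshift δ) = f z)
    (hends : ∀ z ∈ exteriorBox ε δ X, |z.re| = X → f z ≤ m)
    (hdisks : ∀ z ∈ exteriorBox ε δ X, z ∉ openExterior ε δ → f z ≤ m) :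
    ∀ z ∈ exteriorBox ε δ X, f z ≤ m := by
  intro z hz
  refine le_of_harmonicAt_of_le (T := {q | |q.re| = X ∨ q ∉ openExterior ε δ})
    (isCompact_exteriorBox ε δ X) (hc.mono inter_subset_right)
    (fun q hq hT => hT.elim (hends q hq) (hdisks q hq)) ?_ hz
  rintro q ⟨⟨hqre, hqim⟩, hq⟩ hT
  simp only [mem_ofPred_eq, not_or, not_not] at hT
  obtain ⟨q', hfq, hre, hq', him⟩ : ∃ q', f q' = f q ∧ q'.re = q.re ∧ q' ∈ openExterior ε δ ∧
      |q'.im| < 2 + δ := by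
    have h0 : |(0 : ℝ)| < 2 + δ := by rw [abs_zero]; linarith
    rcases hqim.lt_or_eq with h | h
    · exact ⟨q, rfl, rfl, hT.2, h⟩
    rcases eq_or_eq_neg_of_abs_eq h with h | h
    · have hq' : q - vshift δ ∈ openExterior ε δ := by
        rw [← add_vshift_mem_openExterior, sub_add_cancel]; exact hT.2
      have hfq := hper _ (openExterior_subset_closedExterior _ _ hq')
      rw [sub_add_cancel] at hfq
      exact ⟨q - vshift δ, hfq.symm, by simp [vshift], hq', by simpa [vshift, h] using h0⟩
    · exact ⟨q + vshift δ, hper _ hq, by simp [vshift], add_vshift_mem_openExterior.mpr hT.2,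
        by simpa [vshift, h] using h0⟩
  exact ⟨q', hfq, hre, hf q' hq', exteriorBox_mem_nhds hδ hq'
    (by rw [hre]; exact lt_of_le_of_ne hqre hT.1) him⟩

theorem abs_re_le_of_notMem_openExterior (hε : 0 < ε) (hε1 : ε < 1)
    (hz : z ∉ openExterior ε δ) : |z.re| ≤ 4 := by
  by_contra! h
  exact hz (mem_openExterior_of_re hε (Or.inr (by linarith)))

theorem le_of_notMem_openExterior (hper : ∀ z ∈ closedExterior ε δ, f (z + vshift δ) = f z)
    (hL : ∀ z, ‖z - leftCenter ε δ 0‖ = 1 → f z ≤ m)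
    (hR : ∀ z, ‖z - rightCenter ε δ 0‖ = 1 → f z ≤ m) (hz : z ∈ closedExterior ε δ)
    (hzo : z ∉ openExterior ε δ) : f z ≤ m := by
  simp only [openExterior, mem_ofPred_eq, not_forall, not_and_or, not_lt] at hzo
  obtain ⟨n, hn⟩ := hzo
  have hshift : ∀ c : ℂ, z - (c + n * vshift δ) = z + ((-n : ℤ) : ℂ) * vshift δ - c := by
    intro c; push_cast; ring
  rw [← apply_add_int_mul_vshift hper hz (-n)]
  rcases hn with hn | hn
  · exact hL _ (by rw [← hshift, ← leftCenter_eq_add_mul, le_antisymm hn (hz n).1])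
  · exact hR _ (by rw [← hshift, ← rightCenter_eq_add_mul, le_antisymm hn (hz n).2])

theorem exists_box_width (hδ : 0 < δ) (hη : 0 < η) (a C X₀ X₁ : ℝ) :
    ∃ X, X₀ ≤ X ∧ X₁ ≤ X ∧ 1 ≤ Real.pi / (2 + δ) * (X - 2) ∧
      C + η * (Real.pi / (2 + δ)) / 2 * X - η * (Real.pi / (2 + δ) * (X - 2) - 2) ≤ a := by
  have hk : 0 < Real.pi / (2 + δ) := by have := Real.pi_pos; positivity
  have hlarge : ∀ᶠ X : ℝ in atTop, 1 ≤ Real.pi / (2 + δ) * (X - 2) :=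
    (tendsto_id.atTop_add tendsto_const_nhds).const_mul_atTop hk |>.eventually_ge_atTop 1
  have hslope : ∀ᶠ X : ℝ in atTop, C + η * (Real.pi / (2 + δ)) * 2 + 2 * η - a ≤
      η * (Real.pi / (2 + δ)) / 2 * X :=
    (tendsto_id.const_mul_atTop (by positivity)).eventually_ge_atTop _
  obtain ⟨X, h₀, h₁, h₂, h₃⟩ := ((eventually_ge_atTop X₀).and
    ((eventually_ge_atTop X₁).and (hlarge.and hslope))).exists
  exact ⟨X, h₀, h₁, h₂, by linarith⟩

theorem sub_mul_logNormSinh_le (hε : 0 < ε) (hε1 : ε < 1) (hδ : 0 < δ)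
    (hf : HarmonicOnNhd f (openExterior ε δ)) (hc : ContinuousOn f (closedExterior ε δ))
    (hper : ∀ z ∈ closedExterior ε δ, f (z + vshift δ) = f z)
    (hdisks : ∀ z ∈ closedExterior ε δ, z ∉ openExterior ε δ → f z ≤ m)
    (hgrowth : ∀ s : ℝ, 0 < s → ∃ C X₀ : ℝ, ∀ z : ℂ, X₀ ≤ |z.re| → |z.im| ≤ 2 + δ →
      f z ≤ C + s * |z.re|)
    (hC₀ : ∀ z ∈ exteriorBox ε δ 4, C₀ ≤ logNormSinh ε δ z) (hη : 0 < η)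
    (hz : z ∈ closedExterior ε δ) (him : |z.im| ≤ 2 + δ) :
    f z - η * logNormSinh ε δ z ≤ m - η * C₀ := by
  obtain ⟨C, X₀, hgr⟩ := hgrowth (η * (Real.pi / (2 + δ)) / 2)
    (by have := Real.pi_pos; positivity)
  obtain ⟨X, hX₀, hzX, hXk, hXm⟩ := exists_box_width hδ hη (m - η * C₀) C X₀ |z.re|
  refine le_on_exteriorBox_of_periodic (f := f - η • logNormSinh ε δ) hδ ?_ ?_ ?_ ?_ ?_ z
    ⟨⟨hzX, him⟩, hz⟩
  · exact fun q hq => (hf q hq).sub (harmonicAt_logNormSinh hδ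
      (openExterior_subset_closedExterior _ _ hq)).const_smul
  · exact hc.sub (ContinuousOn.const_smul (fun q hq =>
      (harmonicAt_logNormSinh hδ hq).1.continuousAt.continuousWithinAt) η)
  · intro q hq
    simp only [Pi.sub_apply, Pi.smul_apply, hper q hq, logNormSinh_add_vshift hδ]
  · intro q hq hre
    have hfq := hgr q (by rwa [hre]) hq.1.2
    have hlog := le_logNormSinh (z := q) hε hε1 hδ (by rwa [hre])
    rw [hre] at hfq hlog
    have := mul_le_mul_of_nonneg_left hlog hη.le
    simp only [Pi.sub_apply, Pi.smul_apply, smul_eq_mul]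
    linarith
  · intro q hq hqo
    have hlog := hC₀ q ⟨⟨abs_re_le_of_notMem_openExterior hε hε1 hqo, hq.1.2⟩, hq.2⟩
    exact sub_le_sub (hdisks q hq.2 hqo) (mul_le_mul_of_nonneg_left hlog hη.le)

theorem le_of_sublinear (hε : 0 < ε) (hε1 : ε < 1) (hδ : 0 < δ)
    (hf : HarmonicOnNhd f (openExterior ε δ)) (hc : ContinuousOn f (closedExterior ε δ))
    (hper : ∀ z ∈ closedExterior ε δ, f (z + vshift δ) = f z)
    (hL : ∀ z, ‖z - leftCenter ε δ 0‖ = 1 → f z ≤ m)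
    (hR : ∀ z, ‖z - rightCenter ε δ 0‖ = 1 → f z ≤ m)
    (hgrowth : ∀ s : ℝ, 0 < s → ∃ C X₀ : ℝ, ∀ z : ℂ, X₀ ≤ |z.re| → |z.im| ≤ 2 + δ →
      f z ≤ C + s * |z.re|)
    (hz : z ∈ closedExterior ε δ) : f z ≤ m := by
  obtain ⟨C₀, hC₀⟩ := (isCompact_exteriorBox ε δ 4).bddBelow_image (f := logNormSinh ε δ)
    fun q hq => (harmonicAt_logNormSinh hδ hq.2).1.continuousAt.continuousWithinAt
  have hcell : ∀ w ∈ closedExterior ε δ, |w.im| ≤ 2 + δ → f w ≤ m := by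
    intro w hw him
    have hle : ∀ᶠ η : ℝ in 𝓝[>] 0, f w ≤ m - η * C₀ + η * logNormSinh ε δ w := by
      filter_upwards [self_mem_nhdsWithin] with η hη
      linarith [sub_mul_logNormSinh_le hε hε1 hδ hf hc hper
        (fun q => le_of_notMem_openExterior hper hL hR) hgrowth
        (fun q hq => hC₀ (mem_image_of_mem _ hq)) hη hw him]
    have hlim : Continuous fun η : ℝ => m - η * C₀ + η * logNormSinh ε δ w := by fun_prop
    exact ge_of_tendsto (by simpa using (hlim.tendsto 0).mono_left nhdsWithin_le_nhds) hle
  obtain ⟨n, hn⟩ := exists_abs_sub_int_mul_le hδ z.im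
  rw [← apply_add_int_mul_vshift hper hz (-n)]
  refine hcell _ (add_int_mul_vshift_mem_closedExterior hz _) ?_
  have him : (z + ((-n : ℤ) : ℂ) * vshift δ).im = z.im - n * (2 + δ) := by
    simp [vshift, sub_eq_add_neg]
  rw [him]
  linarith

theorem abs_le_of_sublinear (hε : 0 < ε) (hε1 : ε < 1) (hδ : 0 < δ)
    (hf : HarmonicOnNhd f (openExterior ε δ)) (hc : ContinuousOn f (closedExterior ε δ))
    (hper : ∀ z ∈ closedExterior ε δ, f (z + vshift δ) = f z)
    (hL : ∀ z, ‖z - leftCenter ε δ 0‖ = 1 → |f z| ≤ m)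
    (hR : ∀ z, ‖z - rightCenter ε δ 0‖ = 1 → |f z| ≤ m)
    (hgrowth : ∀ s : ℝ, 0 < s → ∃ C X₀ : ℝ, ∀ z : ℂ, X₀ ≤ |z.re| → |z.im| ≤ 2 + δ →
      |f z| ≤ C + s * |z.re|)
    (hz : z ∈ closedExterior ε δ) : |f z| ≤ m := by
  refine abs_le'.mpr ⟨?_, ?_⟩
  · refine le_of_sublinear hε hε1 hδ hf hc hper (fun w hw => (le_abs_self _).trans (hL w hw))
      (fun w hw => (le_abs_self _).trans (hR w hw)) (fun s hs => ?_) hz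
    obtain ⟨C, X₀, hC⟩ := hgrowth s hs
    exact ⟨C, X₀, fun w h₁ h₂ => (le_abs_self _).trans (hC w h₁ h₂)⟩
  · refine le_of_sublinear (f := -f) hε hε1 hδ hf.neg hc.neg
      (fun w hw => congrArg Neg.neg (hper w hw)) (fun w hw => (neg_le_abs _).trans (hL w hw))
      (fun w hw => (neg_le_abs _).trans (hR w hw)) (fun s hs => ?_) hz
    obtain ⟨C, X₀, hC⟩ := hgrowth s hs
    exact ⟨C, X₀, fun w h₁ h₂ => (neg_le_abs _).trans (hC w h₁ h₂)⟩

end MaximumPrinciple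

section UniformBounds

variable {ε δ M κ : ℝ} {H u : ℂ → ℝ} {cL cR : ℝ} {z : ℂ}

namespace PlaneSolution

theorem continuous_background (h : PlaneSolution ε δ H u cL cR) : Continuous H :=
  continuous_iff_continuousAt.mpr fun z => (h.harmonic_background z trivial).1.continuousAt

theorem continuousOn_sub (h : PlaneSolution ε δ H u cL cR) :
    ContinuousOn (fun z => u z - H z) (closedExterior ε δ) :=
  h.cont.sub h.continuous_background.continuousOn

theorem exists_abs_re_eq_abs_sub_le (h : PlaneSolution ε δ H u cL cR) (hε : 0 < ε) (hε1 : ε < 1)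
    {s X : ℝ} (hX : 5 ≤ X)
    (hgrad : ∀ z : ℂ, X ≤ |z.re| → |z.im| ≤ 2 + δ → ‖fderiv ℝ (fun w => u w - H w) z‖ ≤ s)
    (hre : X ≤ |z.re|) (him : |z.im| ≤ 2 + δ) :
    ∃ w ∈ exteriorBox ε δ X, ‖z - w‖ = |z.re| - X ∧ |u z - H z - (u w - H w)| ≤ s * ‖z - w‖ := by
  have hext : ∀ w : ℂ, X ≤ |w.re| → w ∈ openExterior ε δ := fun w hw =>
    mem_openExterior_of_re hε (Or.inr (by linarith))
  have hmean : ∀ (w : ℂ) (T : Set ℂ), Convex ℝ T → (∀ q ∈ T, X ≤ |q.re|) → z ∈ T → w ∈ T →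
      w.im = z.im → |u z - H z - (u w - H w)| ≤ s * ‖z - w‖ := by
    intro w T hT hTX hz hw hwz
    have hw' : |w.im| ≤ 2 + δ := hwz ▸ him
    exact (hT.inter ((convex_halfSpace_im_ge (-(2 + δ))).inter (convex_halfSpace_im_le (2 + δ))))
      |>.norm_image_sub_le_of_norm_fderiv_le (𝕜 := ℝ)
      (fun q hq => (h.hasFDerivAt_sub (hext q (hTX q hq.1))).differentiableAt)
      (fun q hq => hgrad q (hTX q hq.1) (abs_le.mpr hq.2))
      ⟨hw, abs_le.mp hw'⟩ ⟨hz, abs_le.mp him⟩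
  have hdist : ∀ x : ℝ, ‖z - (⟨x, z.im⟩ : ℂ)‖ = |z.re - x| := fun x => by
    rw [show z - (⟨x, z.im⟩ : ℂ) = ((z.re - x : ℝ) : ℂ) by apply Complex.ext <;> simp,
      Complex.norm_real, Real.norm_eq_abs]
  rcases le_abs.mp hre with hside | hside
  · have hw : X ≤ |X| := le_abs_self X
    refine ⟨⟨X, z.im⟩, ⟨⟨(abs_of_nonneg (by linarith)).le, him⟩,
      openExterior_subset_closedExterior _ _ (hext _ hw)⟩, ?_, hmean _ _
      (convex_halfSpace_re_ge X) (fun q hq => le_trans hq (le_abs_self _)) hside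
      (le_refl X) rfl⟩
    rw [hdist, abs_of_nonneg (by linarith), abs_of_nonneg (show 0 ≤ z.re by linarith)]
  · have hw : X ≤ |-X| := by rw [abs_neg]; exact le_abs_self X
    refine ⟨⟨-X, z.im⟩, ⟨⟨((abs_neg X).trans (abs_of_nonneg (by linarith))).le, him⟩,
      openExterior_subset_closedExterior _ _ (hext _ hw)⟩, ?_, hmean _ _
      (convex_halfSpace_re_le (-X)) (fun q hq => le_trans (le_neg.mpr hq) (neg_le_abs _))
      (le_neg.mp hside) (le_refl (-X)) rfl⟩
    rw [hdist, abs_of_nonpos (by linarith), abs_of_nonpos (show z.re ≤ 0 by linarith)]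
    ring

theorem exists_abs_sub_le_add_mul (h : PlaneSolution ε δ H u cL cR) (hε : 0 < ε) (hε1 : ε < 1)
    (hδ : 0 < δ) {s : ℝ} (hs : 0 < s) : ∃ C X₀ : ℝ, ∀ z : ℂ, X₀ ≤ |z.re| → |z.im| ≤ 2 + δ →
      |u z - H z| ≤ C + s * |z.re| := by
  obtain ⟨X, hX, hgrad⟩ := h.exists_norm_fderiv_sub_le hε hε1 hδ hs
  obtain ⟨C, hC⟩ := (isCompact_exteriorBox ε δ X).exists_bound_of_continuousOn
    (h.continuousOn_sub.mono inter_subset_right)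
  refine ⟨C, X, fun z hre him => ?_⟩
  obtain ⟨w, hw, hzw, hle⟩ := h.exists_abs_re_eq_abs_sub_le hε hε1 hX hgrad hre him
  have hCw := hC w hw
  rw [Real.norm_eq_abs] at hCw
  have hmul : s * ‖z - w‖ ≤ s * |z.re| := by gcongr; linarith
  linarith [abs_sub_abs_le_abs_sub (u z - H z) (u w - H w)]

end PlaneSolution

theorem abs_re_lt_and_abs_im_lt {c : ℂ} (hδ : 0 < δ) (hz : ‖z - c‖ = 1) (hre : |c.re| < 3)
    (him : c.im = 0) : |z.re| < 4 ∧ |z.im| < (2 + δ) / 2 := by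
  have hre' := Complex.abs_re_le_norm (z - c)
  have him' := Complex.abs_im_le_norm (z - c)
  rw [hz, Complex.sub_re] at hre'
  rw [hz, Complex.sub_im, him, sub_zero] at him'
  have := abs_sub_abs_le_abs_sub z.re c.re
  constructor <;> linarith

theorem abs_rightCenter_re_lt (hε : 0 < ε) (hε1 : ε < 1) : |(rightCenter ε δ 0).re| < 3 := by
  rw [rightCenter, abs_lt]
  constructor <;> linarith

theorem abs_leftCenter_re_lt (hε : 0 < ε) (hε1 : ε < 1) : |(leftCenter ε δ 0).re| < 3 := by
  rw [leftCenter, abs_lt]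
  constructor <;> linarith

theorem PlaneSolution.abs_sub_sub_le (h : PlaneSolution ε δ H u cL cR) (hε : 0 < ε) (hε1 : ε < 1)
    (hδ : 0 < δ) (hM : ∀ z : ℂ, |z.re| < 4 → |z.im| < (2 + δ) / 2 → |H z| ≤ M)
    (hz : z ∈ closedExterior ε δ) : |u z - H z - cR| ≤ M + |cR - cL| := by
  obtain ⟨κ, hκ, hκH⟩ := h.exists_common_jump hε hε1 hδ
  refine abs_le_of_sublinear (f := fun z => u z - H z - cR) hε hε1 hδ
    (fun q hq => (h.harmonicOnNhd_sub q hq).sub (harmonicAt_const cR))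
    (h.continuousOn_sub.sub continuousOn_const) (fun q hq => by rw [hκ q hq, hκH]; ring)
    (fun q hq => ?_) (fun q hq => ?_) (fun s hs => ?_) hz
  · obtain ⟨hre, him⟩ := abs_re_lt_and_abs_im_lt hδ hq (abs_leftCenter_re_lt hε hε1)
      (by simp [leftCenter])
    rw [h.left q hq, show cL - H q - cR = -H q - (cR - cL) by ring]
    exact (abs_sub _ _).trans (by rw [abs_neg]; gcongr; exact hM q hre him)
  · obtain ⟨hre, him⟩ := abs_re_lt_and_abs_im_lt hδ hq (abs_rightCenter_re_lt hε hε1)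
      (by simp [rightCenter])
    rw [h.right q hq, show cR - H q - cR = -H q by ring, abs_neg]
    exact (hM q hre him).trans (le_add_of_nonneg_right (abs_nonneg _))
  · obtain ⟨C, X₀, hC⟩ := h.exists_abs_sub_le_add_mul hε hε1 hδ hs
    refine ⟨C + |cR|, X₀, fun q hre him => (abs_sub _ _).trans ?_⟩
    linarith [hC q hre him]

theorem abs_le_of_abs_im_le (hH : Continuous H)
    (hM : ∀ z : ℂ, |z.re| < 4 → |z.im| < (2 + δ) / 2 → |H z| ≤ M) (hδ : 0 < δ)
    (hre : |z.re| ≤ 4) (him : |z.im| ≤ (2 + δ) / 2) : |H z| ≤ M := by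
  have hclosed : IsClosed {z | |H z| ≤ M} := isClosed_le (by fun_prop) continuous_const
  have hsub : Ioo (-4) 4 ×ℂ Ioo (-((2 + δ) / 2)) ((2 + δ) / 2) ⊆ {z | |H z| ≤ M} :=
    fun q hq => hM q (abs_lt.mpr hq.1) (abs_lt.mpr hq.2)
  have hclosure := hclosed.closure_subset_iff.mpr hsub
  rw [Complex.closure_reProdIm, closure_Ioo (by norm_num), closure_Ioo (by linarith)] at hclosure
  exact hclosure ⟨abs_le.mp hre, abs_le.mp him⟩

theorem abs_jump_le (hH : Continuous H) (hδ : 0 < δ)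
    (hM : ∀ z : ℂ, |z.re| < 4 → |z.im| < (2 + δ) / 2 → |H z| ≤ M)
    (hκ : ∀ z, H (z + vshift δ) = H z + κ) : |κ| ≤ 2 * M := by
  have hbot := abs_le_of_abs_im_le (z := ⟨0, -((2 + δ) / 2)⟩) hH hM hδ (by simp)
    (by rw [abs_neg, abs_of_pos (by linarith)])
  have htop := abs_le_of_abs_im_le (z := ⟨0, -((2 + δ) / 2)⟩ + vshift δ) hH hM hδ
    (by simp [vshift]) (by
      rw [Complex.add_im, vshift, abs_of_pos (by linarith)]
      linarith)
  rw [hκ] at htop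
  have := abs_sub (H ⟨0, -((2 + δ) / 2)⟩ + κ) (H ⟨0, -((2 + δ) / 2)⟩)
  rw [add_sub_cancel_left] at this
  linarith

theorem abs_le_three_mul (hH : Continuous H) (hδ : 0 < δ)
    (hM : ∀ z : ℂ, |z.re| < 4 → |z.im| < (2 + δ) / 2 → |H z| ≤ M)
    (hκ : ∀ z, H (z + vshift δ) = H z + κ) (hre : |z.re| < 4) (him : |z.im| ≤ 3 * (2 + δ) / 2) :
    |H z| ≤ 3 * M := by
  have hκM := abs_le.mp (abs_jump_le hH hδ hM hκ)
  have hcell := fun w : ℂ => abs_le_of_abs_im_le (z := w) hH hM hδ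
  rw [abs_le] at him
  rcases lt_or_ge ((2 + δ) / 2) z.im with hup | hup
  · have hdown := abs_le.mp (hcell (z - vshift δ) (by simpa [vshift] using hre.le) (by
      rw [Complex.sub_im, vshift, abs_le]; constructor <;> linarith))
    have := hκ (z - vshift δ)
    rw [sub_add_cancel] at this
    rw [abs_le]; constructor <;> linarith
  rcases lt_or_ge z.im (-((2 + δ) / 2)) with hlow | hlow
  · have hup := abs_le.mp (hcell (z + vshift δ) (by simpa [vshift] using hre.le) (by
      rw [Complex.add_im, vshift, abs_le]; constructor <;> linarith))
    rw [hκ] at hup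
    rw [abs_le]; constructor <;> linarith
  · linarith [hcell z hre.le (abs_le.mpr ⟨hlow, hup⟩), abs_nonneg (H z)]

/-- The data of a solution near the two gaps: `M` bounds the background on the truncated strip and
`κ` is the increment of `u` over one vertical period. -/
structure BoundedSolution (ε δ M κ : ℝ) (u : ℂ → ℝ) (cL cR : ℝ) : Prop where
  harmonic : HarmonicOnNhd u (openExterior ε δ)
  cont : ContinuousOn u (closedExterior ε δ)
  left : ∀ z, ‖z - leftCenter ε δ 0‖ = 1 → u z = cL
  right : ∀ z, ‖z - rightCenter ε δ 0‖ = 1 → u z = cR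
  right_up : ∀ z, ‖z - rightCenter ε δ 1‖ = 1 → u z = cR + κ
  right_down : ∀ z, ‖z - rightCenter ε δ (-1)‖ = 1 → u z = cR - κ
  jump_le : |κ| ≤ 2 * M
  bound : ∀ z ∈ closedExterior ε δ, |z.re| < 4 → |z.im| ≤ 3 → |u z - cR| ≤ 4 * M + |cR - cL|

theorem mem_closedExterior_of_norm_sub_rightCenter (hε : 0 < ε) (hδ : 0 < δ)
    (hz : ‖z - rightCenter ε δ 0‖ = 1) : z ∈ closedExterior ε δ := by
  have hre := Complex.abs_re_le_norm (z - rightCenter ε δ 0)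
  have him := Complex.abs_im_le_norm (z - rightCenter ε δ 0)
  rw [hz] at hre him
  simp only [Complex.sub_re, Complex.sub_im, rightCenter, Int.cast_zero, zero_mul,
    sub_zero] at hre him
  have hleft : 1 < ‖z - leftCenter ε δ 0‖ := by
    refine one_lt_norm_sub_of_re (lt_abs.mpr (Or.inl ?_))
    simp only [leftCenter]
    linarith [(abs_le.mp hre).1]
  intro n
  rcases eq_or_ne n 0 with rfl | hn
  · exact ⟨hleft.le, hz.ge⟩
  · have := one_lt_abs_sub_of_ne hδ (y := z.im) (n := 0) (m := n) (by simp; linarith) hn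
    exact ⟨(one_lt_norm_sub_of_im this).le, (one_lt_norm_sub_of_im this).le⟩

theorem PlaneSolution.exists_boundedSolution (h : PlaneSolution ε δ H u cL cR) (hε : 0 < ε)
    (hε1 : ε < 1) (hδ : 0 < δ)
    (hM : ∀ z : ℂ, |z.re| < 4 → |z.im| < (2 + δ) / 2 → |H z| ≤ M) :
    ∃ κ, (∀ z, H (z + vshift δ) = H z + κ) ∧ BoundedSolution ε δ M κ u cL cR := by
  obtain ⟨κ, hκ, hκH⟩ := h.exists_common_jump hε hε1 hδ
  refine ⟨κ, hκH, h.harmonic, h.cont, h.left, h.right, fun z hz => ?_, fun z hz => ?_,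
    abs_jump_le h.continuous_background hδ hM hκH, fun z hz hre him => ?_⟩
  · rw [← zero_add (1 : ℤ), rightCenter_add_one, ← sub_sub, sub_right_comm] at hz
    have hstep := hκ _ (mem_closedExterior_of_norm_sub_rightCenter hε hδ hz)
    rwa [sub_add_cancel, h.right _ hz] at hstep
  · have hz' : ‖z + vshift δ - rightCenter ε δ 0‖ = 1 := by
      rw [← neg_add_cancel (1 : ℤ), rightCenter_add_one, add_sub_add_right_eq_sub, hz]
    have hstep := hκ z (add_vshift_mem_closedExterior.mp
      (mem_closedExterior_of_norm_sub_rightCenter hε hδ hz'))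
    rw [h.right _ hz'] at hstep
    linarith
  · have hsub := abs_le.mp (h.abs_sub_sub_le hε hε1 hδ hM hz)
    have hbg := abs_le.mp (abs_le_three_mul h.continuous_background hδ hM hκH hre (by linarith))
    rw [abs_le]; constructor <;> linarith

end UniformBounds

/-! ### The harmonic profile of the gap between two disks -/

section Profile

/-- The distance from the origin of the logarithmic poles of `profile b`, which are inverse to each
other in the unit circles with centres `b` and `-b`. -/
noncomputable def pole (b : ℝ) : ℝ := √(b ^ 2 - 1)

/-- The value of `log ‖ζ + pole b‖ - log ‖ζ - pole b‖` on the unit circle with centre `b`. -/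
noncomputable def height (b : ℝ) : ℝ := Real.log (b + pole b)

/-- The function harmonic outside the unit disks with centres `b` and `-b` which has the values
`1/2` and `-1/2` on their boundaries. -/
noncomputable def profile (b : ℝ) (ζ : ℂ) : ℝ :=
  (2 * height b)⁻¹ * (Real.log ‖ζ + pole b‖ - Real.log ‖ζ - pole b‖)

/-- The complex derivative of the holomorphic function whose real part is `profile b`. -/
noncomputable def profileDeriv (b : ℝ) (ζ : ℂ) : ℂ :=
  ((pole b / height b : ℝ) : ℂ) / ((pole b : ℂ) ^ 2 - ζ ^ 2)

variable {b : ℝ} {ζ : ℂ}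

theorem pole_sq (hb : 1 < b) : pole b ^ 2 = b ^ 2 - 1 := Real.sq_sqrt (by nlinarith)

theorem pole_pos (hb : 1 < b) : 0 < pole b := Real.sqrt_pos.mpr (by nlinarith)

theorem height_pos (hb : 1 < b) : 0 < height b :=
  Real.log_pos (by linarith [pole_pos hb])

theorem one_le_pole_div_height (hb : 1 < b) : 1 ≤ pole b / height b := by
  have ha := pole_pos hb
  have hsinh : Real.sinh (height b) = pole b := by
    rw [Real.sinh_eq, Real.exp_neg, height, Real.exp_log (by linarith)]
    field_simp
    linarith [pole_sq hb]
  rw [one_le_div (height_pos hb)]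
  exact (Real.self_le_sinh_iff.mpr (height_pos hb).le).trans_eq hsinh

theorem pole_div_height_le (hb : 1 < b) : pole b / height b ≤ (1 + b) / 2 := by
  have ha := pole_pos hb
  have hlog := Real.le_log_one_add_of_nonneg (x := b + pole b - 1) (by linarith)
  have hfrac : 2 * (b + pole b - 1) / (b + pole b - 1 + 2) = 2 * pole b / (1 + b) := by
    rw [div_eq_div_iff (by linarith) (by linarith)]
    linear_combination (-2) * pole_sq hb
  rw [hfrac, add_sub_cancel, div_le_iff₀ (by linarith)] at hlog
  rw [div_le_iff₀ (height_pos hb), height]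
  linarith

theorem profile_neg (b : ℝ) (ζ : ℂ) : profile b (-ζ) = -profile b ζ := by
  have hadd : ‖-ζ + pole b‖ = ‖ζ - pole b‖ := by rw [← norm_neg]; congr 1; ring
  have hsub : ‖-ζ - pole b‖ = ‖ζ + pole b‖ := by rw [← norm_neg]; congr 1; ring
  rw [profile, hadd, hsub, profile]
  ring

theorem norm_sub_pole_pos (hb : 1 < b) (h : 1 ≤ ‖ζ - b‖) : 0 < ‖ζ - pole b‖ := by
  rw [norm_pos_iff, sub_ne_zero]
  rintro rfl
  have := pole_pos hb
  have := pole_sq hb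
  rw [← Complex.ofReal_sub, Complex.norm_real, Real.norm_eq_abs, abs_sub_comm,
    abs_of_pos (by nlinarith)] at h
  nlinarith

theorem norm_add_pole_pos (hb : 1 < b) (h : 1 ≤ ‖ζ + b‖) : 0 < ‖ζ + pole b‖ := by
  have := norm_sub_pole_pos hb (ζ := -ζ) (by rwa [← norm_neg, neg_sub, sub_neg_eq_add, add_comm])
  rwa [← norm_neg, neg_sub, sub_neg_eq_add, add_comm] at this

theorem mul_norm_sub_pole_sq_sub (hb : 1 < b) (ζ : ℂ) :
    ((b + pole b) * ‖ζ - pole b‖) ^ 2 - ‖ζ + pole b‖ ^ 2 =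
      2 * pole b * (b + pole b) * (‖ζ - b‖ ^ 2 - 1) := by
  rw [mul_pow]
  simp only [← Complex.normSq_eq_norm_sq, Complex.normSq_apply, Complex.sub_re, Complex.sub_im,
    Complex.add_re, Complex.add_im, Complex.ofReal_re, Complex.ofReal_im, sub_zero, add_zero]
  linear_combination
    (2 * pole b * (b + pole b) - (ζ.re ^ 2 + ζ.im ^ 2 + pole b ^ 2) - 2 * pole b * ζ.re) *
      pole_sq hb

theorem profile_eq_half (hb : 1 < b) (h : ‖ζ - b‖ = 1) : profile b ζ = 1 / 2 := by
  have hs := height_pos hb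
  have ha := pole_pos hb
  have hpos := norm_sub_pole_pos hb h.ge
  have hnorm : ‖ζ + pole b‖ = (b + pole b) * ‖ζ - pole b‖ := by
    rw [← sq_eq_sq₀ (norm_nonneg _) (by positivity)]
    have := mul_norm_sub_pole_sq_sub hb ζ
    rw [h, one_pow, sub_self, mul_zero] at this
    linarith
  rw [profile, hnorm, Real.log_mul (by linarith) hpos.ne', ← height]
  field_simp
  ring

theorem profile_eq_neg_half (hb : 1 < b) (h : ‖ζ + b‖ = 1) : profile b ζ = -(1 / 2) := by
  have := profile_eq_half hb (ζ := -ζ) (by rwa [← norm_neg, neg_sub, sub_neg_eq_add, add_comm])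
  rw [profile_neg] at this
  linarith

theorem profile_le_half (hb : 1 < b) (h : 1 ≤ ‖ζ - b‖) (h' : 1 ≤ ‖ζ + b‖) :
    profile b ζ ≤ 1 / 2 := by
  have hs := height_pos hb
  have ha := pole_pos hb
  have hpos := norm_sub_pole_pos hb h
  have hnorm : ‖ζ + pole b‖ ≤ (b + pole b) * ‖ζ - pole b‖ := by
    rw [← sq_le_sq₀ (norm_nonneg _) (by positivity)]
    have hprod : 0 ≤ 2 * pole b * (b + pole b) * (‖ζ - b‖ ^ 2 - 1) :=
      mul_nonneg (by positivity) (by nlinarith)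
    linarith [mul_norm_sub_pole_sq_sub hb ζ]
  have hlog := Real.log_le_log (norm_add_pole_pos hb h') hnorm
  rw [Real.log_mul (by linarith) hpos.ne', ← height] at hlog
  rw [profile, inv_mul_le_iff₀ (by positivity)]
  linarith

theorem abs_profile_le (hb : 1 < b) (h : 1 ≤ ‖ζ - b‖) (h' : 1 ≤ ‖ζ + b‖) :
    |profile b ζ| ≤ 1 / 2 := by
  have hneg := profile_le_half hb (ζ := -ζ)
    (by rwa [← norm_neg, neg_sub, sub_neg_eq_add, add_comm])
    (by rwa [← norm_neg, neg_add, neg_neg, ← sub_eq_add_neg])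
  rw [profile_neg] at hneg
  exact abs_le'.mpr ⟨profile_le_half hb h h', hneg⟩

theorem harmonicAt_profile_comp (hb : 1 < b) {φ : ℂ → ℂ} {z : ℂ} (hφ : AnalyticAt ℂ φ z)
    (h : 1 ≤ ‖φ z - b‖) (h' : 1 ≤ ‖φ z + b‖) : HarmonicAt (fun z => profile b (φ z)) z := by
  have hadd : HarmonicAt (fun z => Real.log ‖φ z + pole b‖) z :=
    AnalyticAt.harmonicAt_log_norm (f := fun z => φ z + pole b) (by fun_prop)
      (norm_pos_iff.mp (norm_add_pole_pos hb h'))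
  have hsub : HarmonicAt (fun z => Real.log ‖φ z - pole b‖) z :=
    AnalyticAt.harmonicAt_log_norm (f := fun z => φ z - pole b) (by fun_prop)
      (norm_pos_iff.mp (norm_sub_pole_pos hb h))
  exact (hadd.sub hsub).const_smul (c := (2 * height b)⁻¹)

theorem hasFDerivAt_log_norm_sub {c : ℂ} (h : ζ - c ≠ 0) :
    HasFDerivAt (fun z : ℂ => Real.log ‖z - c‖)
      (Complex.reCLM ∘L ((ζ - c)⁻¹ • (1 : ℂ →L[ℝ] ℂ))) ζ := by
  have hlog : (fun z : ℂ => Real.log ‖z - c‖) = fun z : ℂ => 2⁻¹ * Real.log (‖z - c‖ ^ 2) := by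
    funext z
    rw [Real.log_pow]
    push_cast
    ring
  have hpos : ‖ζ - c‖ ^ 2 ≠ 0 := pow_ne_zero 2 (norm_ne_zero_iff.mpr h)
  rw [hlog]
  refine ((((hasFDerivAt_id ζ).sub_const c).norm_sq.log hpos).const_mul 2⁻¹).congr_fderiv ?_
  ext w
  have hinv : (ζ - c)⁻¹ = starRingEnd ℂ (ζ - c) * ((‖ζ - c‖ ^ 2)⁻¹ : ℝ) := by
    rw [Complex.inv_def, Complex.normSq_eq_norm_sq]
  simp only [smul_apply, ContinuousLinearMap.comp_apply, one_apply_eq_self, Complex.reCLM_apply,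
    smul_eq_mul, hinv, mul_right_comm _ _ w, Complex.re_mul_ofReal]
  simp [Complex.inner]
  ring

theorem hasFDerivAt_profile (hb : 1 < b) (h : 1 ≤ ‖ζ - b‖) (h' : 1 ≤ ‖ζ + b‖) :
    HasFDerivAt (profile b) (Complex.reCLM ∘L (profileDeriv b ζ • (1 : ℂ →L[ℝ] ℂ))) ζ := by
  have hsub := norm_pos_iff.mp (norm_sub_pole_pos hb h)
  have hadd := norm_pos_iff.mp (norm_add_pole_pos hb h')
  have hs : (height b : ℂ) ≠ 0 := by exact_mod_cast (height_pos hb).ne'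
  have hlog := hasFDerivAt_log_norm_sub (c := -(pole b : ℂ)) (ζ := ζ) (by rwa [sub_neg_eq_add])
  simp only [sub_neg_eq_add] at hlog
  refine ((hlog.sub (hasFDerivAt_log_norm_sub hsub)).const_mul (2 * height b)⁻¹).congr_fderiv ?_
  have hden : (pole b : ℂ) ^ 2 - ζ ^ 2 ≠ 0 := by
    rw [show (pole b : ℂ) ^ 2 - ζ ^ 2 = -((ζ - pole b) * (ζ + pole b)) by ring]
    exact neg_ne_zero.mpr (mul_ne_zero hsub hadd)
  have hderiv : profileDeriv b ζ =
      ((2 * height b)⁻¹ : ℝ) * ((ζ + pole b)⁻¹ - (ζ - pole b)⁻¹) := by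
    rw [profileDeriv]
    push_cast
    field_simp
    ring
  refine ContinuousLinearMap.ext fun w => ?_
  rw [hderiv]
  simp only [smul_apply, sub_apply, ContinuousLinearMap.comp_apply, one_apply_eq_self,
    Complex.reCLM_apply, smul_eq_mul]
  rw [mul_assoc, Complex.re_ofReal_mul, sub_mul, Complex.sub_re]

theorem profileDeriv_mul_neg_exp (hb : 1 < b) (θ : ℝ) :
    profileDeriv b (b + Complex.exp (θ * Complex.I)) * -Complex.exp (θ * Complex.I) =
      (pole b / height b / (2 * (b + Real.cos θ)) : ℝ) := by
  set E := Complex.exp (θ * Complex.I) with hE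
  have hE0 : E ≠ 0 := Complex.exp_ne_zero _
  have hcos : 2 * Complex.cos θ = E + E⁻¹ := by
    rw [hE, ← Complex.exp_neg, Complex.cos, ← neg_mul]
    ring
  have hbc : 0 < b + Real.cos θ := by linarith [Real.neg_one_le_cos θ]
  have hden : (pole b : ℂ) ^ 2 - (b + E) ^ 2 = -E * ((2 * (b + Real.cos θ) : ℝ) : ℂ) := by
    have hsq : (pole b : ℂ) ^ 2 = (b : ℂ) ^ 2 - 1 := by exact_mod_cast pole_sq hb
    push_cast
    linear_combination hsq + E * hcos + mul_inv_cancel₀ hE0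
  have hne : ((2 * (b + Real.cos θ) : ℝ) : ℂ) ≠ 0 := by
    exact_mod_cast (by positivity : (2 * (b + Real.cos θ) : ℝ) ≠ 0)
  rw [profileDeriv, hden, Complex.ofReal_div _ (2 * (b + Real.cos θ))]
  field_simp

/-- The region between the unit disks with centres `±(1 + e / 2)` where the gradient of the profile
blows up as `e` tends to `0`. -/
def gap (e : ℝ) : Set ℂ := {ζ | |ζ.re| < 1 + e / 2 - √(1 - ζ.im ^ 2) ∧ |ζ.im| < √3 / 2}

/-- The leading part of `profileDeriv (1 + e / 2)` in `gap e`. -/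
noncomputable def leadingDeriv (e : ℝ) (ζ : ℂ) : ℂ :=
  ⟨1 / (e + ζ.im ^ 2), 2 * ζ.re * ζ.im / (e + ζ.im ^ 2) ^ 2⟩

theorem abs_im_lt_of_mem_gap {e : ℝ} (hζ : ζ ∈ gap e) : |ζ.im| < 7 / 8 := by
  have : √3 < 7 / 4 := by rw [Real.sqrt_lt' (by norm_num)]; norm_num
  linarith [hζ.2]

theorem im_sq_lt_of_mem_gap {e : ℝ} (hζ : ζ ∈ gap e) : ζ.im ^ 2 < 3 / 4 := by
  have h3 : √3 ^ 2 = 3 := Real.sq_sqrt (by norm_num)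
  have := sq_lt_sq' (by linarith [abs_nonneg ζ.im, hζ.2]) hζ.2
  rw [sq_abs] at this
  linarith

theorem abs_re_le_of_mem_gap {e : ℝ} (he : 0 < e) (hζ : ζ ∈ gap e) :
    |ζ.re| ≤ 2 / 3 * (e + ζ.im ^ 2) := by
  have hsqrt : 1 - 2 / 3 * ζ.im ^ 2 ≤ √(1 - ζ.im ^ 2) :=
    Real.le_sqrt_of_sq_le (by nlinarith [sq_nonneg ζ.im, im_sq_lt_of_mem_gap hζ])
  linarith [hζ.1]

theorem re_sq_le_of_mem_gap {e : ℝ} (he : 0 < e) (hζ : ζ ∈ gap e) :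
    ζ.re ^ 2 ≤ 4 / 9 * (e + ζ.im ^ 2) ^ 2 := by
  have h := abs_re_le_of_mem_gap he hζ
  have := sq_le_sq' (by linarith [abs_nonneg ζ.re]) h
  rw [sq_abs] at this
  linarith

theorem one_lt_norm_sub_of_mem_gap {e : ℝ} (hζ : ζ ∈ gap e) : 1 < ‖ζ - (1 + e / 2 : ℝ)‖ := by
  have hsqrt := Real.lt_sq_of_sqrt_lt (lt_sub_comm.mp ((le_abs_self _).trans_lt hζ.1))
  rw [← one_lt_sq_iff₀ (norm_nonneg _), ← Complex.normSq_eq_norm_sq, Complex.normSq_apply]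
  simp only [Complex.sub_re, Complex.sub_im, Complex.ofReal_re, Complex.ofReal_im, sub_zero]
  linarith

theorem one_lt_norm_add_of_mem_gap {e : ℝ} (hζ : ζ ∈ gap e) : 1 < ‖ζ + (1 + e / 2 : ℝ)‖ := by
  have hneg : -ζ ∈ gap e := by simpa [gap] using hζ
  rw [← norm_neg, neg_add, ← sub_eq_add_neg]
  exact one_lt_norm_sub_of_mem_gap hneg

theorem abs_im_leadingDeriv_le {e : ℝ} (he : 0 < e) (hζ : ζ ∈ gap e) :
    |(leadingDeriv e ζ).im| ≤ 1 / √e := by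
  have hs : 0 < √e := Real.sqrt_pos.mpr he
  have ht : 0 < e + ζ.im ^ 2 := by positivity
  have hamgm : 2 * (√e * |ζ.im|) ≤ e + ζ.im ^ 2 := by
    nlinarith [sq_nonneg (√e - |ζ.im|), sq_abs ζ.im, Real.sq_sqrt he.le]
  have hprod := mul_le_mul (abs_re_le_of_mem_gap he hζ) hamgm (by positivity) (by positivity)
  rw [leadingDeriv, abs_div, abs_mul, abs_mul, abs_two, abs_of_pos (pow_pos ht 2),
    div_le_div_iff₀ (by positivity) hs]
  linarith [pow_pos ht 2]

theorem norm_leadingDeriv_le {e : ℝ} (he : 0 < e) (he1 : e < 1) (hζ : ζ ∈ gap e) :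
    ‖leadingDeriv e ζ‖ ≤ 2 / e := by
  have hre : |(leadingDeriv e ζ).re| ≤ 1 / e := by
    rw [leadingDeriv, abs_of_pos (by positivity)]
    exact one_div_le_one_div_of_le he (le_add_of_nonneg_right (sq_nonneg _))
  have him : 1 / √e ≤ 1 / e :=
    one_div_le_one_div_of_le he (Real.le_sqrt_of_sq_le (by nlinarith))
  calc ‖leadingDeriv e ζ‖ ≤ |(leadingDeriv e ζ).re| + |(leadingDeriv e ζ).im| :=
        Complex.norm_le_abs_re_add_abs_im _
    _ ≤ 1 / e + 1 / e := add_le_add hre ((abs_im_leadingDeriv_le he hζ).trans him)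
    _ = 2 / e := by ring

theorem pole_sq_sub_sq {e : ℝ} (he : 0 < e) (x y : ℝ) :
    (pole (1 + e / 2) : ℂ) ^ 2 - (⟨x, y⟩ : ℂ) ^ 2 =
      (e + y ^ 2 : ℝ) - (2 * x * y : ℝ) * Complex.I + (e ^ 2 / 4 - x ^ 2 : ℝ) := by
  have hpole : (pole (1 + e / 2) : ℂ) ^ 2 = (((1 + e / 2) ^ 2 - 1 : ℝ) : ℂ) := by
    exact_mod_cast pole_sq (by linarith)
  rw [hpole, show (⟨x, y⟩ : ℂ) = x + y * Complex.I by apply Complex.ext <;> simp]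
  push_cast
  linear_combination (-(y : ℂ) ^ 2) * Complex.I_sq

/-- Here `1 / t + q / t ^ 2` is the first order expansion of `1 / (t - q + r)` in `q`. -/
theorem norm_one_div_sub_expansion_le {t : ℝ} {q r : ℂ} (ht : 0 < t) (ht1 : t < 1)
    (hq : ‖q‖ ^ 2 ≤ 16 / 9 * t ^ 3) (hr : ‖r‖ ≤ 4 / 9 * t ^ 2) (hτ : t / 2 ≤ ‖t - q + r‖) :
    ‖1 / (t - q + r) - (1 / t + q / t ^ 2)‖ ≤ 9 := by
  have hτ0 : (t : ℂ) - q + r ≠ 0 := norm_pos_iff.mp (by linarith)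
  have ht0 : (t : ℂ) ≠ 0 := by exact_mod_cast ht.ne'
  have hq' : ‖q‖ ≤ 4 / 3 * t := by
    rw [← sq_le_sq₀ (norm_nonneg _) (by positivity)]
    nlinarith [pow_pos ht 2]
  have hnum : ‖q ^ 2 - r * (t + q)‖ ≤ 16 / 9 * t ^ 3 + 4 / 9 * t ^ 2 * (t + 4 / 3 * t) := by
    have ht' : ‖(t : ℂ) + q‖ ≤ t + 4 / 3 * t := by
      refine (norm_add_le _ _).trans (add_le_add ?_ hq')
      rw [Complex.norm_real, Real.norm_eq_abs, abs_of_pos ht]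
    refine (norm_sub_le _ _).trans ?_
    rw [norm_pow, norm_mul]
    gcongr
  have hden : t / 2 * t ^ 2 ≤ ‖(t : ℂ) - q + r‖ * t ^ 2 := by gcongr
  calc ‖1 / (t - q + r) - (1 / t + q / t ^ 2)‖
      = ‖(q ^ 2 - r * (t + q)) / ((t - q + r) * t ^ 2)‖ := by congr 1; field_simp; ring
    _ = ‖q ^ 2 - r * (t + q)‖ / (‖(t : ℂ) - q + r‖ * t ^ 2) := by
        rw [norm_div, norm_mul, norm_pow, Complex.norm_real, Real.norm_eq_abs, abs_of_pos ht]
    _ ≤ 9 := by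
        rw [div_le_iff₀ (by positivity)]
        nlinarith [pow_pos ht 3]

theorem half_le_norm_pole_sq_sub_sq {e : ℝ} (he : 0 < e) (he1 : e < 1 / 4) (hζ : ζ ∈ gap e) :
    (e + ζ.im ^ 2) / 2 ≤ ‖(pole (1 + e / 2) : ℂ) ^ 2 - ζ ^ 2‖ := by
  have hx2 := re_sq_le_of_mem_gap he hζ
  have hy := im_sq_lt_of_mem_gap hζ
  obtain ⟨x, y⟩ := ζ
  rw [pole_sq_sub_sq he]
  refine le_trans ?_ ((le_abs_self _).trans (Complex.abs_re_le_norm _))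
  simp only [Complex.add_re, Complex.sub_re, Complex.ofReal_re, Complex.re_ofReal_mul,
    Complex.I_re, mul_zero, sub_zero]
  nlinarith [sq_nonneg e, sq_nonneg y]

theorem norm_profileDeriv_sub_le {e : ℝ} (he : 0 < e) (he1 : e < 1 / 4) (hζ : ζ ∈ gap e) :
    ‖profileDeriv (1 + e / 2) ζ - leadingDeriv e ζ‖ ≤ 10 := by
  have hb : 1 < 1 + e / 2 := by linarith
  have hx2 := re_sq_le_of_mem_gap he hζ
  have hy := im_sq_lt_of_mem_gap hζ
  have hτ := half_le_norm_pole_sq_sub_sq he he1 hζ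
  have hlead : leadingDeriv e ζ = (1 / (e + ζ.im ^ 2) : ℝ) +
      (2 * ζ.re * ζ.im / (e + ζ.im ^ 2) ^ 2 : ℝ) * Complex.I := (Complex.re_add_im _).symm
  rw [hlead]
  obtain ⟨x, y⟩ := ζ
  have het : e ≤ e + y ^ 2 := by linarith [sq_nonneg y]
  have hyt : y ^ 2 ≤ e + y ^ 2 := by linarith
  rw [pole_sq_sub_sq he] at hτ
  rw [profileDeriv, pole_sq_sub_sq he]
  set t : ℝ := e + y ^ 2
  have ht0 : 0 < t := by linarith
  have hq : ‖((2 * x * y : ℝ) : ℂ) * Complex.I‖ ^ 2 ≤ 16 / 9 * t ^ 3 := by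
    rw [norm_mul, Complex.norm_I, mul_one, Complex.norm_real, Real.norm_eq_abs, sq_abs]
    linarith [mul_le_mul hx2 hyt (sq_nonneg y) (by positivity)]
  have hr : ‖((e ^ 2 / 4 - x ^ 2 : ℝ) : ℂ)‖ ≤ 4 / 9 * t ^ 2 := by
    rw [Complex.norm_real, Real.norm_eq_abs, abs_le]
    constructor <;> nlinarith [sq_nonneg e, sq_nonneg x]
  set τ : ℂ := (t : ℂ) - (2 * x * y : ℝ) * Complex.I + (e ^ 2 / 4 - x ^ 2 : ℝ) with hτdef
  have hk : ‖((pole (1 + e / 2) / height (1 + e / 2) - 1 : ℝ) : ℂ) / τ‖ ≤ 1 := by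
    rw [norm_div, Complex.norm_real, Real.norm_eq_abs,
      abs_of_nonneg (by linarith [one_le_pole_div_height hb]), div_le_one (by linarith)]
    linarith [pole_div_height_le hb]
  have hexp := norm_one_div_sub_expansion_le ht0 (by linarith) hq hr hτ
  rw [← hτdef] at hexp
  refine le_trans (le_of_eq ?_) ((norm_add_le_of_le hk hexp).trans (by norm_num))
  congr 1
  push_cast
  ring

end Profile

/-! ### Comparison with the profile in a single gap -/

section Localization

open scoped ComplexConjugate

variable {ε δ : ℝ}

theorem vanishesNear_sub_profile {b : ℝ} (hb : 1 < b) {φ : ℂ → ℂ} (hφ : ∀ z, AnalyticAt ℂ φ z)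
    {c₁ c₂ p : ℂ} (hφ₁ : ∀ z, ‖φ z + b‖ = ‖z - c₁‖) (hφ₂ : ∀ z, ‖φ z - b‖ = ‖z - c₂‖)
    {U : ℂ → ℝ} {ρ α β N : ℝ}
    (hU : ∀ q ∈ ball p ρ, 1 < ‖q - c₁‖ → 1 < ‖q - c₂‖ → HarmonicAt U q)
    (hUc : ContinuousOn U {q | q ∈ closedBall p ρ ∧ 1 ≤ ‖q - c₁‖ ∧ 1 ≤ ‖q - c₂‖})
    (hα : ∀ z, ‖z - c₁‖ = 1 → U z = α) (hβ : ∀ z, ‖z - c₂‖ = 1 → U z = β)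
    (hN : ∀ q ∈ closedBall p ρ, 1 ≤ ‖q - c₁‖ → 1 ≤ ‖q - c₂‖ → |U q - (α + β) / 2| ≤ N) :
    VanishesNear c₁ c₂ p ρ (N + |β - α| / 2)
      (fun z => U z - ((α + β) / 2 + (β - α) * profile b (φ z))) := by
  have hharm (q : ℂ) (h₁ : 1 ≤ ‖q - c₁‖) (h₂ : 1 ≤ ‖q - c₂‖) :
      HarmonicAt (fun z => (α + β) / 2 + (β - α) * profile b (φ z)) q :=
    (harmonicAt_const _).add ((harmonicAt_profile_comp hb (hφ q) (by rwa [hφ₂])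
      (by rwa [hφ₁])).const_smul (c := β - α))
  refine ⟨fun q hq h₁ h₂ => (hU q hq h₁ h₂).sub (hharm q h₁.le h₂.le), ?_, ?_, ?_⟩
  · exact hUc.sub fun q hq => (hharm q hq.2.1 hq.2.2).1.continuousAt.continuousWithinAt
  · rintro q - - - (h₁ | h₂)
    · rw [hα q h₁, profile_eq_neg_half hb (by rwa [hφ₁])]; ring
    · rw [hβ q h₂, profile_eq_half hb (by rwa [hφ₂])]; ring
  · intro q hq h₁ h₂
    have hprofile : |(β - α) * profile b (φ q)| ≤ |β - α| / 2 := by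
      rw [abs_mul, div_eq_mul_one_div]
      gcongr
      exact abs_profile_le hb (by rwa [hφ₂]) (by rwa [hφ₁])
    rw [← sub_sub]
    exact (abs_sub _ _).trans (add_le_add (hN q hq h₁ h₂) hprofile)

theorem rightCenter_zero : rightCenter ε δ 0 = ((1 + ε / 2 : ℝ) : ℂ) := by
  apply Complex.ext <;> simp [rightCenter]

theorem leftCenter_zero : leftCenter ε δ 0 = -((1 + ε / 2 : ℝ) : ℂ) := by
  apply Complex.ext <;> simp [leftCenter]; ring

theorem abs_sub_le_of_mem_closedBall {p q : ℂ} {ρ : ℝ} (hq : q ∈ closedBall p ρ) :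
    |q.re - p.re| ≤ ρ ∧ |q.im - p.im| ≤ ρ := by
  rw [mem_closedBall, dist_eq_norm] at hq
  exact ⟨(Complex.abs_re_le_norm (q - p)).trans hq, (Complex.abs_im_le_norm (q - p)).trans hq⟩

theorem one_lt_norm_sub_of_abs_im_lt_one (hδ : 0 < δ) {q : ℂ} (h : |q.im| < 1) {n : ℤ}
    (hn : n ≠ 0) : 1 < ‖q - leftCenter ε δ n‖ ∧ 1 < ‖q - rightCenter ε δ n‖ := by
  have := one_lt_abs_sub_of_ne hδ (y := q.im) (n := 0) (m := n) (by simp; linarith) hn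
  exact ⟨one_lt_norm_sub_of_im this, one_lt_norm_sub_of_im this⟩

theorem mem_openExterior_of_abs_im_lt_one (hδ : 0 < δ) {q : ℂ} (h : |q.im| < 1)
    (h₁ : 1 < ‖q - leftCenter ε δ 0‖) (h₂ : 1 < ‖q - rightCenter ε δ 0‖) :
    q ∈ openExterior ε δ := by
  intro n
  rcases eq_or_ne n 0 with rfl | hn
  · exact ⟨h₁, h₂⟩
  · exact one_lt_norm_sub_of_abs_im_lt_one hδ h hn

theorem mem_closedExterior_of_abs_im_lt_one (hδ : 0 < δ) {q : ℂ} (h : |q.im| < 1)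
    (h₁ : 1 ≤ ‖q - leftCenter ε δ 0‖) (h₂ : 1 ≤ ‖q - rightCenter ε δ 0‖) :
    q ∈ closedExterior ε δ := by
  intro n
  rcases eq_or_ne n 0 with rfl | hn
  · exact ⟨h₁, h₂⟩
  · exact (one_lt_norm_sub_of_abs_im_lt_one hδ h hn).imp le_of_lt le_of_lt

theorem one_lt_norm_sub_leftCenter (hε : 0 < ε) {q : ℂ} (hre : 0 < q.re) (n : ℤ) :
    1 < ‖q - leftCenter ε δ n‖ := by
  refine one_lt_norm_sub_of_re (lt_abs.mpr (Or.inl ?_))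
  simp only [leftCenter]
  linarith

theorem one_lt_norm_sub_rightCenter (hδ : 0 < δ) {q : ℂ} (him : q.im ∈ Ioo (-1) 3) {n : ℤ}
    (hn₀ : n ≠ 0) (hn₁ : n ≠ 1) : 1 < ‖q - rightCenter ε δ n‖ := by
  refine one_lt_norm_sub_of_im (lt_abs.mpr ?_)
  simp only [rightCenter]
  rcases lt_or_gt_of_ne hn₀ with hn | hn
  · have : (n : ℝ) ≤ -1 := by exact_mod_cast (by lia : n ≤ -1)
    exact Or.inl (by nlinarith [him.1])
  · have : (2 : ℝ) ≤ n := by exact_mod_cast (by lia : (2 : ℤ) ≤ n)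
    exact Or.inr (by nlinarith [him.2])

theorem mem_openExterior_of_mem_Ioo (hε : 0 < ε) (hδ : 0 < δ) {q : ℂ} (hre : 0 < q.re)
    (him : q.im ∈ Ioo (-1) 3) (h₁ : 1 < ‖q - rightCenter ε δ 0‖)
    (h₂ : 1 < ‖q - rightCenter ε δ 1‖) : q ∈ openExterior ε δ := by
  refine fun n => ⟨one_lt_norm_sub_leftCenter hε hre n, ?_⟩
  rcases eq_or_ne n 0 with rfl | hn₀
  · exact h₁
  rcases eq_or_ne n 1 with rfl | hn₁
  · exact h₂
  exact one_lt_norm_sub_rightCenter hδ him hn₀ hn₁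

theorem mem_closedExterior_of_mem_Ioo (hε : 0 < ε) (hδ : 0 < δ) {q : ℂ} (hre : 0 < q.re)
    (him : q.im ∈ Ioo (-1) 3) (h₁ : 1 ≤ ‖q - rightCenter ε δ 0‖)
    (h₂ : 1 ≤ ‖q - rightCenter ε δ 1‖) : q ∈ closedExterior ε δ := by
  refine fun n => ⟨(one_lt_norm_sub_leftCenter hε hre n).le, ?_⟩
  rcases eq_or_ne n 0 with rfl | hn₀
  · exact h₁
  rcases eq_or_ne n 1 with rfl | hn₁
  · exact h₂
  exact (one_lt_norm_sub_rightCenter hδ him hn₀ hn₁).le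

theorem abs_sub_midpoint_le {w α β N : ℝ} (h : |w - β| ≤ N) :
    |w - (α + β) / 2| ≤ N + |β - α| / 2 :=
  calc |w - (α + β) / 2| = |(w - β) + (β - α) / 2| := by ring_nf
    _ ≤ N + |β - α| / 2 := by
      grw [abs_add_le, h, abs_div, abs_two]

theorem vanishesNear_vertical (hε : 0 < ε) (hδ : 0 < δ) {U : ℂ → ℝ} {α β N : ℝ}
    (hU : HarmonicOnNhd U (openExterior ε δ)) (hUc : ContinuousOn U (closedExterior ε δ))
    (hα : ∀ z, ‖z - leftCenter ε δ 0‖ = 1 → U z = α)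
    (hβ : ∀ z, ‖z - rightCenter ε δ 0‖ = 1 → U z = β)
    (hN : ∀ z ∈ closedExterior ε δ, |z.re| < 4 → |z.im| ≤ 3 → |U z - β| ≤ N) {p : ℂ}
    (him : |p.im| < 7 / 8) (hre : |p.re| < 3) :
    VanishesNear (leftCenter ε δ 0) (rightCenter ε δ 0) p (1 / 10) (N + |β - α|)
      (fun z => U z - ((α + β) / 2 + (β - α) * profile (1 + ε / 2) z)) := by
  have hcoord : ∀ q ∈ closedBall p (1 / 10), |q.im| < 1 ∧ |q.re| < 4 := fun q hq => by
    obtain ⟨h₁, h₂⟩ := abs_sub_le_of_mem_closedBall hq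
    constructor <;> linarith [abs_sub_abs_le_abs_sub q.re p.re, abs_sub_abs_le_abs_sub q.im p.im]
  have hclosed (q) (hq : q ∈ closedBall p (1 / 10)) :=
    mem_closedExterior_of_abs_im_lt_one (ε := ε) hδ (hcoord q hq).1
  have h := vanishesNear_sub_profile (b := 1 + ε / 2) (by linarith) (φ := fun z => z)
    (fun z => analyticAt_id) (c₁ := leftCenter ε δ 0) (c₂ := rightCenter ε δ 0)
    (fun z => by rw [leftCenter_zero, sub_neg_eq_add]) (fun z => by rw [rightCenter_zero])
    (fun q hq h₁ h₂ => hU q (mem_openExterior_of_abs_im_lt_one hδ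
      (hcoord q (ball_subset_closedBall hq)).1 h₁ h₂))
    (hUc.mono fun q hq => hclosed q hq.1 hq.2.1 hq.2.2) hα hβ (N := N + |β - α| / 2)
    (fun q hq h₁ h₂ => abs_sub_midpoint_le
      (hN q (hclosed q hq h₁ h₂) (hcoord q hq).2 (by linarith [(hcoord q hq).1])))
  rwa [add_assoc, add_halves] at h

/-- Coordinates in which the gap between `D_{R0}` and `D_{R1}` is vertical. -/
noncomputable def rot (ε δ : ℝ) (z : ℂ) : ℂ := -Complex.I * (z - ⟨1 + ε / 2, 1 + δ / 2⟩)

theorem norm_rot_sub (z : ℂ) : ‖rot ε δ z - ((1 + δ / 2 : ℝ) : ℂ)‖ = ‖z - rightCenter ε δ 1‖ := by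
  have : rot ε δ z - ((1 + δ / 2 : ℝ) : ℂ) = -Complex.I * (z - rightCenter ε δ 1) := by
    apply Complex.ext <;> simp [rot, rightCenter]; ring
  rw [this, norm_mul, norm_neg, Complex.norm_I, one_mul]

theorem norm_rot_add (z : ℂ) : ‖rot ε δ z + ((1 + δ / 2 : ℝ) : ℂ)‖ = ‖z - rightCenter ε δ 0‖ := by
  have : rot ε δ z + ((1 + δ / 2 : ℝ) : ℂ) = -Complex.I * (z - rightCenter ε δ 0) := by
    apply Complex.ext <;> simp [rot, rightCenter]
  rw [this, norm_mul, norm_neg, Complex.norm_I, one_mul]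

theorem vanishesNear_horizontal (hε : 0 < ε) (hδ : 0 < δ) {U : ℂ → ℝ} {α β N : ℝ}
    (hU : HarmonicOnNhd U (openExterior ε δ)) (hUc : ContinuousOn U (closedExterior ε δ))
    (hα : ∀ z, ‖z - rightCenter ε δ 0‖ = 1 → U z = α)
    (hβ : ∀ z, ‖z - rightCenter ε δ 1‖ = 1 → U z = β)
    (hN : ∀ z ∈ closedExterior ε δ, |z.re| < 4 → |z.im| ≤ 3 → |U z - α| ≤ N) {p : ℂ}
    (hre : p.re ∈ Ioo (1 / 10) 3) (him : p.im ∈ Ioo (-(1 / 2)) (5 / 2)) :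
    VanishesNear (rightCenter ε δ 0) (rightCenter ε δ 1) p (1 / 10) (N + |β - α|)
      (fun z => U z - ((α + β) / 2 + (β - α) * profile (1 + δ / 2) (rot ε δ z))) := by
  have hcoord : ∀ q ∈ closedBall p (1 / 10), q.re ∈ Ioo 0 4 ∧ q.im ∈ Ioo (-1) 3 := fun q hq => by
    obtain ⟨h₁, h₂⟩ := abs_sub_le_of_mem_closedBall hq
    rw [abs_le] at h₁ h₂
    refine ⟨⟨?_, ?_⟩, ?_, ?_⟩ <;> linarith [hre.1, hre.2, him.1, him.2]
  have hclosed (q) (hq : q ∈ closedBall p (1 / 10)) :=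
    mem_closedExterior_of_mem_Ioo hε hδ (hcoord q hq).1.1 (hcoord q hq).2
  have h := vanishesNear_sub_profile (b := 1 + δ / 2) (by linarith) (φ := rot ε δ)
    (fun z => by unfold rot; fun_prop) (c₁ := rightCenter ε δ 0) (c₂ := rightCenter ε δ 1)
    norm_rot_add norm_rot_sub
    (fun q hq h₁ h₂ => hU q (mem_openExterior_of_mem_Ioo hε hδ
      (hcoord q (ball_subset_closedBall hq)).1.1 (hcoord q (ball_subset_closedBall hq)).2 h₁ h₂))
    (hUc.mono fun q hq => hclosed q hq.1 hq.2.1 hq.2.2) hα hβ (N := N + |β - α| / 2)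
    (fun q hq h₁ h₂ => by
      obtain ⟨hre, him⟩ := hcoord q hq
      rw [add_comm α, abs_sub_comm β]
      exact abs_sub_midpoint_le (hN q (hclosed q hq h₁ h₂)
        (abs_lt.mpr (by constructor <;> linarith [hre.1, hre.2]))
        (abs_le.mpr (by constructor <;> linarith [him.1, him.2]))))
  rwa [add_assoc, add_halves] at h

end Localization

/-! ### The potential difference across the vertical gap -/

section Flux

open scoped ComplexConjugate

variable {ε δ M κ cL cR : ℝ} {u : ℂ → ℝ}

theorem VanishesNear.abs_normalDeriv_le {c₁ c₂ E : ℂ} {ρ M G : ℝ} {v : ℂ → ℝ}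
    (h : VanishesNear c₁ c₂ (c₁ + E) ρ M v) (hρ : 0 < ρ) (hρ1 : ρ ≤ 1) (hE : ‖E‖ = 1)
    (hc : 1 < ‖c₁ + E - c₂‖)
    (hG : HasDerivWithinAt (fun t : ℝ => v (c₁ + (1 - t : ℝ) * E)) G (Iic 0) 0) :
    |G| ≤ 64 * M / ρ ^ 2 := by
  have h0 : v (c₁ + (1 - 0 : ℝ) * E) = 0 := by
    rw [sub_zero, Complex.ofReal_one, one_mul]
    exact h.zero _ (mem_closedBall_self hρ.le) (by simp [hE]) hc.le (Or.inl (by simp [hE]))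
  rw [hasDerivWithinAt_iff_tendsto_slope, Iic_sdiff_right] at hG
  refine le_of_tendsto hG.abs ?_
  have hfar : ∀ᶠ t : ℝ in 𝓝[<] 0, 1 < ‖c₁ + (1 - t : ℝ) * E - c₂‖ := by
    have hcont : Continuous fun t : ℝ => ‖c₁ + (1 - t : ℝ) * E - c₂‖ := by fun_prop
    exact nhdsWithin_le_nhds (hcont.continuousAt.eventually (lt_mem_nhds (by simpa using hc)))
  have hnear : ∀ᶠ t : ℝ in 𝓝[<] 0, -(ρ / 2) < t := nhdsWithin_le_nhds (lt_mem_nhds (by linarith))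
  filter_upwards [hfar, hnear, self_mem_nhdsWithin] with t ht_far ht_near (ht : t < 0)
  have hdist : ‖c₁ + (1 - t : ℝ) * E - c₁‖ = 1 - t := by
    rw [add_sub_cancel_left, norm_mul, hE, mul_one, Complex.norm_real, Real.norm_eq_abs,
      abs_of_pos (by linarith)]
  have hmem : c₁ + (1 - t : ℝ) * E ∈ closedBall (c₁ + E) (ρ / 2) := by
    have : c₁ + (1 - t : ℝ) * E - (c₁ + E) = ((-t : ℝ) : ℂ) * E := by push_cast; ring
    rw [mem_closedBall, dist_eq_norm, this, norm_mul, hE, mul_one, Complex.norm_real,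
      Real.norm_eq_abs, abs_of_pos (by linarith)]
    linarith
  have hv := (h.shrink hmem).abs_le_mul_dist (by linarith) (by linarith)
    (by rw [hdist]; linarith) ht_far.le
  rw [hdist] at hv
  rw [slope_def_field, h0, sub_zero, sub_zero, abs_div, abs_of_neg ht, div_le_iff₀ (by linarith)]
  exact hv.trans_eq (by ring)

/-- The derivative of `2 * profile b` along the inward normal of the unit circle with centre `b`,
at the point of argument `θ`. -/
noncomputable def profileFlux (b θ : ℝ) : ℝ := pole b / height b / (b + Real.cos θ)

theorem add_cos_pos {b : ℝ} (hb : 1 < b) (θ : ℝ) : 0 < b + Real.cos θ := by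
  linarith [Real.neg_one_le_cos θ]

theorem continuous_profileFlux {b : ℝ} (hb : 1 < b) : Continuous (profileFlux b) :=
  continuous_const.div (by fun_prop) fun θ => (add_cos_pos hb θ).ne'

theorem one_div_le_profileFlux {b : ℝ} (hb : 1 < b) (θ : ℝ) :
    1 / (b + Real.cos θ) ≤ profileFlux b θ :=
  div_le_div_of_nonneg_right (one_le_pole_div_height hb) (add_cos_pos hb θ).le

theorem profileFlux_nonneg {b : ℝ} (hb : 1 < b) (θ : ℝ) : 0 ≤ profileFlux b θ :=
  (one_div_nonneg.mpr (add_cos_pos hb θ).le).trans (one_div_le_profileFlux hb θ)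

theorem hasDerivAt_profile_radial {b : ℝ} (hb : 1 < b) (θ : ℝ) :
    HasDerivAt (fun t : ℝ => profile b (b + (1 - t : ℝ) * Complex.exp (θ * Complex.I)))
      (profileFlux b θ / 2) 0 := by
  have hE : ‖Complex.exp (θ * Complex.I)‖ = 1 := Complex.norm_exp_ofReal_mul_I θ
  have hEre : (Complex.exp (θ * Complex.I)).re = Real.cos θ := Complex.exp_ofReal_mul_I_re θ
  have hnormal := congrArg Complex.re (profileDeriv_mul_neg_exp hb θ)
  set E := Complex.exp (θ * Complex.I)
  have hpath : HasDerivAt (fun t : ℝ => (b : ℂ) + ((1 - t : ℝ) : ℂ) * E) (-E) 0 := by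
    simpa using
      ((((hasDerivAt_id (0 : ℝ)).const_sub 1).ofReal_comp).mul_const E).const_add (b : ℂ)
  have hfar : 1 ≤ ‖(b : ℂ) + E + b‖ := by
    refine le_trans ?_ ((le_abs_self _).trans (Complex.abs_re_le_norm _))
    simp only [Complex.add_re, Complex.ofReal_re, hEre]
    linarith [add_cos_pos hb θ]
  have hprofile : HasFDerivAt (profile b)
      (Complex.reCLM ∘L (profileDeriv b (b + E) • (1 : ℂ →L[ℝ] ℂ)))
      ((b : ℂ) + ((1 - (0 : ℝ) : ℝ) : ℂ) * E) := by
    rw [sub_zero, Complex.ofReal_one, one_mul]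
    exact hasFDerivAt_profile hb (by rw [add_sub_cancel_left, hE]) hfar
  refine (hprofile.comp_hasDerivAt (0 : ℝ) hpath).congr_deriv ?_
  rw [Complex.ofReal_re] at hnormal
  rw [profileFlux, div_div _ _ (2 : ℝ), mul_comm _ (2 : ℝ), ← hnormal]
  simp

theorem inv_sqrt_le_integral_profileFlux (hε : 0 < ε) (hε1 : ε < 1) :
    1 / √ε ≤ ∫ θ in (0 : ℝ)..(2 * Real.pi), profileFlux (1 + ε / 2) θ := by
  have hb : 1 < 1 + ε / 2 := by linarith
  have hint (a b : ℝ) := (continuous_profileFlux hb).intervalIntegrable (μ := volume) a b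
  have hs0 : 0 < √ε := Real.sqrt_pos.mpr hε
  have hs1 : √ε < 1 := by rw [Real.sqrt_lt' one_pos]; linarith
  have hss : √ε ^ 2 = ε := Real.sq_sqrt hε.le
  have hpi := Real.pi_gt_three
  have hlower (θ : ℝ) (hθ : θ ∈ Icc Real.pi (Real.pi + √ε)) :
      1 / ε ≤ profileFlux (1 + ε / 2) θ := by
    refine le_trans ?_ (one_div_le_profileFlux hb θ)
    refine one_div_le_one_div_of_le (add_cos_pos hb θ) ?_
    have hcos := Real.one_sub_sq_div_two_le_cos (x := θ - Real.pi)
    rw [Real.cos_sub_pi] at hcos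
    have hsq : (θ - Real.pi) ^ 2 ≤ ε :=
      hss ▸ pow_le_pow_left₀ (by linarith [hθ.1]) (by linarith [hθ.2]) 2
    linarith
  calc 1 / √ε = ∫ θ in Real.pi..Real.pi + √ε, (1 / ε : ℝ) := by
        rw [intervalIntegral.integral_const, add_sub_cancel_left, smul_eq_mul]
        nth_rewrite 3 [← hss]
        field_simp
    _ ≤ ∫ θ in Real.pi..Real.pi + √ε, profileFlux (1 + ε / 2) θ :=
        intervalIntegral.integral_mono_on (by linarith) (by simp) (hint _ _) hlower
    _ ≤ ∫ θ in (0 : ℝ)..(2 * Real.pi), profileFlux (1 + ε / 2) θ :=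
        intervalIntegral.integral_mono_interval (by linarith) (by linarith) (by linarith)
          (Eventually.of_forall (profileFlux_nonneg hb)) (hint _ _)

/-- The sum of `u` and its reflection in the real axis. On `∂D_{R0}`, `∂D_{R1}` it takes the same
constant value, so only the gap towards `D_{L0}` contributes to its normal derivative. -/
noncomputable def conjSum (u : ℂ → ℝ) (z : ℂ) : ℝ := u z + u (conj z)

theorem norm_conj_sub_rightCenter (z : ℂ) (n : ℤ) :
    ‖conj z - rightCenter ε δ n‖ = ‖z - rightCenter ε δ (-n)‖ := by
  have : conj z - rightCenter ε δ n = conj (z - rightCenter ε δ (-n)) := by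
    apply Complex.ext <;> simp [rightCenter]
  rw [this, RCLike.norm_conj]

theorem norm_conj_sub_leftCenter (z : ℂ) (n : ℤ) :
    ‖conj z - leftCenter ε δ n‖ = ‖z - leftCenter ε δ (-n)‖ := by
  have : conj z - leftCenter ε δ n = conj (z - leftCenter ε δ (-n)) := by
    apply Complex.ext <;> simp [leftCenter]
  rw [this, RCLike.norm_conj]

theorem conj_mem_openExterior {z : ℂ} (hz : z ∈ openExterior ε δ) : conj z ∈ openExterior ε δ :=
  fun n => by rw [norm_conj_sub_leftCenter, norm_conj_sub_rightCenter]; exact hz (-n)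

theorem conj_mem_closedExterior {z : ℂ} (hz : z ∈ closedExterior ε δ) :
    conj z ∈ closedExterior ε δ :=
  fun n => by rw [norm_conj_sub_leftCenter, norm_conj_sub_rightCenter]; exact hz (-n)

theorem conj_rightCenter_add_mul_exp (r θ : ℝ) :
    conj (rightCenter ε δ 0 + r * Complex.exp (θ * Complex.I)) =
      rightCenter ε δ 0 + r * Complex.exp ((2 * Real.pi - θ : ℝ) * Complex.I) := by
  have hexp : Complex.exp ((2 * Real.pi - θ : ℝ) * Complex.I) =
      conj (Complex.exp (θ * Complex.I)) := by
    rw [← Complex.exp_conj, map_mul, Complex.conj_ofReal, Complex.conj_I,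
      ← Complex.exp_periodic (θ * -Complex.I)]
    congr 1
    push_cast
    ring
  rw [hexp, map_add, map_mul, Complex.conj_ofReal, rightCenter_zero, Complex.conj_ofReal]

namespace BoundedSolution

theorem bound_nonneg (h : BoundedSolution ε δ M κ u cL cR) : 0 ≤ M := by
  linarith [h.jump_le, abs_nonneg κ]

theorem harmonicOnNhd_conjSum (h : BoundedSolution ε δ M κ u cL cR) :
    HarmonicOnNhd (conjSum u) (openExterior ε δ) := fun z hz =>
  (h.harmonic z hz).add (harmonicAt_comp_linearIsometryEquiv Complex.conjLIE
    (h.harmonic _ (conj_mem_openExterior hz)))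

theorem continuousOn_conjSum (h : BoundedSolution ε δ M κ u cL cR) :
    ContinuousOn (conjSum u) (closedExterior ε δ) :=
  h.cont.add (h.cont.comp Complex.continuous_conj.continuousOn fun _ hz =>
    conj_mem_closedExterior hz)

theorem abs_conjSum_sub_le (h : BoundedSolution ε δ M κ u cL cR) (z : ℂ)
    (hz : z ∈ closedExterior ε δ) (hre : |z.re| < 4) (him : |z.im| ≤ 3) :
    |conjSum u z - 2 * cR| ≤ 8 * M + 2 * |cR - cL| := by
  have h₁ := abs_le.mp (h.bound z hz hre him)
  have h₂ := abs_le.mp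
    (h.bound _ (conj_mem_closedExterior hz) (by simpa using hre) (by simpa using him))
  unfold conjSum
  rw [abs_le]
  constructor <;> linarith

theorem conjSum_left (h : BoundedSolution ε δ M κ u cL cR) (z : ℂ)
    (hz : ‖z - leftCenter ε δ 0‖ = 1) : conjSum u z = 2 * cL := by
  rw [conjSum, h.left z hz, h.left _ (by rw [norm_conj_sub_leftCenter]; simpa using hz), two_mul]

theorem conjSum_right (h : BoundedSolution ε δ M κ u cL cR) (z : ℂ)
    (hz : ‖z - rightCenter ε δ 0‖ = 1) : conjSum u z = 2 * cR := by
  rw [conjSum, h.right z hz, h.right _ (by rw [norm_conj_sub_rightCenter]; simpa using hz),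
    two_mul]

theorem conjSum_right_up (h : BoundedSolution ε δ M κ u cL cR) (z : ℂ)
    (hz : ‖z - rightCenter ε δ 1‖ = 1) : conjSum u z = 2 * cR := by
  rw [conjSum, h.right_up z hz,
    h.right_down _ (by rw [norm_conj_sub_rightCenter]; simpa using hz)]
  ring

theorem abs_normalDeriv_sub_le_of_cos_le (h : BoundedSolution ε δ M κ u cL cR) (hε : 0 < ε)
    (hε1 : ε < 1 / 4) (hδ : 0 < δ) {θ G : ℝ} (hcos : Real.cos θ ≤ -(1 / 2))
    (hG : HasDerivWithinAt (fun t : ℝ => conjSum u (rightCenter ε δ 0 + (1 - t : ℝ) *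
      Complex.exp (θ * Complex.I))) G (Iic 0) 0) :
    |G - (cR - cL) * profileFlux (1 + ε / 2) θ| ≤ 52000 * M + 26000 * |cR - cL| := by
  have hcos' := Real.neg_one_le_cos θ
  have hsin : |Real.sin θ| < 7 / 8 := by
    refine abs_lt_of_sq_lt_sq ?_ (by norm_num)
    nlinarith [Real.sin_sq_add_cos_sq θ]
  have hEre : (Complex.exp (θ * Complex.I)).re = Real.cos θ := Complex.exp_ofReal_mul_I_re θ
  have hEim : (Complex.exp (θ * Complex.I)).im = Real.sin θ := Complex.exp_ofReal_mul_I_im θ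
  have hprofile := hasDerivAt_profile_radial (b := 1 + ε / 2) (by linarith) θ
  rw [← rightCenter_zero (δ := δ)] at hprofile
  have hdiff := hG.sub (((hprofile.const_mul (2 * cR - 2 * cL)).const_add
    ((2 * cL + 2 * cR) / 2)).hasDerivWithinAt)
  have hE : ‖Complex.exp (θ * Complex.I)‖ = 1 := Complex.norm_exp_ofReal_mul_I θ
  set E := Complex.exp (θ * Complex.I)
  have hre : (rightCenter ε δ 0 + E).re = 1 + ε / 2 + Real.cos θ := by
    rw [Complex.add_re, hEre, rightCenter]
  have hv := (vanishesNear_vertical hε hδ h.harmonicOnNhd_conjSum h.continuousOn_conjSum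
    h.conjSum_left h.conjSum_right h.abs_conjSum_sub_le (p := rightCenter ε δ 0 + E)
    (by simpa [rightCenter, hEim] using hsin)
    (by rw [hre, abs_of_pos (by linarith)]; linarith)).swap
  have hle := hv.abs_normalDeriv_le (by norm_num) (by norm_num) hE
    (one_lt_norm_sub_leftCenter hε (by rw [hre]; linarith) 0) hdiff
  have hflux : (2 * cR - 2 * cL) * (profileFlux (1 + ε / 2) θ / 2) =
      (cR - cL) * profileFlux (1 + ε / 2) θ := by ring
  have hd : |2 * cR - 2 * cL| = 2 * |cR - cL| := by rw [← mul_sub, abs_mul, abs_two]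
  rw [hflux, hd, le_div_iff₀ (by norm_num)] at hle
  linarith [abs_nonneg (cR - cL), h.bound_nonneg]

theorem abs_normalDeriv_sub_le_of_lt_cos (h : BoundedSolution ε δ M κ u cL cR) (hε : 0 < ε)
    (hε1 : ε < 1 / 4) (hδ : 0 < δ) {θ G : ℝ} (hsin : 0 ≤ Real.sin θ)
    (hcos : -(1 / 2) < Real.cos θ)
    (hG : HasDerivWithinAt (fun t : ℝ => conjSum u (rightCenter ε δ 0 + (1 - t : ℝ) *
      Complex.exp (θ * Complex.I))) G (Iic 0) 0) :
    |G - (cR - cL) * profileFlux (1 + ε / 2) θ| ≤ 52000 * M + 26000 * |cR - cL| := by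
  have hb : 1 < 1 + ε / 2 := by linarith
  have hEre : (Complex.exp (θ * Complex.I)).re = Real.cos θ := Complex.exp_ofReal_mul_I_re θ
  have hEim : (Complex.exp (θ * Complex.I)).im = Real.sin θ := Complex.exp_ofReal_mul_I_im θ
  have hE : ‖Complex.exp (θ * Complex.I)‖ = 1 := Complex.norm_exp_ofReal_mul_I θ
  set E := Complex.exp (θ * Complex.I)
  have hre : (rightCenter ε δ 0 + E).re = 1 + ε / 2 + Real.cos θ := by
    rw [Complex.add_re, hEre, rightCenter]
  have him : (rightCenter ε δ 0 + E).im = Real.sin θ := by simp [rightCenter, hEim]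
  have hv := vanishesNear_horizontal hε hδ h.harmonicOnNhd_conjSum h.continuousOn_conjSum
    h.conjSum_right h.conjSum_right_up h.abs_conjSum_sub_le (p := rightCenter ε δ 0 + E)
    (by rw [hre]; constructor <;> linarith [Real.cos_le_one θ])
    (by rw [him]; constructor <;> linarith [Real.sin_le_one θ])
  have hfar : 1 < ‖rightCenter ε δ 0 + E - rightCenter ε δ 1‖ := by
    refine one_lt_norm_sub_of_im (lt_abs.mpr (Or.inr ?_))
    rw [him]
    simp only [rightCenter]
    push_cast
    linarith [Real.sin_le_one θ]
  have hle := hv.abs_normalDeriv_le (G := G) (by norm_num) (by norm_num) hE hfar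
    (by simpa using hG.sub_const ((2 * cR + 2 * cR) / 2))
  rw [sub_self, abs_zero, add_zero, le_div_iff₀ (by norm_num)] at hle
  have hflux : |profileFlux (1 + ε / 2) θ| ≤ 4 := by
    rw [abs_of_nonneg (profileFlux_nonneg hb θ), profileFlux, div_le_iff₀ (add_cos_pos hb θ)]
    linarith [pole_div_height_le hb]
  have hprod : |(cR - cL) * profileFlux (1 + ε / 2) θ| ≤ |cR - cL| * 4 := by
    rw [abs_mul]
    gcongr
  linarith [abs_sub G ((cR - cL) * profileFlux (1 + ε / 2) θ), abs_nonneg (cR - cL),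
    h.bound_nonneg]

theorem abs_normalDeriv_add_sub_le (h : BoundedSolution ε δ M κ u cL cR) (hε : 0 < ε)
    (hε1 : ε < 1 / 4) (hδ : 0 < δ) {g : ℝ → ℝ}
    (hg : ∀ θ : ℝ, HasDerivWithinAt (fun t : ℝ => u (rightCenter ε δ 0 + (1 - t : ℝ) *
      Complex.exp (θ * Complex.I))) (g θ) (Iic 0) 0) (θ : ℝ) :
    |g θ + g (2 * Real.pi - θ) - (cR - cL) * profileFlux (1 + ε / 2) θ| ≤
      52000 * M + 26000 * |cR - cL| := by
  have hderiv (θ : ℝ) : HasDerivWithinAt (fun t : ℝ => conjSum u (rightCenter ε δ 0 +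
      (1 - t : ℝ) * Complex.exp (θ * Complex.I))) (g θ + g (2 * Real.pi - θ)) (Iic 0) 0 := by
    simp only [conjSum, conj_rightCenter_add_mul_exp]
    exact (hg θ).add (hg (2 * Real.pi - θ))
  wlog hsin : 0 ≤ Real.sin θ generalizing θ
  · have := this (2 * Real.pi - θ) (by rw [Real.sin_two_pi_sub]; linarith)
    rwa [profileFlux, Real.cos_two_pi_sub, sub_sub_cancel, add_comm (g _)] at this
  rcases le_or_gt (Real.cos θ) (-(1 / 2)) with hcos | hcos
  · exact h.abs_normalDeriv_sub_le_of_cos_le hε hε1 hδ hcos (hderiv θ)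
  · exact h.abs_normalDeriv_sub_le_of_lt_cos hε hε1 hδ hsin hcos (hderiv θ)

theorem abs_sub_mul_integral_profileFlux_le (h : BoundedSolution ε δ M κ u cL cR) (hε : 0 < ε)
    (hε1 : ε < 1 / 4) (hδ : 0 < δ) {g : ℝ → ℝ}
    (hg : ∀ θ : ℝ, HasDerivWithinAt (fun t : ℝ => u (rightCenter ε δ 0 + (1 - t : ℝ) *
      Complex.exp (θ * Complex.I))) (g θ) (Iic 0) 0)
    (hgi : IntervalIntegrable g volume 0 (2 * Real.pi))
    (hg0 : ∫ θ in (0 : ℝ)..(2 * Real.pi), g θ = 0) :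
    |cR - cL| * ∫ θ in (0 : ℝ)..(2 * Real.pi), profileFlux (1 + ε / 2) θ ≤
      (52000 * M + 26000 * |cR - cL|) * (2 * Real.pi) := by
  have hb : 1 < 1 + ε / 2 := by linarith
  have hgi' : IntervalIntegrable (fun θ => g (2 * Real.pi - θ)) volume 0 (2 * Real.pi) := by
    simpa using (hgi.comp_sub_left (2 * Real.pi)).symm
  have hg0' : ∫ θ in (0 : ℝ)..(2 * Real.pi), g (2 * Real.pi - θ) = 0 := by
    rw [intervalIntegral.integral_comp_sub_left (fun θ => g θ)]
    simpa using hg0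
  have hint : ∫ θ in (0 : ℝ)..(2 * Real.pi),
      (g θ + g (2 * Real.pi - θ) - (cR - cL) * profileFlux (1 + ε / 2) θ) =
      -((cR - cL) * ∫ θ in (0 : ℝ)..(2 * Real.pi), profileFlux (1 + ε / 2) θ) := by
    rw [intervalIntegral.integral_sub (hgi.add hgi')
      ((continuous_profileFlux hb).intervalIntegrable _ _ |>.const_mul _),
      intervalIntegral.integral_add hgi hgi', hg0, hg0', intervalIntegral.integral_const_mul,
      add_zero, zero_sub]
  have hle := intervalIntegral.norm_integral_le_of_norm_le_const (a := 0) (b := 2 * Real.pi)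
    (C := 52000 * M + 26000 * |cR - cL|)
    (f := fun θ => g θ + g (2 * Real.pi - θ) - (cR - cL) * profileFlux (1 + ε / 2) θ)
    fun θ _ => h.abs_normalDeriv_add_sub_le hε hε1 hδ hg θ
  have hnonneg : 0 ≤ ∫ θ in (0 : ℝ)..(2 * Real.pi), profileFlux (1 + ε / 2) θ :=
    intervalIntegral.integral_nonneg (by positivity) fun θ _ => profileFlux_nonneg hb θ
  rwa [hint, norm_neg, norm_mul, Real.norm_eq_abs, Real.norm_eq_abs, sub_zero,
    abs_of_nonneg hnonneg, abs_of_pos (by positivity : 0 < 2 * Real.pi)] at hle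

theorem abs_sub_le (h : BoundedSolution ε δ M κ u cL cR) (hε : 0 < ε) (hε1 : ε < 1 / 10 ^ 12)
    (hδ : 0 < δ)
    (hflux : ∃ g : ℝ → ℝ, (∀ θ : ℝ, HasDerivWithinAt (fun t : ℝ => u (rightCenter ε δ 0 +
      (1 - t : ℝ) * Complex.exp (θ * Complex.I))) (g θ) (Iic 0) 0) ∧
      IntervalIntegrable g volume 0 (2 * Real.pi) ∧ ∫ θ in (0 : ℝ)..(2 * Real.pi), g θ = 0) :
    |cR - cL| ≤ 500000 * √ε * M := by
  obtain ⟨g, hg, hgi, hg0⟩ := hflux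
  have hM := h.bound_nonneg
  have hs0 : 0 < √ε := Real.sqrt_pos.mpr hε
  have hs1 : √ε ≤ 1 / 10 ^ 6 := by
    rw [Real.sqrt_le_left (by norm_num)]; norm_num; linarith
  have hle : |cR - cL| * (1 / √ε) ≤ (52000 * M + 26000 * |cR - cL|) * 7 :=
    calc |cR - cL| * (1 / √ε)
        ≤ |cR - cL| * ∫ θ in (0 : ℝ)..(2 * Real.pi), profileFlux (1 + ε / 2) θ := by
          gcongr
          exact inv_sqrt_le_integral_profileFlux hε (by linarith)
      _ ≤ (52000 * M + 26000 * |cR - cL|) * (2 * Real.pi) :=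
          h.abs_sub_mul_integral_profileFlux_le hε (by linarith) hδ hg hgi hg0
      _ ≤ (52000 * M + 26000 * |cR - cL|) * 7 := by
          gcongr
          linarith [Real.pi_lt_d2]
  rw [mul_one_div, div_le_iff₀ hs0] at hle
  nlinarith [mul_nonneg (abs_nonneg (cR - cL)) hs0.le, mul_nonneg hM hs0.le]

end BoundedSolution

end Flux

/-! ### The gradient in the gaps -/

section Gradient

open scoped ComplexConjugate Gradient

variable {ε δ M κ cL cR : ℝ} {u : ℂ → ℝ} {z : ℂ}

theorem toDual_conj (c : ℂ) :
    toDual ℝ ℂ (conj c) = Complex.reCLM ∘L (c • (1 : ℂ →L[ℝ] ℂ)) := by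
  ext w
  simp [Complex.inner, mul_comm]

theorem norm_gradient {F : Type*} [NormedAddCommGroup F] [InnerProductSpace ℝ F]
    [CompleteSpace F] (f : F → ℝ) (x : F) : ‖∇ f x‖ = ‖fderiv ℝ f x‖ := by
  rw [gradient, LinearIsometryEquiv.norm_map]

theorem norm_gradient_sub_leadingDeriv_le {e c d K : ℝ} (he : 0 < e) (he1 : e < 1 / 4)
    {φ : ℂ → ℂ} {a : ℂ} (hφ : HasDerivAt φ a z) (ha : ‖a‖ = 1) (hz : φ z ∈ gap e)
    (hu : DifferentiableAt ℝ u z)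
    (hK : ‖fderiv ℝ (fun z => u z - (c + d * profile (1 + e / 2) (φ z))) z‖ ≤ K) :
    ‖∇ u z - d * conj (leadingDeriv e (φ z) * a)‖ ≤ K + 10 * |d| := by
  have hprofile := (hasFDerivAt_profile (by linarith) (one_lt_norm_sub_of_mem_gap hz).le
    (one_lt_norm_add_of_mem_gap hz).le).comp z hφ.complexToReal_fderiv
  have hdiff : HasGradientAt (fun z => u z - (c + d * profile (1 + e / 2) (φ z)))
      (∇ u z - d * conj (profileDeriv (1 + e / 2) (φ z) * a)) z := by
    rw [hasGradientAt_iff_hasFDerivAt, map_sub, gradient, LinearIsometryEquiv.apply_symm_apply,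
      ← Complex.real_smul, map_smul, toDual_conj]
    refine (hu.hasFDerivAt.sub ((hprofile.const_mul d).const_add c)).congr_fderiv ?_
    ext w
    simp [mul_assoc]
  have herr : ‖(d : ℂ) * conj ((profileDeriv (1 + e / 2) (φ z) - leadingDeriv e (φ z)) * a)‖
      ≤ 10 * |d| := by
    rw [norm_mul, RCLike.norm_conj, norm_mul, ha, mul_one, Complex.norm_real, Real.norm_eq_abs,
      mul_comm]
    gcongr
    exact norm_profileDeriv_sub_le he he1 hz
  rw [← norm_gradient, hdiff.gradient] at hK
  refine le_trans (le_of_eq ?_) (norm_add_le_of_le hK herr)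
  congr 1
  rw [sub_mul, map_sub]
  ring

theorem mem_openExterior_of_mem_gap (hδ : 0 < δ) (hz : z ∈ gap ε) : z ∈ openExterior ε δ :=
  mem_openExterior_of_abs_im_lt_one hδ ((abs_im_lt_of_mem_gap hz).trans (by norm_num))
    (by rw [leftCenter_zero, sub_neg_eq_add]; exact one_lt_norm_add_of_mem_gap hz)
    (by rw [rightCenter_zero]; exact one_lt_norm_sub_of_mem_gap hz)

theorem hasDerivAt_rot : HasDerivAt (rot ε δ) (-Complex.I) z :=
  (((hasDerivAt_id z).sub_const _).const_mul (-Complex.I)).congr_deriv (mul_one _)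

theorem rot_eq (z : ℂ) : rot ε δ z = ⟨z.im - 1 - δ / 2, -(z.re - 1 - ε / 2)⟩ := by
  apply Complex.ext <;> simp [rot] <;> ring

namespace BoundedSolution

theorem abs_sub_le_half (h : BoundedSolution ε δ M κ u cL cR) (hε1 : ε < 1 / 10 ^ 12)
    (hd : |cR - cL| ≤ 500000 * √ε * M) : |cR - cL| ≤ M / 2 := by
  have hs : √ε ≤ 1 / 10 ^ 6 := by
    rw [Real.sqrt_le_left (by norm_num)]
    norm_num
    linarith
  nlinarith [h.bound_nonneg]

theorem norm_gradient_sub_vertical_le (h : BoundedSolution ε δ M κ u cL cR) (hε : 0 < ε)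
    (hε1 : ε < 1 / 10 ^ 12) (hδ : 0 < δ) (hd : |cR - cL| ≤ 500000 * √ε * M) (hz : z ∈ gap ε) :
    ‖∇ u z - ((cR - cL) / (ε + z.im ^ 2) : ℝ)‖ ≤ 1000000 * M := by
  have hM := h.bound_nonneg
  have hd' := h.abs_sub_le_half hε1 hd
  have him := abs_im_lt_of_mem_gap hz
  have hre := abs_re_le_of_mem_gap hε hz
  have hmem := mem_openExterior_of_mem_gap hδ hz
  have hK := (vanishesNear_vertical hε hδ h.harmonic h.cont h.left h.right h.bound (p := z) him
    (by linarith [im_sq_lt_of_mem_gap hz])).norm_fderiv_le (by norm_num) (by norm_num)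
    (hmem 0).1 (hmem 0).2
  have hconst : 512 * (4 * M + |cR - cL| + |cR - cL|) / (1 / 10) ^ 2 ≤ 256000 * M := by
    rw [div_le_iff₀ (by norm_num)]
    linarith
  have hmain := norm_gradient_sub_leadingDeriv_le hε (by linarith) (hasDerivAt_id z) norm_one hz
    ((h.harmonic z hmem).1.differentiableAt two_ne_zero) (hK.trans hconst)
  have hrest : ‖((cR - cL : ℝ) : ℂ) * (-((leadingDeriv ε z).im : ℂ) * Complex.I)‖
      ≤ 500000 * M := by
    rw [norm_mul, norm_mul, norm_neg, Complex.norm_I, mul_one, Complex.norm_real,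
      Complex.norm_real, Real.norm_eq_abs, Real.norm_eq_abs]
    grw [hd, abs_im_leadingDeriv_le hε hz]
    field_simp
    exact le_rfl
  have hconj : conj (leadingDeriv ε z) =
      (1 / (ε + z.im ^ 2) : ℝ) + -((leadingDeriv ε z).im : ℂ) * Complex.I := by
    apply Complex.ext <;> simp only [leadingDeriv, Complex.conj_re, Complex.conj_im,
      Complex.add_re, Complex.add_im, Complex.ofReal_re, Complex.ofReal_im, ← Complex.ofReal_neg,
      Complex.re_ofReal_mul, Complex.im_ofReal_mul, Complex.I_re, Complex.I_im, mul_zero, mul_one,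
      add_zero, zero_add]
  calc ‖∇ u z - ((cR - cL) / (ε + z.im ^ 2) : ℝ)‖
      = ‖(∇ u z - (cR - cL : ℝ) * conj (leadingDeriv ε z * 1)) +
          (cR - cL : ℝ) * (-((leadingDeriv ε z).im : ℂ) * Complex.I)‖ := by
        rw [mul_one, hconj]
        push_cast
        congr 1
        ring
    _ ≤ _ := norm_add_le_of_le hmain hrest
    _ ≤ 1000000 * M := by linarith

theorem mem_Ioo_of_rot_mem_gap (hε : 0 < ε) (hε1 : ε < 1 / 4) (hδ : 0 < δ) (hδ1 : δ < 1 / 4)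
    (hz : rot ε δ z ∈ gap δ) : z.re ∈ Ioo (1 / 10) 3 ∧ z.im ∈ Ioo (-(1 / 2)) (5 / 2) := by
  have hX := abs_im_lt_of_mem_gap hz
  have hY := abs_re_le_of_mem_gap hδ hz
  have hX2 := im_sq_lt_of_mem_gap hz
  simp only [rot_eq, abs_neg, abs_lt, abs_le] at hX hX2 hY
  refine ⟨⟨?_, ?_⟩, ?_, ?_⟩ <;> linarith

theorem norm_gradient_sub_horizontal_le (h : BoundedSolution ε δ M κ u cL cR) (hε : 0 < ε)
    (hε1 : ε < 1 / 10 ^ 12) (hδ : 0 < δ) (hδ1 : δ < 1 / 10 ^ 12)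
    (hd : |cR - cL| ≤ 500000 * √ε * M) {lam : ℝ} (hlam : |κ - lam| ≤ 12 * δ * M)
    (hz : rot ε δ z ∈ gap δ) :
    ‖∇ u z - lam * (Complex.I * conj (leadingDeriv δ (rot ε δ z)))‖ ≤ 1000000 * M := by
  have hM := h.bound_nonneg
  have hd' := h.abs_sub_le_half hε1 hd
  have hκ := h.jump_le
  obtain ⟨hre, him⟩ := mem_Ioo_of_rot_mem_gap hε (by linarith) hδ (by linarith) hz
  have h₁ := (one_lt_norm_sub_of_mem_gap hz).trans_eq (norm_rot_sub z)
  have h₀ := (one_lt_norm_add_of_mem_gap hz).trans_eq (norm_rot_add z)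
  have hmem := mem_openExterior_of_mem_Ioo hε hδ (by linarith [hre.1])
    ⟨by linarith [him.1], by linarith [him.2]⟩ h₀ h₁
  have hK := (vanishesNear_horizontal hε hδ h.harmonic h.cont h.right h.right_up h.bound hre
    him).norm_fderiv_le (by norm_num) (by norm_num) h₀ h₁
  have hconst : 512 * (4 * M + |cR - cL| + |cR + κ - cR|) / (1 / 10) ^ 2 ≤ 332800 * M := by
    rw [add_sub_cancel_left, div_le_iff₀ (by norm_num)]
    linarith
  have hmain := norm_gradient_sub_leadingDeriv_le hδ (by linarith) hasDerivAt_rot (by simp) hz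
    ((h.harmonic z hmem).1.differentiableAt two_ne_zero) (hK.trans hconst)
  rw [add_sub_cancel_left] at hmain
  have hjump : ‖((κ - lam : ℝ) : ℂ) * (Complex.I * conj (leadingDeriv δ (rot ε δ z)))‖
      ≤ 24 * M := by
    rw [norm_mul, norm_mul, RCLike.norm_conj, Complex.norm_I, one_mul, Complex.norm_real,
      Real.norm_eq_abs]
    grw [hlam, norm_leadingDeriv_le hδ (by linarith) hz]
    field_simp
    linarith
  refine le_trans (le_of_eq ?_) ((norm_add_le_of_le hmain hjump).trans (by linarith))
  congr 1
  simp only [map_mul, map_neg, Complex.conj_I]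
  push_cast
  ring

end BoundedSolution

end Gradient

/-! ### Transport from the Euclidean plane to the complex plane -/

section Transport

variable {ε δ : ℝ} {H u : Plane → ℝ}

/-- The isometry `x + iy ↦ (x, y)`, which moves the problem to the complex plane. -/
noncomputable def toPlane : ℂ ≃ₗᵢ[ℝ] Plane := Complex.orthonormalBasisOneI.repr

theorem toPlane_apply (z : ℂ) : toPlane z = !₂[z.re, z.im] := by
  ext i
  fin_cases i <;> simp [toPlane]

@[simp] theorem toPlane_apply_zero (z : ℂ) : toPlane z 0 = z.re := by simp [toPlane_apply]

@[simp] theorem toPlane_apply_one (z : ℂ) : toPlane z 1 = z.im := by simp [toPlane_apply]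

theorem toPlane_rightCenter (n : ℤ) : toPlane (rightCenter ε δ n) = centerR ε δ n := toPlane_apply _

theorem toPlane_leftCenter (n : ℤ) : toPlane (leftCenter ε δ n) = centerL ε δ n := toPlane_apply _

theorem toPlane_vshift : toPlane (vshift δ) = period δ := toPlane_apply _

theorem toPlane_exp (θ : ℝ) : toPlane (Complex.exp (θ * Complex.I)) = circleVec θ := by
  rw [toPlane_apply, Complex.exp_ofReal_mul_I_re, Complex.exp_ofReal_mul_I_im, circleVec]

theorem preimage_inclusions : toPlane ⁻¹' inclusions ε δ =
    (⋃ n, ball (leftCenter ε δ n) 1) ∪ ⋃ n, ball (rightCenter ε δ n) 1 := by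
  simp only [inclusions, preimage_iUnion, preimage_union, diskL, diskR, ← toPlane_leftCenter,
    ← toPlane_rightCenter, toPlane.preimage_ball, toPlane.symm_apply_apply, iUnion_union_distrib]

theorem closedExterior_eq_preimage : closedExterior ε δ = toPlane ⁻¹' (inclusions ε δ)ᶜ := by
  rw [preimage_compl, preimage_inclusions]
  ext z
  simp only [closedExterior, mem_ofPred_eq, mem_compl_iff, mem_union, mem_iUnion, mem_ball,
    dist_eq_norm, not_or, not_exists, not_lt, forall_and]

theorem closure_iUnion_ball (hδ : 0 < δ) {c : ℤ → ℂ} (hc : ∀ n, (c n).im = n * (2 + δ)) :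
    closure (⋃ n, ball (c n) 1) = ⋃ n, closedBall (c n) 1 := by
  apply Subset.antisymm
  · exact closure_minimal (iUnion_mono fun n => ball_subset_closedBall)
      (isClosed_iUnion_closedBall hδ hc)
  · refine iUnion_subset fun n => ?_
    rw [← closure_ball (c n) one_ne_zero]
    exact closure_mono (subset_iUnion (fun n => ball (c n) 1) n)

theorem openExterior_eq_preimage (hδ : 0 < δ) : openExterior ε δ = toPlane ⁻¹' exterior ε δ := by
  have hcl : toPlane ⁻¹' closure (inclusions ε δ) = closure (toPlane ⁻¹' inclusions ε δ) :=
    toPlane.toHomeomorph.preimage_closure _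
  rw [exterior, preimage_compl, hcl, preimage_inclusions, closure_union,
    closure_iUnion_ball hδ fun _ => rfl, closure_iUnion_ball hδ fun _ => rfl,
    openExterior_eq_compl]

theorem toPlane_mem_frontier_ball {c z : ℂ} (h : ‖z - c‖ = 1) :
    toPlane z ∈ frontier (ball (toPlane c) 1) := by
  rw [frontier_ball _ one_ne_zero, mem_sphere, toPlane.dist_map, dist_eq_norm, h]

theorem gradient_comp_linearIsometryEquiv {E F : Type*} [NormedAddCommGroup E]
    [InnerProductSpace ℝ E] [CompleteSpace E] [NormedAddCommGroup F] [InnerProductSpace ℝ F]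
    [CompleteSpace F] (e : E ≃ₗᵢ[ℝ] F) (f : F → ℝ) (x : E) :
    e (gradient (f ∘ e) x) = gradient f (e x) := by
  have hcomp : fderiv ℝ (f ∘ e) x =
      (fderiv ℝ f (e x)).comp (e.toContinuousLinearEquiv : E →L[ℝ] F) :=
    e.toContinuousLinearEquiv.comp_right_fderiv
  refine ext_inner_right ℝ fun w => ?_
  rw [← e.apply_symm_apply w, e.inner_map_map, inner_gradient_left, inner_gradient_left, hcomp]
  rfl

theorem fderiv_comp_toPlane_periodic {f : Plane → ℝ} {z : ℂ}
    (h : gradient f (toPlane z) = gradient f (toPlane z + period δ)) :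
    fderiv ℝ (f ∘ toPlane) (z + vshift δ) = fderiv ℝ (f ∘ toPlane) z := by
  apply (toDual ℝ ℂ).symm.injective
  apply toPlane.injective
  change toPlane (gradient _ _) = toPlane (gradient _ _)
  rw [gradient_comp_linearIsometryEquiv, gradient_comp_linearIsometryEquiv, map_add,
    toPlane_vshift, h]

theorem HasNormalDeriv.comp_toPlane {c : ℂ} {θ g : ℝ}
    (h : HasNormalDeriv u (toPlane c + circleVec θ) (-circleVec θ) g) :
    HasDerivWithinAt (fun t : ℝ => (u ∘ toPlane) (c + (1 - t : ℝ) * Complex.exp (θ * Complex.I)))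
      g (Iic 0) 0 := by
  rw [HasNormalDeriv] at h
  convert h using 1
  funext t
  rw [Function.comp_apply, map_add, ← Complex.real_smul, map_smul, toPlane_exp]
  congr 1
  module

theorem subset_preimage_strip_diff (hε : 0 < ε) (hε1 : ε < 1) :
    {z : ℂ | |z.im| < (2 + δ) / 2 ∧ 4 < |z.re|} ⊆
      toPlane ⁻¹' (strip δ \ closure (diskL ε δ 0 ∪ diskR ε δ 0)) := by
  rintro z ⟨him, hre⟩
  rw [abs_lt] at him
  refine ⟨⟨by rw [toPlane_apply_one]; linarith, by rw [toPlane_apply_one]; linarith⟩, ?_⟩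
  rw [closure_union, diskL, diskR, closure_ball _ one_ne_zero, closure_ball _ one_ne_zero,
    ← toPlane_leftCenter, ← toPlane_rightCenter, mem_union, mem_closedBall, mem_closedBall,
    toPlane.dist_map, toPlane.dist_map, dist_eq_norm, dist_eq_norm, not_or, not_le, not_le]
  have hc : |1 + ε / 2| < 3 := abs_lt.mpr ⟨by linarith, by linarith⟩
  constructor <;> apply one_lt_norm_sub_of_re
  · have := abs_sub_abs_le_abs_sub z.re (-1 - ε / 2)
    rw [← neg_add', abs_neg] at this
    change 1 < |z.re - (-1 - ε / 2)|
    rw [← neg_add']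
    linarith
  · exact (by linarith : 1 < |z.re| - |1 + ε / 2|).trans_le (abs_sub_abs_le_abs_sub _ _)

theorem lintegral_energy_comp_toPlane_lt_top (hε : 0 < ε) (hε1 : ε < 1) (hu : IsSolution ε δ H u) :
    ∫⁻ z in {z : ℂ | |z.im| < (2 + δ) / 2 ∧ 4 < |z.re|},
      ‖fderiv ℝ (fun w => (u ∘ toPlane) w - (H ∘ toPlane) w) z‖ₑ ^ 2 < ∞ := by
  refine (lintegral_mono_set (subset_preimage_strip_diff hε hε1)).trans_lt
    (lt_of_eq_of_lt ?_ hu.energy)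
  rw [← toPlane.measurePreserving.setLIntegral_comp_preimage_emb
    toPlane.toHomeomorph.measurableEmbedding]
  refine lintegral_congr fun z => ?_
  rw [← gradient_comp_linearIsometryEquiv, toPlane.enorm_map, ← ofReal_norm, ← ofReal_norm,
    norm_gradient]
  rfl

theorem exists_planeSolution (hε : 0 < ε) (hε1 : ε < 1) (hδ : 0 < δ) (hH : IsBackground δ H)
    (hu : IsSolution ε δ H u) :
    ∃ cL cR, PlaneSolution ε δ (H ∘ toPlane) (u ∘ toPlane) cL cR := by
  obtain ⟨cL, hcL⟩ := hu.const_left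
  obtain ⟨cR, hcR⟩ := hu.const_right
  obtain ⟨g, hg, hgint, hg0⟩ := hu.flux_right
  have hmem : ∀ z ∈ openExterior ε δ, toPlane z ∈ exterior ε δ := fun z hz => by
    rwa [openExterior_eq_preimage hδ] at hz
  refine ⟨cL, cR, {
    harmonic_background := fun z _ =>
      harmonicAt_comp_linearIsometryEquiv toPlane (hH.harmonic _ trivial)
    periodic_background := fun z => fderiv_comp_toPlane_periodic (hH.periodic _)
    harmonic := fun z hz =>
      harmonicAt_comp_linearIsometryEquiv toPlane (hu.harmonic _ (hmem z hz))
    cont := ?_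
    left := fun z hz => hcL _ (by
      rw [diskL, ← toPlane_leftCenter]; exact toPlane_mem_frontier_ball hz)
    right := fun z hz => hcR _ (by
      rw [diskR, ← toPlane_rightCenter]; exact toPlane_mem_frontier_ball hz)
    flux := ⟨g, fun θ => HasNormalDeriv.comp_toPlane (by rw [toPlane_rightCenter]; exact hg θ),
      hgint, hg0⟩
    energy := lintegral_energy_comp_toPlane_lt_top hε hε1 hu
    periodic := fun z hz => fderiv_comp_toPlane_periodic (hu.periodic _ (hmem z hz)) }⟩
  rw [closedExterior_eq_preimage]
  exact hu.continuousOn.comp toPlane.continuous.continuousOn fun _ hz => hz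

end Transport

section EssSup

variable {F : Type*} [NormedAddCommGroup F] {f : Plane → F} {s : Set Plane}

theorem linftyNorm_le {C : ℝ≥0∞} (hs : MeasurableSet s) (h : ∀ p ∈ s, ‖f p‖ₑ ≤ C) :
    LinftyNorm f s ≤ C := by
  rw [LinftyNorm, eLpNorm_exponent_top]
  refine eLpNormEssSup_le_of_ae_enorm_bound ?_
  filter_upwards [ae_restrict_mem hs] with p hp using h p hp

theorem enorm_le_linftyNorm {p : Plane} (hf : ContinuousOn f s) (hs : IsOpen s) (hp : p ∈ s) :
    ‖f p‖ₑ ≤ LinftyNorm f s := by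
  by_contra! hlt
  have hopen : IsOpen (s ∩ (fun q => ‖f q‖ₑ) ⁻¹' Ioi (LinftyNorm f s)) :=
    hf.enorm.isOpen_inter_preimage hs isOpen_Ioi
  have hnull : volume (s ∩ (fun q => ‖f q‖ₑ) ⁻¹' Ioi (LinftyNorm f s)) = 0 := by
    have hae : ∀ᵐ q ∂volume.restrict s, ‖f q‖ₑ ≤ LinftyNorm f s := by
      rw [LinftyNorm, eLpNorm_exponent_top]
      exact enorm_ae_le_eLpNormEssSup f _
    rw [ae_restrict_iff' hs.measurableSet] at hae
    refine measure_mono_null ?_ (ae_iff.mp hae)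
    exact fun q hq hle => (hle hq.1).not_gt hq.2
  exact (hopen.eq_empty_of_measure_zero hnull).subset ⟨hp, hlt⟩

theorem isOpen_stripTrunc (δ m : ℝ) : IsOpen (stripTrunc δ m) := by
  have h : stripTrunc δ m = (fun p : Plane => p 1) ⁻¹' Ioo (-1 - δ / 2) (1 + δ / 2) ∩
      (fun p : Plane => |p 0|) ⁻¹' Iio m := rfl
  rw [h]
  exact (isOpen_Ioo.preimage (by fun_prop)).inter (isOpen_Iio.preimage (by fun_prop))

theorem stripTrunc_subset_closedBall {δ m : ℝ} :
    stripTrunc δ m ⊆ closedBall (0 : Plane) (m + (1 + δ / 2)) := by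
  rintro p ⟨⟨hlow, hup⟩, hre⟩
  obtain ⟨z, rfl⟩ := toPlane.surjective p
  rw [toPlane_apply_one] at hlow hup
  rw [toPlane_apply_zero] at hre
  rw [mem_closedBall, dist_zero_right, toPlane.norm_map]
  exact (Complex.norm_le_abs_re_add_abs_im z).trans
    (add_le_add hre.le (abs_le.mpr ⟨by linarith, hup.le⟩))

theorem linftyNorm_stripTrunc_lt_top (hf : Continuous f) (δ m : ℝ) :
    LinftyNorm f (stripTrunc δ m) < ∞ := by
  obtain ⟨C, hC⟩ := (isCompact_closedBall (0 : Plane)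
    (m + (1 + δ / 2))).exists_bound_of_continuousOn hf.continuousOn
  refine (linftyNorm_le (C := ENNReal.ofReal C) (isOpen_stripTrunc δ m).measurableSet
    fun p hp => ?_).trans_lt ENNReal.ofReal_lt_top
  rw [← ofReal_norm]
  exact ENNReal.ofReal_le_ofReal (hC p (stripTrunc_subset_closedBall hp))

end EssSup

section Gaps

variable {ε δ M κ : ℝ} {z : ℂ}

theorem toPlane_mem_gapV : toPlane z ∈ gapV ε ↔ z ∈ gap ε := by
  simp only [gapV, gap, mem_ofPred_eq, toPlane_apply_zero, toPlane_apply_one]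

theorem toPlane_mem_gapH : toPlane z ∈ gapH ε δ ↔ rot ε δ z ∈ gap δ := by
  simp only [gapH, gap, mem_ofPred_eq, toPlane_apply_zero, toPlane_apply_one, rot_eq, neg_sq,
    abs_neg]

theorem isOpen_gap (e : ℝ) : IsOpen (gap e) := by
  have h : gap e = {ζ : ℂ | |ζ.re| < 1 + e / 2 - √(1 - ζ.im ^ 2)} ∩ {ζ : ℂ | |ζ.im| < √3 / 2} := rfl
  rw [h]
  exact (isOpen_lt (by fun_prop) (by fun_prop)).inter (isOpen_lt (by fun_prop) (by fun_prop))

theorem measurableSet_gapV (ε : ℝ) : MeasurableSet (gapV ε) := by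
  have h : gapV ε = toPlane.symm ⁻¹' gap ε := by
    ext p
    rw [mem_preimage, ← toPlane_mem_gapV, toPlane.apply_symm_apply]
  rw [h]
  exact ((isOpen_gap ε).preimage toPlane.symm.continuous).measurableSet

theorem measurableSet_gapH (ε δ : ℝ) : MeasurableSet (gapH ε δ) := by
  have hrot : Continuous (rot ε δ) := continuous_iff_continuousAt.mpr fun _ =>
    hasDerivAt_rot.continuousAt
  have h : gapH ε δ = (rot ε δ ∘ toPlane.symm) ⁻¹' gap δ := by
    ext p
    rw [mem_preimage, Function.comp_apply, ← toPlane_mem_gapH, toPlane.apply_symm_apply]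
  rw [h]
  exact ((isOpen_gap δ).preimage (hrot.comp toPlane.symm.continuous)).measurableSet

theorem S_toPlane (z : ℂ) :
    S ε δ (toPlane z) = √δ * (leadingDeriv δ (rot ε δ z)).im := by
  simp only [S, leadingDeriv, rot_eq, toPlane_apply_zero, toPlane_apply_one]
  ring

theorem enorm_S_le (hδ : 0 < δ) {p : Plane} (hp : p ∈ gapH ε δ) : ‖S ε δ p‖ₑ ≤ 2 := by
  obtain ⟨z, rfl⟩ := toPlane.surjective p
  have h := abs_im_leadingDeriv_le hδ (toPlane_mem_gapH.mp hp)
  have hS : |S ε δ (toPlane z)| ≤ 1 := by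
    rw [S_toPlane, abs_mul, abs_of_nonneg (Real.sqrt_nonneg δ)]
    calc √δ * |(leadingDeriv δ (rot ε δ z)).im| ≤ √δ * (1 / √δ) := by gcongr
      _ ≤ 1 := by field_simp; rfl
  rw [Real.enorm_eq_ofReal_abs]
  exact (ENNReal.ofReal_le_one.mpr hS).trans one_le_two

theorem abs_jump_sub_le {H : ℂ → ℝ} (hδ : 0 < δ) (hδ1 : δ ≤ 1) (hH : HarmonicOnNhd H univ)
    (hM : ∀ z : ℂ, |z.re| < 4 → |z.im| < (2 + δ) / 2 → |H z| ≤ M)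
    (hκ : ∀ z, H (z + vshift δ) = H z + κ) :
    |κ - (H ⟨0, 1⟩ - H ⟨0, -1⟩)| ≤ 12 * δ * M := by
  have hcont : Continuous H :=
    continuous_iff_continuousAt.mpr fun z => (hH z trivial).1.continuousAt
  have hgrad : ∀ z ∈ closedBall (0 : ℂ) (1 + δ), ‖fderiv ℝ H z‖ ≤ 12 * M := by
    intro z hz
    rw [mem_closedBall, dist_zero_right] at hz
    have h3M := norm_fderiv_le_of_harmonicOnNhd_ball (z := z) one_pos
      (fun w _ => hH w trivial) fun w hw => by
        have hw1 : ‖w‖ < 2 + δ := by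
          rw [mem_ball, dist_eq_norm] at hw
          linarith [norm_le_norm_add_norm_sub' w z]
        exact abs_le_three_mul hcont hδ hM hκ (by linarith [Complex.abs_re_le_norm w])
          (by linarith [Complex.abs_im_le_norm w])
    linarith
  have hmem : ∀ t : ℝ, |t| ≤ 1 + δ → (⟨0, t⟩ : ℂ) ∈ closedBall (0 : ℂ) (1 + δ) := fun t ht => by
    rw [mem_closedBall, dist_zero_right]
    exact (Complex.norm_le_abs_re_add_abs_im _).trans (by simpa using ht)
  have hmv := (convex_closedBall (0 : ℂ) (1 + δ)).norm_image_sub_le_of_norm_fderiv_le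
    (fun z _ => (hH z trivial).1.differentiableAt two_ne_zero) hgrad
    (hmem 1 (by rw [abs_one]; linarith)) (hmem (1 + δ) (abs_of_pos (by linarith)).le)
  have hup : (⟨0, -1⟩ : ℂ) + vshift δ = ⟨0, 1 + δ⟩ := by
    apply Complex.ext <;> simp [vshift]; ring
  have hdist : (⟨0, 1 + δ⟩ : ℂ) - ⟨0, 1⟩ = (δ : ℂ) * Complex.I := by
    apply Complex.ext <;> simp
  have hjump := hκ ⟨0, -1⟩
  rw [hup] at hjump
  rw [hdist, norm_mul, Complex.norm_I, mul_one, Complex.norm_real, Real.norm_eq_abs,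
    Real.norm_eq_abs, abs_of_pos hδ, hjump] at hmv
  calc |κ - (H ⟨0, 1⟩ - H ⟨0, -1⟩)| = |H ⟨0, -1⟩ + κ - H ⟨0, 1⟩| := by ring_nf
    _ ≤ 12 * δ * M := by linarith

/-- The singular part of the gradient in the horizontal gap, for a unit potential difference. -/
noncomputable def horizontalField (ε δ : ℝ) (p : Plane) : Plane :=
  (1 / (δ + (p 0 - 1 - ε / 2) ^ 2)) • !₂[(0 : ℝ), 1] + (1 / √δ * S ε δ p) • !₂[(1 : ℝ), 0]

/-- The singular part of the gradient in the vertical gap, for a potential difference `√ε`, which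
is the order of magnitude that the zero flux condition leaves. -/
noncomputable def verticalField (ε : ℝ) (p : Plane) : Plane :=
  (√ε / (ε + p 1 ^ 2)) • !₂[(1 : ℝ), 0]

open scoped ComplexConjugate in
theorem horizontalField_toPlane (hδ : 0 < δ) (z : ℂ) :
    horizontalField ε δ (toPlane z) =
      toPlane (Complex.I * conj (leadingDeriv δ (rot ε δ z))) := by
  have hs : √δ ≠ 0 := (Real.sqrt_pos.mpr hδ).ne'
  have hconj : Complex.I * conj (leadingDeriv δ (rot ε δ z)) =
      ⟨(leadingDeriv δ (rot ε δ z)).im, 1 / (δ + (z.re - 1 - ε / 2) ^ 2)⟩ := by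
    apply Complex.ext <;> simp [leadingDeriv, rot_eq, -neg_sub]
  rw [horizontalField, S_toPlane, ← mul_assoc, one_div_mul_cancel hs, one_mul, hconj,
    toPlane_apply_zero, toPlane_apply]
  ext i
  fin_cases i <;> simp

theorem verticalField_toPlane (z : ℂ) :
    verticalField ε (toPlane z) = toPlane (√ε / (ε + z.im ^ 2) : ℝ) := by
  rw [verticalField, toPlane_apply_one, toPlane_apply, Complex.ofReal_re, Complex.ofReal_im]
  ext i
  fin_cases i <;> simp

theorem exists_norm_gradient_sub_le (hε : 0 < ε) (hε1 : ε < 1 / 10 ^ 12) (hδ : 0 < δ)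
    (hδ1 : δ < 1 / 10 ^ 12) {H u : Plane → ℝ} (hH : IsBackground δ H) (hu : IsSolution ε δ H u)
    (hM : ∀ p ∈ stripTrunc δ 4, |H p| ≤ M) :
    ∃ μ, |μ| ≤ 500000 * M ∧
      (∀ p ∈ gapV ε, ‖gradient u p - μ • verticalField ε p‖ ≤ 1000000 * M) ∧
      ∀ p ∈ gapH ε δ, ‖gradient u p - (H !₂[0, 1] - H !₂[0, -1]) • horizontalField ε δ p‖
        ≤ 1000000 * M := by
  have hs : 0 < √ε := Real.sqrt_pos.mpr hε
  obtain ⟨cL, cR, hsol⟩ := exists_planeSolution hε (by linarith) hδ hH hu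
  have hM' : ∀ z : ℂ, |z.re| < 4 → |z.im| < (2 + δ) / 2 → |(H ∘ toPlane) z| ≤ M := by
    intro z hre him
    rw [abs_lt] at him
    exact hM _ ⟨⟨by rw [toPlane_apply_one]; linarith, by rw [toPlane_apply_one]; linarith⟩,
      by rwa [toPlane_apply_zero]⟩
  obtain ⟨κ, hκ, hbdd⟩ := hsol.exists_boundedSolution hε (by linarith) hδ hM'
  have hpot := hbdd.abs_sub_le hε hε1 hδ hsol.flux
  have hjump := abs_jump_sub_le hδ (by linarith) hsol.harmonic_background hM' hκ
  rw [Function.comp_apply, Function.comp_apply, toPlane_apply, toPlane_apply] at hjump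
  refine ⟨(cR - cL) / √ε, ?_, fun p hp => ?_, fun p hp => ?_⟩
  · rw [abs_div, abs_of_pos hs, div_le_iff₀ hs]
    linarith
  · obtain ⟨z, rfl⟩ := toPlane.surjective p
    have hz := hbdd.norm_gradient_sub_vertical_le hε hε1 hδ hpot (toPlane_mem_gapV.mp hp)
    rw [← toPlane.norm_map, map_sub, gradient_comp_linearIsometryEquiv] at hz
    have hlead : ((cR - cL) / √ε) • verticalField ε (toPlane z) =
        toPlane ((cR - cL) / (ε + z.im ^ 2) : ℝ) := by
      rw [verticalField_toPlane, ← map_smul, Complex.real_smul, ← Complex.ofReal_mul,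
        div_mul_div_cancel₀ hs.ne']
    rwa [hlead]
  · obtain ⟨z, rfl⟩ := toPlane.surjective p
    have hz := hbdd.norm_gradient_sub_horizontal_le hε hε1 hδ hδ1 hpot hjump
      (toPlane_mem_gapH.mp hp)
    rwa [← toPlane.norm_map, map_sub, gradient_comp_linearIsometryEquiv, ← Complex.real_smul,
      map_smul, ← horizontalField_toPlane hδ] at hz

theorem enorm_le_mul_of_norm_le {F : Type*} [NormedAddCommGroup F] {x : F} {c : ℝ≥0} {L : ℝ≥0∞}
    (h : ‖x‖ ≤ c * L.toReal) : ‖x‖ₑ ≤ c * L := by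
  rw [← ofReal_norm]
  exact ENNReal.ofReal_le_of_le_toReal (by rwa [ENNReal.toReal_mul, ENNReal.coe_toReal])

theorem abs_le_toReal_linftyNorm {H : Plane → ℝ} (hH : Continuous H) {m : ℝ} {p : Plane}
    (hp : p ∈ stripTrunc δ m) : |H p| ≤ (LinftyNorm H (stripTrunc δ m)).toReal := by
  rw [← ENNReal.ofReal_le_iff_le_toReal (linftyNorm_stripTrunc_lt_top hH δ m).ne,
    ← Real.enorm_eq_ofReal_abs]
  exact enorm_le_linftyNorm hH.continuousOn (isOpen_stripTrunc δ m) hp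

end Gaps

end TwoRows

theorem theorem1p1 :
    ∃ C : ℝ≥0, ∃ r : ℝ, 0 < r ∧
      ∀ ε δ : ℝ, 0 < ε → ε < r → 0 < δ → δ < r →
      ∀ H u : TwoRows.Plane → ℝ, TwoRows.IsBackground δ H → TwoRows.IsSolution ε δ H u →
      ∃ (lam μ : ℝ) (R₁ R₂ : TwoRows.Plane → TwoRows.Plane),
        (∀ p ∈ TwoRows.gapH ε δ,
          gradient u p =
            lam • ((1 / (δ + (p 0 - 1 - ε / 2) ^ 2)) • !₂[(0 : ℝ), 1]
              + (1 / √δ * TwoRows.S ε δ p) • !₂[(1 : ℝ), 0]) + R₁ p) ∧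
        (∀ p ∈ TwoRows.gapV ε,
          gradient u p = (μ * (√ε / (ε + p 1 ^ 2))) • !₂[(1 : ℝ), 0] + R₂ p) ∧
        lam = H !₂[0, 1] - H !₂[0, -1] ∧
        ENNReal.ofReal |μ| ≤ C * TwoRows.LinftyNorm H (TwoRows.stripTrunc δ 4) ∧
        TwoRows.LinftyNorm (TwoRows.S ε δ) (TwoRows.gapH ε δ) ≤ 2 ∧
        TwoRows.S ε δ !₂[1 + ε / 2, 1 + δ / 2] = 0 ∧
        TwoRows.LinftyNorm R₁ (TwoRows.gapH ε δ) + TwoRows.LinftyNorm R₂ (TwoRows.gapV ε)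
          ≤ C * TwoRows.LinftyNorm H (TwoRows.stripTrunc δ 4) := by
  refine ⟨2000000, 1 / 10 ^ 12, by norm_num, fun ε δ hε hε1 hδ hδ1 H u hH hu => ?_⟩
  have hHc : Continuous H :=
    continuous_iff_continuousAt.mpr fun p => (hH.harmonic p trivial).1.continuousAt
  obtain ⟨μ, hμ, hV, hHor⟩ := TwoRows.exists_norm_gradient_sub_le hε hε1 hδ hδ1 hH hu
    fun p hp => TwoRows.abs_le_toReal_linftyNorm hHc hp
  refine ⟨H !₂[0, 1] - H !₂[0, -1], μ,
    fun p => gradient u p - (H !₂[0, 1] - H !₂[0, -1]) • TwoRows.horizontalField ε δ p,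
    fun p => gradient u p - μ • TwoRows.verticalField ε p,
    fun p _ => (add_sub_cancel _ _).symm, fun p _ => ?_, rfl, ?_,
    TwoRows.linftyNorm_le (TwoRows.measurableSet_gapH ε δ) fun p => TwoRows.enorm_S_le hδ,
    by simp [TwoRows.S], ?_⟩
  · simp only [TwoRows.verticalField, smul_smul, add_sub_cancel]
  · rw [← Real.enorm_eq_ofReal_abs]
    refine TwoRows.enorm_le_mul_of_norm_le (hμ.trans ?_)
    gcongr
    norm_num
  · rw [show (2000000 : ℝ≥0) = 1000000 + 1000000 by norm_num, ENNReal.coe_add, add_mul]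
    exact add_le_add
      (TwoRows.linftyNorm_le (TwoRows.measurableSet_gapH ε δ) fun p hp =>
        TwoRows.enorm_le_mul_of_norm_le (by exact_mod_cast hHor p hp))
      (TwoRows.linftyNorm_le (TwoRows.measurableSet_gapV ε) fun p hp =>
        TwoRows.enorm_le_mul_of_norm_le (by exact_mod_cast hV p hp))
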